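/- **Setting.** Let $\Omega\subset\mathbb R^2$ be a bounded domain (a nonempty, bounded, connected open set), $T>0$, $I=(0,T)$, $Q_T=\Omega\times I$. Let $\mu>0$, $\lambda+\mu\ge 0$, $\nu>0$, $\theta>0$, $A>0$, $\gamma>1$, $\rho_\infty\ge 0$ be constants. Consider the system $$\partial_t\rho+\operatorname{div}(\rho\mathbf v)=0,$$ $$\partial_t(\rho\mathbf v)+\operatorname{div}(\rho\mathbf v\otimes\mathbf v)+\nabla(A\rho^\gamma)=\mu\Delta\mathbf v+(\mu+\lambda)\nabla\operatorname{div}\mathbf v-\nu\operatorname{div}\Big(\nabla\mathbf d\odot\nabla\mathbf d-\tfrac12|\nabla\mathbf d|^2\mathbb I\Big),$$ $$\partial_t\mathbf d+\mathbf v\cdot\nabla\mathbf d=\theta(\Delta\mathbf d+|\nabla\mathbf d|^2\mathbf d)$$ in $Q_T$, for $\rho$ real-valued and $\mathbf v,\mathbf d$ with values in $\mathbb R^2$, where $(\nabla\mathbf d\odot\nabla\mathbf d)_{ij}=\partial_i\mathbf d\cdot\partial_j\mathbf d$, with initial data $\rho=\rho_0$, $\rho\mathbf v=\mathbf m_0$,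 $\mathbf d=\mathbf d_0$ in $\Omega$ at $t=0$ and boundary conditions $\mathbf v=\mathbf 0$, $\mathbf d=\mathbf d_0$ on $\partial\Omega\times I$. Assume $\rho_0\ge 0$ and $|\mathbf d_0|=1$ in $\Omega$. A classical solution is a triple $(\rho,\mathbf v,\mathbf d)$ satisfying all this pointwise such that $\rho\in C^1(\overline{Q_T})$ and $\mathbf v,\mathbf d\in C^{2,1}(\overline{Q_T})$, that is, the functions are continuous on $\overline{Q_T}$, and their first derivatives in $(\mathbf x,t)$ and, for $\mathbf v$ and $\mathbf d$, the second derivatives in $\mathbf x$, are continuous in $Q_T$ and extend continuously to $\overline{Q_T}$. The initial energy is $$\mathcal E_0=\int_\Omega\Big(\frac12\frac{|\mathbf m_0|^2}{\rho_0}1_{\{\rho_0>0\}}+Q(\rho_0)+\frac{\nu}{2}|\nabla\mathbf d_0|^2\Big)d\mathbf x,\qquad Q(s)=\frac{A}{\gamma-1}\big(s^\gamma-\gamma s\rho_\infty^{\gamma-1}+(\gamma-1)\rho_\infty^\gamma\big).$$ **Proposition.** (1) There is a positive $c_2$, nondecreasing in both arguments and depending only on $A,\gamma,\mu,\nu,\theta$,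 such that for every bounded domain $\Omega$, every $T>0$, all $\lambda\ge-\mu$ and $\rho_\infty\ge 0$, and every classical solution as above, $$\sup_{t\in[0,T]}\big(\|\sqrt\rho\,\mathbf v\|_{\mathbf L^2(\Omega)}+\|\rho\|_{L^\gamma(\Omega)}+\|\nabla\mathbf d\|_{\mathbf L^2(\Omega)}\big)+\|\nabla\mathbf v\|_{L^2(I,\mathbf L^2(\Omega))}\le c_2\big(\rho_\infty^\gamma|\Omega|,\mathcal E_0\big).$$ (2) Let moreover $\partial\Omega$ be of class $C^{2,\alpha}$ for some $\alpha\in(0,1)$. There is a positive $c_3$, nondecreasing in both arguments and depending only on $\mu,\nu,\theta,T$ and $\Omega$, such that for every classical solution as above (with any $A>0$, $\gamma>1$, $\lambda\ge-\mu$, $\rho_\infty\ge 0$) with $\mathcal E_0<\nu/4096$, $$\|\nabla^2\mathbf d\|_{\mathbf L^2(Q_T)}+\|\nabla\mathbf d\|_{\mathbf L^4(Q_T)}+\|\partial_t\mathbf d\|_{L^{4/3}(I,\mathbf L^2(\Omega))}+\|\partial_t\mathbf d\|_{L^2(I,(\mathbf H^1(\Omega))^*)}\le c_3\big(\|\mathbf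 d_0\|_{\mathbf H^2(\Omega)},\mathcal E_0\big),$$ where $(\mathbf H^1(\Omega))^*$ is the dual space of $\mathbf H^1(\Omega)$. -/

import Mathlib

open MeasureTheory Set
open scoped ENNReal NNReal

noncomputable section

namespace NematicFlow

/-- The Euclidean plane. -/
abbrev Plane : Type := EuclideanSpace ℝ (Fin 2)

/-- The partial derivative `∂ᵢ f` of a scalar function on the plane. -/
def pd (i : Fin 2) (f : Plane → ℝ) (x : Plane) : ℝ :=
  fderiv ℝ f x (EuclideanSpace.single i 1)

/-- The Laplacian `Δ f = ∂₁∂₁ f + ∂₂∂₂ f`. -/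
def lapl (f : Plane → ℝ) (x : Plane) : ℝ := ∑ i, pd i (pd i f) x

/-- The gradient `(∂ᵢ uⱼ)ᵢⱼ` of a vector field; its norm is the Frobenius norm. -/
def grad (u : Plane → Plane) (x : Plane) : EuclideanSpace ℝ (Fin 2 × Fin 2) :=
  WithLp.toLp 2 fun p => pd p.1 (fun y => u y p.2) x

/-- The second derivatives `(∂ᵢ∂ⱼ uₗ)ᵢⱼₗ` of a vector field; the norm is the square root of the
sum of the squares. -/
def hess (u : Plane → Plane) (x : Plane) : EuclideanSpace ℝ (Fin 2 × Fin 2 × Fin 2) :=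
  WithLp.toLp 2 fun p => pd p.1 (pd p.2.1 fun y => u y p.2.2) x

/-- The divergence of a vector field. -/
def dvg (u : Plane → Plane) (x : Plane) : ℝ := ∑ i, pd i (fun y => u y i) x

/-! ### Domains -/

/-- A bounded domain: a bounded, nonempty, connected open set. -/
structure IsBoundedDomain (Ω : Set Plane) : Prop where
  isOpen : IsOpen Ω
  isConnected : IsConnected Ω
  isBounded : Bornology.IsBounded Ω

/-- `Ω` has a boundary of class `C^{2,α}`: near each boundary point, after a rotation or
reflection of the coordinates, `Ω` is the part of the plane above the graph of a function of class
`C^{2,α}`. -/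
def HasC2HolderBoundary (α : ℝ≥0) (Ω : Set Plane) : Prop :=
  ∀ x₀ ∈ frontier Ω, ∃ (R : Plane ≃ₗᵢ[ℝ] Plane) (g : ℝ → ℝ) (C : ℝ≥0) (r : ℝ),
    0 < r ∧ ContDiff ℝ 2 g ∧ HolderWith C α (iteratedDeriv 2 g) ∧
      ∀ y ∈ Metric.ball x₀ r, (y ∈ Ω ↔ g (R y 0) < R y 1)

/-! ### Classical solutions -/

/-- The open space-time cylinder, time being the first coordinate. -/
def cyl (T : ℝ) (Ω : Set Plane) : Set (ℝ × Plane) := Ioo 0 T ×ˢ Ω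

/-- `f` is of class `C¹` on the closed space-time cylinder: `f` is continuous there, is `C¹` in the
open cylinder, and its first derivatives (in time and in space) extend continuously to the closed
cylinder (on a bounded set this is uniform continuity). -/
structure IsC1Closed (T : ℝ) (Ω : Set Plane) (f : ℝ → Plane → ℝ) : Prop where
  continuousOn : ContinuousOn (Function.uncurry f) (Icc 0 T ×ˢ closure Ω)
  contDiffOn : ContDiffOn ℝ 1 (Function.uncurry f) (cyl T Ω)
  uniformContinuousOn : UniformContinuousOn (fderiv ℝ (Function.uncurry f)) (cyl T Ω)

/-- `f` is of class `C^{2,1}` on the closed space-time cylinder: it is `C¹` there, is `C²` in space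
inside, and its second space derivatives extend continuously to the closed cylinder. -/
structure IsC21Closed (T : ℝ) (Ω : Set Plane) (f : ℝ → Plane → ℝ) : Prop
    extends IsC1Closed T Ω f where
  contDiffOn_slice : ∀ t ∈ Ioo 0 T, ContDiffOn ℝ 2 (f t) Ω
  uniformContinuousOn_snd : ∀ i j : Fin 2,
    UniformContinuousOn (fun p : ℝ × Plane => pd i (pd j (f p.1)) p.2) (cyl T Ω)

/-- `(ρ, v, d)` is a classical solution, on the time interval `(0, T)` and in `Ω`, of the
compressible nematic liquid crystal system with pressure `A ρ ^ γ`, with initial data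
`(ρ₀, m₀, d₀)` for `(ρ, ρ v, d)`, and with the boundary values `v = 0` and `d = d₀`. -/
structure IsClassicalSolution (A γ μ lam ν θ T : ℝ) (Ω : Set Plane)
    (ρ₀ : Plane → ℝ) (m₀ d₀ : Plane → Plane)
    (ρ : ℝ → Plane → ℝ) (v d : ℝ → Plane → Plane) : Prop where
  reg_density : IsC1Closed T Ω ρ
  reg_velocity : ∀ k, IsC21Closed T Ω fun t x => v t x k
  reg_director : ∀ k, IsC21Closed T Ω fun t x => d t x k
  mass : ∀ t ∈ Ioo 0 T, ∀ x ∈ Ω,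
    deriv (fun s => ρ s x) t + dvg (fun y => ρ t y • v t y) x = 0
  momentum : ∀ t ∈ Ioo 0 T, ∀ x ∈ Ω, ∀ k : Fin 2,
    deriv (fun s => ρ s x * v s x k) t
        + ∑ i, pd i (fun y => ρ t y * v t y i * v t y k) x
        + pd k (fun y => A * ρ t y ^ γ) x
      = μ * lapl (fun y => v t y k) x + (μ + lam) * pd k (dvg (v t)) x
        - ν * ∑ i, pd i (fun y =>
            (∑ l, pd i (fun z => d t z l) y * pd k (fun z => d t z l) y)
              - 1 / 2 * ‖grad (d t) y‖ ^ 2 * (if i = k then 1 else 0)) x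
  director : ∀ t ∈ Ioo 0 T, ∀ x ∈ Ω, ∀ k : Fin 2,
    deriv (fun s => d s x k) t + ∑ i, v t x i * pd i (fun y => d t y k) x
      = θ * (lapl (fun y => d t y k) x + ‖grad (d t) x‖ ^ 2 * d t x k)
  init_density : ∀ x ∈ Ω, ρ 0 x = ρ₀ x
  init_momentum : ∀ x ∈ Ω, ρ 0 x • v 0 x = m₀ x
  init_director : ∀ x ∈ Ω, d 0 x = d₀ x
  bdry_velocity : ∀ t ∈ Ioo 0 T, ∀ x ∈ frontier Ω, v t x = 0
  bdry_director : ∀ t ∈ Ioo 0 T, ∀ x ∈ frontier Ω, d t x = d₀ x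

/-! ### The energy -/

/-- The potential `Q(s) = A/(γ-1) (s^γ - γ s ρ∞^(γ-1) + (γ-1) ρ∞^γ)`. -/
def potential (A γ ρinf s : ℝ) : ℝ :=
  A / (γ - 1) * (s ^ γ - γ * s * ρinf ^ (γ - 1) + (γ - 1) * ρinf ^ γ)

/-- The energy
`∫_Ω (½ |m|²/ρ 1_{ρ > 0} + Q(ρ) + ν/2 |∇d|²) dx`. -/
def energy (A γ ν ρinf : ℝ) (Ω : Set Plane) (ρ : Plane → ℝ) (m d : Plane → Plane) : ℝ :=
  ∫ x in Ω, (1 / 2 * indicator {y | 0 < ρ y} (fun y => ‖m y‖ ^ 2 / ρ y) x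
    + potential A γ ρinf (ρ x) + ν / 2 * ‖grad d x‖ ^ 2)

/-! ### Norms -/

/-- The norm of `L^p(Ω)`. -/
def lpNormSpace {F : Type*} [NormedAddCommGroup F] (Ω : Set Plane) (p : ℝ≥0∞) (f : Plane → F) : ℝ≥0∞ :=
  eLpNorm f p (volume.restrict Ω)

/-- The norm of `L^p(Q_T)`, where `Q_T` is the space-time cylinder. -/
def lpNormCyl {F : Type*} [NormedAddCommGroup F] (T : ℝ) (Ω : Set Plane) (p : ℝ≥0∞)
    (f : ℝ → Plane → F) : ℝ≥0∞ :=
  eLpNorm (Function.uncurry f) p (volume.restrict (cyl T Ω))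

/-- The norm of `L^p(0, T)` of a function of time with values in `[0, ∞]`; applied to
`t ↦ ‖f t‖_X` it gives the norm of `f` in `L^p(0, T; X)`. -/
def lpNormTime (T : ℝ) (p : ℝ≥0∞) (φ : ℝ → ℝ≥0∞) : ℝ≥0∞ :=
  eLpNorm φ p (volume.restrict (Ioo 0 T))

/-- The norm of `H²(Ω)` on functions that are twice differentiable in `Ω`. -/
def h2Norm (Ω : Set Plane) (u : Plane → Plane) : ℝ≥0∞ :=
  (lpNormSpace Ω 2 u ^ 2 + lpNormSpace Ω 2 (grad u) ^ 2 + lpNormSpace Ω 2 (hess u) ^ 2) ^ (1 / 2 : ℝ)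

/-- `w` lies in `H¹(Ω)` and `g i` is its weak derivative `∂ᵢ w`, tested componentwise against the
smooth functions with compact support in `Ω`. -/
structure IsH1 (Ω : Set Plane) (w : Plane → Plane) (g : Fin 2 → Plane → Plane) : Prop where
  memLp : MemLp w 2 (volume.restrict Ω)
  memLp_grad : ∀ i, MemLp (g i) 2 (volume.restrict Ω)
  weak : ∀ φ : Plane → ℝ, ContDiff ℝ (⊤ : ℕ∞) φ → HasCompactSupport φ → tsupport φ ⊆ Ω →
    ∀ i k : Fin 2, ∫ x in Ω, w x k * pd i φ x = -∫ x in Ω, g i x k * φ x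

/-- The norm in the dual space of `H¹(Ω)` of the functional `w ↦ ∫_Ω f · w dx`. -/
def dualH1Norm (Ω : Set Plane) (f : Plane → Plane) : ℝ≥0∞ :=
  ⨆ (w : Plane → Plane) (g : Fin 2 → Plane → Plane) (_ : IsH1 Ω w g)
    (_ : lpNormSpace Ω 2 w ^ 2 + ∑ i, lpNormSpace Ω 2 (g i) ^ 2 ≤ 1),
    ENNReal.ofReal |∫ x in Ω, inner ℝ (f x) (w x)|

/-- The time derivative of a time-dependent vector field. -/
def dt (u : ℝ → Plane → Plane) (t : ℝ) (x : Plane) : Plane := deriv (fun s => u s x) t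

end NematicFlow

end

open NematicFlow

/-!
The energy bound is the energy balance. Testing the momentum equation with `v` and using the mass
and director equations, one finds that the kinetic, potential and Dirichlet energies together
decrease at the rate `∫ (μ |∇v|² + (μ + λ) (div v)² + νθ |Δd + |∇d|² d|²)`
(`IsClassicalSolution.setIntegral_energy_rate`, `IsClassicalSolution.energy_balance`). The balance
uses `ρ ≥ 0` and `|d| = 1`, and both are Gronwall arguments: for the integral of the square of the
negative part of `ρ`, and for that of `(|d|² - 1)²` (`IsClassicalSolution.density_nonneg`,
`IsClassicalSolution.director_sq`). The boundary of `Ω` is arbitrary here, so that no divergence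
theorem is at hand. Its place is taken by the fact that a `C¹` function with bounded derivatives
that tends to zero at the boundary is a limit of test functions, with bounded convergence of the
derivatives (`exists_test_approx`); the integrals of its derivatives therefore vanish.

For the second bound the point is that the director has values in the circle. Its angle `φ` need not
exist globally, but the gradient `u = d₁ ∇d₂ - d₂ ∇d₁` does (`angGrad`), and

* `|∇d|² = |u|²` and `|∇²d|² = |∇u|² + |u|⁴`,
* `curl u = 0`, and `div u` is the component of the tension field `Δd + |∇d|² d` perpendicular to
  `d`,
* the tangential component of `u` at the boundary is that of the initial field, as `d = d₀` there.

Thus `div u` is bounded in `L²(Q_T)` by the energy balance. A curl-free field whose tangential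
component vanishes at the boundary has its gradient bounded in `L²` by its divergence and by the
field (`exists_gaffney`); applied to `u(t) - u(0)` this bounds `∇u`. Ladyzhenskaya's inequality
(`exists_ladyzhenskaya`) then bounds `u` in `L⁴`, and with it `∇d` in `L⁴` and `∇²d` in `L²`
(`exists_director_bounds`). The quadratic term `|∇d|² d` of the equation is part of the tension
field and need not be absorbed. The bounds of the time derivative come from the director equation
`∂ₜd = -v·∇d + θ (Δd + |∇d|² d)`: by Hölder's inequality in `L^{4/3}(L²)` (`exists_dt_sq_le`), and
in the dual of `H¹` by moving the derivative in the transport term to the test function, where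
`|d| = 1` suffices (`exists_dualH1Norm_sq_le`).

Gaffney's inequality is proved in boundary charts. After a rotation that makes the first component
`a` of the field tangential, the determinant `∂₁(η²a) ∂₂b - ∂₂(η²a) ∂₁b` has integral zero, for a
cut-off function `η`, because `η²a` vanishes at the boundary; and for curl-free fields
`|∇w|² = (div w)² - 2 det ∇w`. For Ladyzhenskaya's inequality the values of `η f²` at a point are
bounded by integrals of its derivative along two lines that stay in the domain.
-/

namespace NematicFlow

open Filter Topology

/-! ### Partial derivatives in the plane -/

lemma pd_congr {f g : Plane → ℝ} {x : Plane} (i : Fin 2) (h : f =ᶠ[𝓝 x] g) :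
    pd i f x = pd i g x := by
  simp only [pd, h.fderiv_eq]

lemma pd_congr_on {Ω : Set Plane} (hΩ : IsOpen Ω) {f g : Plane → ℝ} (h : EqOn f g Ω) (i : Fin 2)
    {x : Plane} (hx : x ∈ Ω) : pd i f x = pd i g x :=
  pd_congr i (h.eventuallyEq_of_mem (hΩ.mem_nhds hx))

lemma pd_of_hasFDerivAt {f : Plane → ℝ} {f' : Plane →L[ℝ] ℝ} {x : Plane} (h : HasFDerivAt f f' x)
    (i : Fin 2) : pd i f x = f' (EuclideanSpace.single i 1) := by
  simp only [pd, h.fderiv]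

lemma pd_const (i : Fin 2) (c : ℝ) (x : Plane) : pd i (fun _ => c) x = 0 := by
  simp [pd]

lemma pd_add {f g : Plane → ℝ} {x : Plane} (i : Fin 2) (hf : DifferentiableAt ℝ f x)
    (hg : DifferentiableAt ℝ g x) : pd i (fun y => f y + g y) x = pd i f x + pd i g x := by
  rw [pd_of_hasFDerivAt (hf.hasFDerivAt.fun_add hg.hasFDerivAt) i]
  simp [pd]

lemma pd_sub {f g : Plane → ℝ} {x : Plane} (i : Fin 2) (hf : DifferentiableAt ℝ f x)
    (hg : DifferentiableAt ℝ g x) : pd i (fun y => f y - g y) x = pd i f x - pd i g x := by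
  rw [pd_of_hasFDerivAt (hf.hasFDerivAt.fun_sub hg.hasFDerivAt) i]
  simp [pd]

lemma pd_neg {f : Plane → ℝ} {x : Plane} (i : Fin 2) : pd i (fun y => -f y) x = -pd i f x := by
  simp [pd, fderiv_fun_neg]

lemma pd_mul {f g : Plane → ℝ} {x : Plane} (i : Fin 2) (hf : DifferentiableAt ℝ f x)
    (hg : DifferentiableAt ℝ g x) :
    pd i (fun y => f y * g y) x = pd i f x * g x + f x * pd i g x := by
  rw [pd_of_hasFDerivAt (hf.hasFDerivAt.fun_mul hg.hasFDerivAt) i]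
  simp [pd]
  ring

lemma pd_const_mul {f : Plane → ℝ} {x : Plane} (i : Fin 2) (c : ℝ)
    (hf : DifferentiableAt ℝ f x) : pd i (fun y => c * f y) x = c * pd i f x := by
  rw [pd_mul i (differentiableAt_const c) hf, pd_const]; ring

lemma pd_comp {f : Plane → ℝ} {x : Plane} {φ : ℝ → ℝ} {c : ℝ} (i : Fin 2)
    (hφ : HasDerivAt φ c (f x)) (hf : DifferentiableAt ℝ f x) :
    pd i (fun y => φ (f y)) x = c * pd i f x := by
  have := pd_of_hasFDerivAt (hφ.comp_hasFDerivAt x hf.hasFDerivAt) i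
  simpa [pd, Function.comp_def] using this

lemma pd_sum {ι : Type*} (s : Finset ι) {f : ι → Plane → ℝ} {x : Plane} (i : Fin 2)
    (hf : ∀ k ∈ s, DifferentiableAt ℝ (f k) x) :
    pd i (fun y => ∑ k ∈ s, f k y) x = ∑ k ∈ s, pd i (f k) x := by
  have := pd_of_hasFDerivAt (HasFDerivAt.fun_sum fun k hk => (hf k hk).hasFDerivAt) i
  simpa [pd] using this

/-- The coordinate `x ↦ xⱼ` has partial derivatives `δᵢⱼ`. -/
lemma pd_coord (i j : Fin 2) (x : Plane) :
    pd i (fun y : Plane => y j) x = if i = j then 1 else 0 := by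
  have h : HasFDerivAt (fun y : Plane => y j) (EuclideanSpace.proj j : Plane →L[ℝ] ℝ) x :=
    (EuclideanSpace.proj j : Plane →L[ℝ] ℝ).hasFDerivAt
  rw [pd_of_hasFDerivAt h]
  simp [PiLp.single_apply, eq_comm]

lemma pd_comm {Ω : Set Plane} (hΩ : IsOpen Ω) {f : Plane → ℝ} (hf : ContDiffOn ℝ 2 f Ω)
    (i j : Fin 2) {x : Plane} (hx : x ∈ Ω) : pd i (pd j f) x = pd j (pd i f) x := by
  have hc : ContDiffAt ℝ 2 f x := hf.contDiffAt (hΩ.mem_nhds hx)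
  have hd : DifferentiableAt ℝ (fderiv ℝ f) x :=
    (hc.fderiv_right (m := 1) (by norm_num)).differentiableAt (by norm_num)
  have key : ∀ k l : Fin 2, pd k (pd l f) x =
      fderiv ℝ (fderiv ℝ f) x (EuclideanSpace.single k 1) (EuclideanSpace.single l 1) := by
    intro k l
    have : HasFDerivAt (fun y => fderiv ℝ f y (EuclideanSpace.single l 1))
        ((fderiv ℝ (fderiv ℝ f) x).flip (EuclideanSpace.single l 1)) x := by
      have := hd.hasFDerivAt.clm_apply (hasFDerivAt_const (EuclideanSpace.single l (1 : ℝ)) x)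
      simpa using this
    change NematicFlow.pd k (fun y => fderiv ℝ f y (EuclideanSpace.single l 1)) x = _
    rw [pd_of_hasFDerivAt this]; rfl
  rw [key, key]
  exact (hc.isSymmSndFDerivAt (by simp)).eq _ _

/-- The derivative of a differentiable function is determined by its partial derivatives. -/
lemma fderiv_apply_eq {f : Plane → ℝ} {x : Plane} (v : Plane) :
    fderiv ℝ f x v = ∑ i, v i * pd i f x := by
  have hv : v = ∑ i, v i • EuclideanSpace.single i (1 : ℝ) := by
    ext j; fin_cases j <;> simp [Fin.sum_univ_two]
  conv_lhs => rw [hv]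
  simp [Fin.sum_univ_two, pd]

/-! ### Functions with bounded derivatives -/

/-- `f` is of class `C¹` in `Ω`, and `f` and its first derivatives are bounded there. -/
structure Reg1 (Ω : Set Plane) (f : Plane → ℝ) : Prop where
  contDiffOn : ContDiffOn ℝ 1 f Ω
  bdd : ∃ K, ∀ x ∈ Ω, |f x| ≤ K
  bdd_pd : ∃ K, ∀ i, ∀ x ∈ Ω, |pd i f x| ≤ K

/-- `f` is of class `C²` in `Ω`, and `f` and its derivatives of orders one and two are bounded
there. -/
structure Reg2 (Ω : Set Plane) (f : Plane → ℝ) : Prop where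
  reg1 : Reg1 Ω f
  contDiffOn_two : ContDiffOn ℝ 2 f Ω
  pd : ∀ i, Reg1 Ω (pd i f)

/-- `F` tends to zero at the boundary of `Ω`. -/
def Vanish (Ω : Set Plane) (F : Plane → ℝ) : Prop :=
  ∀ y ∈ frontier Ω, Tendsto F (𝓝[Ω] y) (𝓝 0)

section Reg

variable {Ω : Set Plane} {f g F : Plane → ℝ}

lemma differentiableAt_of_contDiffOn (hΩ : IsOpen Ω) (hf : ContDiffOn ℝ 1 f Ω) {x : Plane}
    (hx : x ∈ Ω) : DifferentiableAt ℝ f x :=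
  (hf.differentiableOn (by norm_num)).differentiableAt (hΩ.mem_nhds hx)

lemma Reg1.differentiableAt (hf : Reg1 Ω f) (hΩ : IsOpen Ω) {x : Plane} (hx : x ∈ Ω) :
    DifferentiableAt ℝ f x :=
  differentiableAt_of_contDiffOn hΩ hf.contDiffOn hx

lemma Reg1.continuousOn (hf : Reg1 Ω f) : ContinuousOn f Ω := hf.contDiffOn.continuousOn

lemma continuousOn_pd (hΩ : IsOpen Ω) (hf : ContDiffOn ℝ 1 f Ω) (i : Fin 2) :
    ContinuousOn (pd i f) Ω :=
  (hf.continuousOn_fderiv_of_isOpen hΩ (by norm_num)).clm_apply continuousOn_const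

lemma Reg1.continuousOn_pd (hf : Reg1 Ω f) (hΩ : IsOpen Ω) (i : Fin 2) :
    ContinuousOn (NematicFlow.pd i f) Ω :=
  NematicFlow.continuousOn_pd hΩ hf.contDiffOn i

lemma Reg1.congr (hf : Reg1 Ω f) (hΩ : IsOpen Ω) (h : EqOn g f Ω) : Reg1 Ω g where
  contDiffOn := hf.contDiffOn.congr h
  bdd := by
    obtain ⟨K, hK⟩ := hf.bdd
    exact ⟨K, fun x hx => by rw [h hx]; exact hK x hx⟩
  bdd_pd := by
    obtain ⟨K, hK⟩ := hf.bdd_pd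
    exact ⟨K, fun i x hx => by rw [pd_congr_on hΩ h i hx]; exact hK i x hx⟩

lemma reg1_const (c : ℝ) : Reg1 Ω fun _ => c where
  contDiffOn := contDiffOn_const
  bdd := ⟨|c|, fun _ _ => le_rfl⟩
  bdd_pd := ⟨0, fun i x _ => by simp [pd_const]⟩

lemma Reg1.add (hf : Reg1 Ω f) (hg : Reg1 Ω g) (hΩ : IsOpen Ω) : Reg1 Ω fun x => f x + g x where
  contDiffOn := hf.contDiffOn.add hg.contDiffOn
  bdd := by
    obtain ⟨K, hK⟩ := hf.bdd
    obtain ⟨L, hL⟩ := hg.bdd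
    exact ⟨K + L, fun x hx => (abs_add_le _ _).trans (add_le_add (hK x hx) (hL x hx))⟩
  bdd_pd := by
    obtain ⟨K, hK⟩ := hf.bdd_pd
    obtain ⟨L, hL⟩ := hg.bdd_pd
    refine ⟨K + L, fun i x hx => ?_⟩
    rw [pd_add i (hf.differentiableAt hΩ hx) (hg.differentiableAt hΩ hx)]
    exact (abs_add_le _ _).trans (add_le_add (hK i x hx) (hL i x hx))

lemma Reg1.mul (hf : Reg1 Ω f) (hg : Reg1 Ω g) (hΩ : IsOpen Ω) : Reg1 Ω fun x => f x * g x where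
  contDiffOn := hf.contDiffOn.mul hg.contDiffOn
  bdd := by
    obtain ⟨K, hK⟩ := hf.bdd
    obtain ⟨L, hL⟩ := hg.bdd
    refine ⟨K * L, fun x hx => ?_⟩
    rw [abs_mul]
    exact mul_le_mul (hK x hx) (hL x hx) (abs_nonneg _) ((abs_nonneg _).trans (hK x hx))
  bdd_pd := by
    obtain ⟨K, hK⟩ := hf.bdd
    obtain ⟨L, hL⟩ := hg.bdd
    obtain ⟨K', hK'⟩ := hf.bdd_pd
    obtain ⟨L', hL'⟩ := hg.bdd_pd
    refine ⟨K' * L + K * L', fun i x hx => ?_⟩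
    rw [pd_mul i (hf.differentiableAt hΩ hx) (hg.differentiableAt hΩ hx)]
    refine (abs_add_le _ _).trans (add_le_add ?_ ?_) <;> rw [abs_mul]
    · exact mul_le_mul (hK' i x hx) (hL x hx) (abs_nonneg _) ((abs_nonneg _).trans (hK' i x hx))
    · exact mul_le_mul (hK x hx) (hL' i x hx) (abs_nonneg _) ((abs_nonneg _).trans (hK x hx))

lemma Reg1.const_mul (hf : Reg1 Ω f) (hΩ : IsOpen Ω) (c : ℝ) : Reg1 Ω fun x => c * f x :=
  (reg1_const c).mul hf hΩ

lemma Reg1.neg (hf : Reg1 Ω f) (hΩ : IsOpen Ω) : Reg1 Ω fun x => -f x :=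
  (hf.const_mul hΩ (-1)).congr hΩ fun x _ => by ring

lemma Reg1.sub (hf : Reg1 Ω f) (hg : Reg1 Ω g) (hΩ : IsOpen Ω) : Reg1 Ω fun x => f x - g x :=
  (hf.add (hg.neg hΩ) hΩ).congr hΩ fun x _ => by ring

lemma Reg1.pow (hf : Reg1 Ω f) (hΩ : IsOpen Ω) (n : ℕ) : Reg1 Ω fun x => f x ^ n := by
  induction n with
  | zero => simpa using reg1_const 1
  | succ n ih => exact (ih.mul hf hΩ).congr hΩ fun x _ => pow_succ _ _

lemma Reg1.sum {ι : Type*} (s : Finset ι) {f : ι → Plane → ℝ} (hΩ : IsOpen Ω)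
    (hf : ∀ k ∈ s, Reg1 Ω (f k)) : Reg1 Ω fun x => ∑ k ∈ s, f k x := by
  classical
  induction s using Finset.induction_on with
  | empty => simpa using reg1_const 0
  | insert a s ha ih =>
    refine ((hf a (by simp)).add (ih fun k hk => hf k (by simp [hk])) hΩ).congr hΩ fun x _ => ?_
    simp [Finset.sum_insert ha]

lemma Reg1.comp (hf : Reg1 Ω f) (hΩ : IsOpen Ω) {φ : ℝ → ℝ} (hφ : ContDiff ℝ 1 φ) :
    Reg1 Ω fun x => φ (f x) where
  contDiffOn := hφ.comp_contDiffOn hf.contDiffOn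
  bdd := by
    obtain ⟨K, hK⟩ := hf.bdd
    obtain ⟨C, hC⟩ := (isCompact_Icc (a := -K) (b := K)).exists_bound_of_continuousOn
      hφ.continuous.continuousOn
    exact ⟨C, fun x hx => hC _ (abs_le.1 (hK x hx))⟩
  bdd_pd := by
    obtain ⟨K, hK⟩ := hf.bdd
    obtain ⟨L, hL⟩ := hf.bdd_pd
    obtain ⟨C, hC⟩ := (isCompact_Icc (a := -K) (b := K)).exists_bound_of_continuousOn
      (hφ.continuous_deriv (by norm_num)).continuousOn
    refine ⟨C * L, fun i x hx => ?_⟩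
    rw [pd_comp i ((hφ.differentiable (by norm_num)).differentiableAt.hasDerivAt)
      (hf.differentiableAt hΩ hx), abs_mul]
    have h := hC _ (abs_le.1 (hK x hx))
    exact mul_le_mul h (hL i x hx) (abs_nonneg _) ((norm_nonneg _).trans h)

/-- A function of class `C¹` in the whole plane is bounded, with its derivatives, in a bounded
set. -/
lemma reg1_of_contDiff (hb : Bornology.IsBounded Ω) (hf : ContDiff ℝ 1 f) : Reg1 Ω f where
  contDiffOn := hf.contDiffOn
  bdd := by
    obtain ⟨C, hC⟩ := hb.isCompact_closure.exists_bound_of_continuousOn hf.continuous.continuousOn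
    exact ⟨C, fun x hx => hC _ (subset_closure hx)⟩
  bdd_pd := by
    have h : ∀ i, Continuous (NematicFlow.pd i f) := fun i =>
      (hf.continuous_fderiv (by norm_num)).clm_apply continuous_const
    obtain ⟨C, hC⟩ := hb.isCompact_closure.exists_bound_of_continuousOn (h 0).continuousOn
    obtain ⟨D, hD⟩ := hb.isCompact_closure.exists_bound_of_continuousOn (h 1).continuousOn
    refine ⟨max C D, fun i x hx => ?_⟩
    fin_cases i
    · exact (hC _ (subset_closure hx)).trans (le_max_left _ _)
    · exact (hD _ (subset_closure hx)).trans (le_max_right _ _)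

lemma integrableOn_of_bdd (hΩ : IsOpen Ω) (hb : Bornology.IsBounded Ω) {E : Type*}
    [NormedAddCommGroup E] {f : Plane → E} (hf : ContinuousOn f Ω)
    (hK : ∃ K, ∀ x ∈ Ω, ‖f x‖ ≤ K) : IntegrableOn f Ω := by
  obtain ⟨K, hK⟩ := hK
  have : IsFiniteMeasure (volume.restrict Ω) := ⟨by simpa using hb.measure_lt_top⟩
  have hm : AEStronglyMeasurable f (volume.restrict Ω) :=
    hf.aestronglyMeasurable hΩ.measurableSet
  refine Integrable.of_bound hm K ?_
  exact (ae_restrict_mem hΩ.measurableSet).mono hK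

lemma Reg1.integrableOn (hf : Reg1 Ω f) (hΩ : IsOpen Ω) (hb : Bornology.IsBounded Ω) :
    IntegrableOn f Ω :=
  integrableOn_of_bdd hΩ hb hf.continuousOn hf.bdd

lemma Reg1.integrableOn_pd (hf : Reg1 Ω f) (hΩ : IsOpen Ω) (hb : Bornology.IsBounded Ω)
    (i : Fin 2) : IntegrableOn (NematicFlow.pd i f) Ω := by
  obtain ⟨K, hK⟩ := hf.bdd_pd
  exact integrableOn_of_bdd hΩ hb (hf.continuousOn_pd hΩ i) ⟨K, hK i⟩

lemma Vanish.mul_bdd (hF : Vanish Ω F) (hf : ∃ K, ∀ x ∈ Ω, |f x| ≤ K) :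
    Vanish Ω fun x => F x * f x := by
  obtain ⟨K, hK⟩ := hf
  intro y hy
  refine (hF y hy).zero_mul_isBoundedUnder_le ⟨K, ?_⟩
  rw [eventually_map]
  exact eventually_nhdsWithin_of_forall hK

lemma Vanish.add (hf : Vanish Ω f) (hg : Vanish Ω g) : Vanish Ω fun x => f x + g x :=
  fun y hy => by simpa using (hf y hy).add (hg y hy)

lemma Vanish.congr (hf : Vanish Ω f) (h : EqOn g f Ω) : Vanish Ω g := fun y hy =>
  (hf y hy).congr' (eventually_nhdsWithin_of_forall fun _ hx => (h hx).symm)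

lemma vanish_of_continuousOn (hf : ContinuousOn f (closure Ω)) (h0 : ∀ y ∈ frontier Ω, f y = 0) :
    Vanish Ω f := fun y hy => by
  have := (hf y (frontier_subset_closure hy)).mono_left (nhdsWithin_mono y subset_closure)
  rwa [h0 y hy] at this

end Reg

/-! ### Approximation by test functions, and integration by parts -/

/-- The zeros at which the derivative does not vanish are isolated. -/
lemma countable_of_hasDerivAt_ne_zero {f : ℝ → ℝ} {S : Set ℝ}
    (h : ∀ t ∈ S, f t = 0 ∧ ∃ c, c ≠ 0 ∧ HasDerivAt f c t) : S.Countable := by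
  refine IsLindelof.countable_of_isDiscrete (HereditarilyLindelofSpace.isLindelof S) ?_
  rw [isDiscrete_iff_forall_mem_exists_isOpen]
  intro t ht
  obtain ⟨-, c, hc, hd⟩ := h t ht
  have := hd.eventually_ne hc (c := 0)
  rw [eventually_nhdsWithin_iff, eventually_nhds_iff] at this
  obtain ⟨u, hu, huo, htu⟩ := this
  refine ⟨u, huo, Subset.antisymm ?_ (by rintro _ rfl; exact ⟨htu, ht⟩)⟩
  rintro s ⟨hs, hsS⟩
  by_contra hne
  exact hu s hs hne (h s hsS).1

lemma measurable_indicator_of_continuousOn {Ω : Set Plane} (hΩ : IsOpen Ω) {f : Plane → ℝ}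
    (hf : ContinuousOn f Ω) : Measurable (Ω.indicator f) := by
  classical
  have := hf.measurable_piecewise (g := fun _ => (0 : ℝ)) continuousOn_const hΩ.measurableSet
  convert this using 1
  exact (piecewise_eq_indicator (s := Ω) (f := f)).symm

/-- The derivatives of a `C¹` function vanish almost everywhere on its zero set: on each line
parallel to the axis, the exceptional points are isolated. -/
lemma ae_pd_eq_zero {Ω : Set Plane} (hΩ : IsOpen Ω) {F : Plane → ℝ} (hF : ContDiffOn ℝ 1 F Ω)
    (i : Fin 2) : ∀ᵐ x, x ∈ Ω → F x = 0 → pd i F x = 0 := by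
  set s : Set Plane := {x | x ∈ Ω → F x = 0 → pd i F x = 0} with hs
  have hsm : MeasurableSet s := by
    have h1 := measurable_indicator_of_continuousOn hΩ hF.continuousOn
    have h2 := measurable_indicator_of_continuousOn hΩ (continuousOn_pd hΩ hF i)
    have : s = Ωᶜ ∪ ({x | Ω.indicator F x = 0}ᶜ ∪ {x | Ω.indicator (pd i F) x = 0}) := by
      ext x
      by_cases hx : x ∈ Ω <;> simp [hs, hx]
      tauto
    rw [this]
    exact hΩ.measurableSet.compl.union ((h1 (measurableSet_singleton 0)).compl.union
      (h2 (measurableSet_singleton 0)))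
  refine ae_mem_of_ae_add_linearMap_mem
    (LinearMap.toSpanSingleton ℝ Plane (EuclideanSpace.single i 1)) volume volume hsm fun y => ?_
  have hc : {t : ℝ | ¬ (y + t • EuclideanSpace.single i (1 : ℝ) ∈ s)}.Countable := by
    refine countable_of_hasDerivAt_ne_zero
      (f := fun t => F (y + t • EuclideanSpace.single i (1 : ℝ))) fun t ht => ?_
    simp only [hs, mem_ofPred_eq, Classical.not_imp] at ht
    obtain ⟨h1, h2, h3⟩ := ht
    refine ⟨h2, _, h3, ?_⟩
    have hd := (differentiableAt_of_contDiffOn hΩ hF h1).hasFDerivAt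
    have hl : HasDerivAt (fun t : ℝ => y + t • EuclideanSpace.single i (1 : ℝ))
        (EuclideanSpace.single i (1 : ℝ)) t := by
      simpa using ((hasDerivAt_id t).smul_const (EuclideanSpace.single i (1 : ℝ))).const_add y
    exact hd.comp_hasDerivAt t hl
  exact hc.measure_zero volume

lemma Vanish.isCompact {Ω : Set Plane} (hb : Bornology.IsBounded Ω) (hΩ : IsOpen Ω)
    {F : Plane → ℝ} (hF : ContinuousOn F Ω) (hv : Vanish Ω F) {ε : ℝ} (hε : 0 < ε) :
    IsCompact {x | x ∈ Ω ∧ ε ≤ |F x|} := by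
  refine Metric.isCompact_of_isClosed_isBounded (isClosed_of_closure_subset fun y hy => ?_)
    (hb.subset fun x hx => hx.1)
  rw [mem_closure_iff_frequently] at hy
  by_cases hyΩ : y ∈ Ω
  · refine ⟨hyΩ, ?_⟩
    by_contra! hlt
    have hcont : ContinuousAt F y := hF.continuousAt (hΩ.mem_nhds hyΩ)
    exact hy ((hcont.abs.eventually (gt_mem_nhds hlt)).mono fun x hx h => absurd h.2 (not_le.2 hx))
  · have hyf : y ∈ frontier Ω := by
      rw [hΩ.frontier_eq]
      exact ⟨mem_closure_iff_frequently.2 (hy.mono fun x hx => hx.1), hyΩ⟩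
    have h := (hv y hyf).abs.eventually (gt_mem_nhds (by simpa using hε))
    rw [eventually_nhdsWithin_iff] at h
    exact (hy (h.mono fun x hx hx' => absurd hx'.2 (not_le.2 (hx hx'.1)))).elim

/-- A continuous cut-off that vanishes for `|s| ≤ 1 / (n + 1)` and is `1` for
`|s| ≥ 2 / (n + 1)`. -/
def cutoff (n : ℕ) (s : ℝ) : ℝ := min 1 (max 0 ((n + 1) * |s| - 1))

/-- The primitive of `cutoff n`: it vanishes near zero and converges to the identity. -/
noncomputable def truncation (n : ℕ) (s : ℝ) : ℝ := ∫ r in (0 : ℝ)..s, cutoff n r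

lemma continuous_cutoff (n : ℕ) : Continuous (cutoff n) := by
  unfold cutoff; fun_prop

lemma cutoff_nonneg (n : ℕ) (s : ℝ) : 0 ≤ cutoff n s := by simp [cutoff]

lemma cutoff_le_one (n : ℕ) (s : ℝ) : cutoff n s ≤ 1 := min_le_left _ _

lemma tendsto_cutoff {s : ℝ} (hs : s ≠ 0) : Tendsto (fun n => cutoff n s) atTop (𝓝 1) := by
  have hs' := abs_pos.2 hs
  refine tendsto_const_nhds.congr' ?_
  obtain ⟨N, hN⟩ := exists_nat_gt (2 / |s|)
  filter_upwards [eventually_ge_atTop N] with n hn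
  have hn' : (N : ℝ) ≤ n := by exact_mod_cast hn
  rw [div_lt_iff₀ hs'] at hN
  have : 1 ≤ (n + 1) * |s| - 1 := by nlinarith
  rw [cutoff, max_eq_right (by linarith), min_eq_left this]

lemma hasDerivAt_truncation (n : ℕ) (s : ℝ) : HasDerivAt (truncation n) (cutoff n s) s :=
  ((continuous_cutoff n).integral_hasStrictDerivAt 0 s).hasDerivAt

lemma contDiff_truncation (n : ℕ) : ContDiff ℝ 1 (truncation n) := by
  rw [contDiff_one_iff_deriv]
  refine ⟨fun s => (hasDerivAt_truncation n s).differentiableAt, ?_⟩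
  have : deriv (truncation n) = cutoff n := funext fun s => (hasDerivAt_truncation n s).deriv
  rw [this]
  exact continuous_cutoff n

lemma abs_truncation_le (n : ℕ) (s : ℝ) : |truncation n s| ≤ |s| := by
  have := intervalIntegral.norm_integral_le_of_norm_le_const (a := 0) (b := s) (f := cutoff n)
    (C := 1) fun x _ => by
      rw [Real.norm_eq_abs, abs_of_nonneg (cutoff_nonneg n x)]; exact cutoff_le_one n x
  simpa [truncation] using this

lemma truncation_eq_zero {n : ℕ} {s : ℝ} (hs : |s| < 1 / (n + 1)) : truncation n s = 0 := by
  have h : EqOn (cutoff n) (fun _ => 0) (uIcc 0 s) := by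
    intro r hr
    have hr' : |r| ≤ |s| := by
      rcases le_total 0 s with h | h
      · rw [uIcc_of_le h] at hr
        rw [abs_of_nonneg hr.1, abs_of_nonneg h]; exact hr.2
      · rw [uIcc_of_ge h] at hr
        rw [abs_of_nonpos hr.2, abs_of_nonpos h]; linarith [hr.1]
    have hn : (0 : ℝ) < n + 1 := by positivity
    rw [lt_div_iff₀ hn] at hs
    have : (n + 1) * |r| - 1 ≤ 0 := by nlinarith
    simp [cutoff, max_eq_left this]
  rw [truncation, intervalIntegral.integral_congr h]
  simp

lemma tendsto_truncation (s : ℝ) : Tendsto (fun n => truncation n s) atTop (𝓝 s) := by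
  have h : Tendsto (fun n => ∫ r in (0 : ℝ)..s, cutoff n r) atTop
      (𝓝 (∫ _ in (0 : ℝ)..s, (1 : ℝ))) := by
    refine intervalIntegral.tendsto_integral_filter_of_dominated_convergence (fun _ => 1)
      (.of_forall fun n => (continuous_cutoff n).aestronglyMeasurable) ?_
      (by simp) ?_
    · refine .of_forall fun n => .of_forall fun x _ => ?_
      rw [Real.norm_eq_abs, abs_of_nonneg (cutoff_nonneg n x)]; exact cutoff_le_one n x
    · have : ∀ᵐ x : ℝ, x ≠ 0 := by simp [ae_iff]
      filter_upwards [this] with x hx _ using tendsto_cutoff hx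
  simpa [truncation] using h

/-- Mollification: a compactly supported `C¹` function is approximated, together with its
derivatives, by smooth functions with slightly larger support. -/
lemma exists_smooth_near {Ω : Set Plane} (hΩ : IsOpen Ω) {G : Plane → ℝ} (hG : ContDiff ℝ 1 G)
    (hc : HasCompactSupport G) (hs : tsupport G ⊆ Ω) {δ : ℝ} (hδ : 0 < δ) :
    ∃ H : Plane → ℝ, ContDiff ℝ (⊤ : ℕ∞) H ∧ HasCompactSupport H ∧ tsupport H ⊆ Ω ∧
      (∀ x, |H x - G x| ≤ δ) ∧ ∀ i x, |pd i H x - pd i G x| ≤ δ := by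
  obtain ⟨r₀, hr₀, hr₀s⟩ := hc.exists_cthickening_subset_open hΩ hs
  have hcf : HasCompactSupport (fderiv ℝ G) := hc.fderiv ℝ
  have hGf : Continuous (fderiv ℝ G) := hG.continuous_fderiv (by norm_num)
  obtain ⟨r₁, hr₁, h₁⟩ := Metric.uniformContinuous_iff.1
    (hc.uniformContinuous_of_continuous hG.continuous) δ hδ
  obtain ⟨r₂, hr₂, h₂⟩ := Metric.uniformContinuous_iff.1
    (hcf.uniformContinuous_of_continuous hGf) δ hδ
  set r := min r₀ (min r₁ r₂) with hr
  have hrpos : 0 < r := by positivity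
  let φ : ContDiffBump (0 : Plane) := ⟨r / 2, r, by positivity, by linarith⟩
  have hφs : HasCompactSupport (φ.normed volume) := φ.hasCompactSupport_normed
  have hφl : LocallyIntegrable (φ.normed volume) volume :=
    φ.continuous_normed.locallyIntegrable
  let H : Plane → ℝ := convolution (φ.normed volume) G (ContinuousLinearMap.lsmul ℝ ℝ) volume
  refine ⟨H, ?_, ?_, ?_, ?_, ?_⟩
  · exact hφs.contDiff_convolution_left _ φ.contDiff_normed hG.continuous.locallyIntegrable
  · exact hφs.convolution _ hc
  · have : Function.support H ⊆ Metric.cthickening r₀ (tsupport G) := by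
      refine (support_convolution_subset _).trans ?_
      rintro x ⟨a, ha, b, hb, rfl⟩
      rw [φ.support_normed_eq] at ha
      refine Metric.mem_cthickening_of_dist_le _ b _ _ (subset_tsupport _ hb) ?_
      have : ‖a‖ < r := by simpa using ha
      simpa [dist_eq_norm] using this.le.trans (min_le_left _ _)
    exact (closure_minimal this Metric.isClosed_cthickening).trans hr₀s
  · intro x
    have := φ.dist_normed_convolution_le (μ := volume) (g := G) (x₀ := x) (ε := δ)
      hG.continuous.aestronglyMeasurable fun y hy => by
        refine (h₁ (lt_of_lt_of_le hy ?_)).le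
        exact (min_le_right _ _).trans (min_le_left _ _)
    simpa [Real.dist_eq] using this
  · intro i x
    have hd := hc.hasFDerivAt_convolution_right (ContinuousLinearMap.lsmul ℝ ℝ) hφl hG x
    have hd' : pd i H x = convolution (φ.normed volume) (pd i G)
        (ContinuousLinearMap.lsmul ℝ ℝ) volume x := by
      rw [pd_of_hasFDerivAt hd]
      exact convolution_precompR_apply _ hφl hcf hGf x _
    have := φ.dist_normed_convolution_le (μ := volume) (g := pd i G) (x₀ := x) (ε := δ)
      (hGf.clm_apply continuous_const).aestronglyMeasurable fun y hy => by
        have hle := (h₂ (lt_of_lt_of_le hy ((min_le_right _ _).trans (min_le_right _ _)))).le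
        rw [dist_eq_norm] at hle ⊢
        have := (fderiv ℝ G y - fderiv ℝ G x).le_of_opNorm_le hle (EuclideanSpace.single i 1)
        simpa [pd] using this
    rw [hd']
    simpa [Real.dist_eq] using this

/-- A function with bounded derivatives that vanishes at the boundary is the limit, together with
its derivatives, of a bounded sequence of test functions. -/
lemma exists_test_approx {Ω : Set Plane} (hΩ : IsOpen Ω) (hb : Bornology.IsBounded Ω)
    {F : Plane → ℝ} (hF : Reg1 Ω F) (hv : Vanish Ω F) :
    ∃ (H : ℕ → Plane → ℝ) (M : ℝ), (∀ n, ContDiff ℝ (⊤ : ℕ∞) (H n)) ∧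
      (∀ n, HasCompactSupport (H n)) ∧ (∀ n, tsupport (H n) ⊆ Ω) ∧
      (∀ n, ∀ x ∈ Ω, |H n x| ≤ M) ∧ (∀ n i, ∀ x ∈ Ω, |pd i (H n) x| ≤ M) ∧
      (∀ x ∈ Ω, Tendsto (fun n => H n x) atTop (𝓝 (F x))) ∧
      ∀ i, ∀ᵐ x ∂(volume.restrict Ω), Tendsto (fun n => pd i (H n) x) atTop (𝓝 (pd i F x)) := by
  let G : ℕ → Plane → ℝ := fun n => Ω.indicator fun x => truncation n (F x)
  have hGΩ : ∀ n, EqOn (G n) (fun x => truncation n (F x)) Ω := fun n x hx => by simp [G, hx]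
  have hK : ∀ n : ℕ, IsCompact {x | x ∈ Ω ∧ 1 / ((n : ℝ) + 1) ≤ |F x|} := fun n =>
    hv.isCompact hb hΩ hF.continuousOn (by positivity)
  have hsub : ∀ n, tsupport (G n) ⊆ {x | x ∈ Ω ∧ 1 / ((n : ℝ) + 1) ≤ |F x|} := by
    intro n
    refine closure_minimal (fun x hx => ?_) (hK n).isClosed
    by_cases hxΩ : x ∈ Ω
    · refine ⟨hxΩ, not_lt.1 fun h => hx ?_⟩
      rw [hGΩ n hxΩ]; exact truncation_eq_zero h
    · exact absurd (by simp [G, hxΩ]) hx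
  have hGc : ∀ n, HasCompactSupport (G n) := fun n =>
    (hK n).of_isClosed_subset (isClosed_tsupport _) (hsub n)
  have hGd : ∀ n, ContDiff ℝ 1 (G n) := by
    intro n
    rw [contDiff_iff_contDiffAt]
    intro x
    by_cases hx : x ∈ Ω
    · have h1 : ContDiffAt ℝ 1 (fun x => truncation n (F x)) x :=
        (contDiff_truncation n).contDiffAt.comp x (hF.contDiffOn.contDiffAt (hΩ.mem_nhds hx))
      exact h1.congr_of_eventuallyEq ((hGΩ n).eventuallyEq_of_mem (hΩ.mem_nhds hx))
    · have : x ∉ tsupport (G n) := fun h => hx (hsub n h).1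
      exact contDiffAt_const.congr_of_eventuallyEq (notMem_tsupport_iff_eventuallyEq.1 this)
  have hpdG : ∀ n i, ∀ x ∈ Ω, pd i (G n) x = cutoff n (F x) * pd i F x := by
    intro n i x hx
    rw [pd_congr_on hΩ (hGΩ n) i hx,
      pd_comp i (hasDerivAt_truncation n (F x)) (hF.differentiableAt hΩ hx)]
  choose H h1 h2 h3 h4 h5 using fun n : ℕ => exists_smooth_near hΩ (hGd n) (hGc n)
    ((hsub n).trans fun x hx => hx.1) (δ := 1 / ((n : ℝ) + 1)) (by positivity)
  obtain ⟨K, hKb⟩ := hF.bdd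
  obtain ⟨L, hL⟩ := hF.bdd_pd
  have hδ : ∀ n : ℕ, 1 / ((n : ℝ) + 1) ≤ 1 := fun n => by
    rw [div_le_one (by positivity)]; linarith [n.cast_nonneg (α := ℝ)]
  have close : ∀ {a b : ℕ → ℝ} {c : ℝ}, (∀ n, |a n - b n| ≤ 1 / ((n : ℝ) + 1)) →
      Tendsto b atTop (𝓝 c) → Tendsto a atTop (𝓝 c) := by
    intro a b c hab hbc
    have h0 : Tendsto (fun n => a n - b n) atTop (𝓝 0) :=
      squeeze_zero_norm hab tendsto_one_div_add_atTop_nhds_zero_nat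
    simpa using h0.add hbc
  refine ⟨H, max (K + 1) (L + 1), h1, h2, h3, ?_, ?_, ?_, ?_⟩
  · intro n x hx
    have := abs_le.1 ((h4 n x).trans (hδ n))
    have h6 := abs_le.1 ((abs_truncation_le n (F x)).trans (hKb x hx))
    rw [hGΩ n hx] at this
    exact le_max_of_le_left (abs_le.2 ⟨by linarith [this.1, h6.1], by linarith [this.2, h6.2]⟩)
  · intro n i x hx
    have := abs_le.1 ((h5 n i x).trans (hδ n))
    have h6 : |pd i (G n) x| ≤ L := by
      rw [hpdG n i x hx, abs_mul, abs_of_nonneg (cutoff_nonneg _ _)]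
      exact (mul_le_of_le_one_left (abs_nonneg _) (cutoff_le_one _ _)).trans (hL i x hx)
    have h6 := abs_le.1 h6
    exact le_max_of_le_right (abs_le.2 ⟨by linarith [this.1, h6.1], by linarith [this.2, h6.2]⟩)
  · intro x hx
    refine close (fun n => h4 n x) ?_
    simpa only [hGΩ _ hx] using tendsto_truncation (F x)
  · intro i
    rw [ae_restrict_iff' hΩ.measurableSet]
    filter_upwards [ae_pd_eq_zero hΩ hF.contDiffOn i] with x hx0 hx
    refine close (fun n => h5 n i x) ?_
    simp only [hpdG _ i x hx]
    by_cases h0 : F x = 0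
    · simp [hx0 hx h0]
    · simpa using (tendsto_cutoff h0).mul_const (pd i F x)

lemma integral_eq_setIntegral_of_tsupport {Ω : Set Plane} {H f : Plane → ℝ}
    (hs : tsupport H ⊆ Ω) (hf : ∀ x, x ∉ tsupport H → f x = 0) :
    ∫ x in Ω, f x = ∫ x, f x := by
  refine setIntegral_eq_integral_of_forall_compl_eq_zero fun x hx => hf x fun h => hx (hs h)

lemma pd_eq_zero_of_notMem_tsupport {H : Plane → ℝ} {x : Plane} (hx : x ∉ tsupport H)
    (i : Fin 2) : pd i H x = 0 := by
  rw [pd_congr i (notMem_tsupport_iff_eventuallyEq.1 hx)]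
  exact pd_const i 0 x

/-- Integration by parts against a test function. -/
lemma setIntegral_pd_mul_test {Ω : Set Plane} (hΩ : IsOpen Ω)
    {f H : Plane → ℝ} (hf : ContDiffOn ℝ 1 f Ω) (hH : ContDiff ℝ 1 H)
    (hc : HasCompactSupport H) (hs : tsupport H ⊆ Ω) (i : Fin 2) :
    ∫ x in Ω, pd i f x * H x = -∫ x in Ω, f x * pd i H x := by
  have hz : ∀ x, x ∉ tsupport H → H x = 0 := fun x hx => image_eq_zero_of_notMem_tsupport hx
  have hcont : ∀ {a b : Plane → ℝ}, ContinuousOn a Ω → Continuous b →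
      (∀ x, x ∉ tsupport H → b x = 0) → Integrable (fun x => a x * b x) := by
    intro a b ha hb hb0
    have hsupp : Function.support (fun x => a x * b x) ⊆ tsupport H := fun x hx => by
      by_contra h
      exact hx (by simp [hb0 x h])
    rw [← integrableOn_iff_integrable_of_support_subset hsupp]
    exact ((ha.mono hs).mul hb.continuousOn).integrableOn_compact hc
  have hpdH : Continuous (pd i H) :=
    (hH.continuous_fderiv (by norm_num)).clm_apply continuous_const
  have key := integral_mul_fderiv_eq_neg_fderiv_mul_of_integrable (μ := (volume : Measure Plane))
    (f := f) (g := H) (v := EuclideanSpace.single i 1)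
    (hcont (continuousOn_pd hΩ hf i) hH.continuous hz)
    (hcont hf.continuousOn hpdH fun x hx => pd_eq_zero_of_notMem_tsupport hx i)
    (hcont hf.continuousOn hH.continuous hz)
    (fun x hx => differentiableAt_of_contDiffOn hΩ hf (hs hx))
    (fun x _ => (hH.differentiable (by norm_num)).differentiableAt)
  rw [integral_eq_setIntegral_of_tsupport (H := H) hs fun x hx => by simp [hz x hx],
    integral_eq_setIntegral_of_tsupport (H := H) hs fun x hx => by
      simp [pd_eq_zero_of_notMem_tsupport hx i]]
  have key' : ∫ x, f x * pd i H x = -∫ x, pd i f x * H x := key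
  rw [key']; ring

/-- Dominated convergence in a bounded open set, with a bounded factor. -/
lemma tendsto_setIntegral_mul {Ω : Set Plane} (hΩ : IsOpen Ω) {h : ℕ → Plane → ℝ}
    {h' a : Plane → ℝ} {M : ℝ}
    (hm : ∀ n, Continuous (h n)) (hM : ∀ n, ∀ x ∈ Ω, |h n x| ≤ M) (ha : IntegrableOn a Ω)
    (ht : ∀ᵐ x ∂(volume.restrict Ω), Tendsto (fun n => h n x) atTop (𝓝 (h' x))) :
    Tendsto (fun n => ∫ x in Ω, a x * h n x) atTop (𝓝 (∫ x in Ω, a x * h' x)) := by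
  refine tendsto_integral_of_dominated_convergence (fun x => |a x| * M)
    (fun n => ha.aestronglyMeasurable.mul (hm n).aestronglyMeasurable)
    (ha.abs.mul_const M) (fun n => ?_) (ht.mono fun x hx => hx.const_mul _)
  filter_upwards [ae_restrict_mem hΩ.measurableSet] with x hx
  rw [Real.norm_eq_abs, abs_mul]
  exact mul_le_mul_of_nonneg_left (hM n x hx) (abs_nonneg _)

section Integral

variable {Ω : Set Plane} (hΩ : IsOpen Ω) (hb : Bornology.IsBounded Ω)
include hΩ hb

/-- The divergence theorem for functions that vanish at the boundary, in an arbitrary bounded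
open set. -/
lemma setIntegral_pd_eq_zero {F : Plane → ℝ} (hF : Reg1 Ω F) (hv : Vanish Ω F) (i : Fin 2) :
    ∫ x in Ω, pd i F x = 0 := by
  obtain ⟨H, M, h1, h2, h3, h4, h5, h6, h7⟩ := exists_test_approx hΩ hb hF hv
  have hH1 : ∀ n, ContDiff ℝ 1 (H n) := fun n => (h1 n).of_le (by exact_mod_cast le_top)
  have ht := tendsto_setIntegral_mul hΩ (a := fun _ => 1) (h := fun n => pd i (H n))
    (fun n => ((hH1 n).continuous_fderiv (by norm_num)).clm_apply continuous_const)
    (fun n => h5 n i) (integrableOn_const hb.measure_lt_top.ne) (h7 i)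
  have h0 : ∀ n, ∫ x in Ω, 1 * pd i (H n) x = 0 := by
    intro n
    have := setIntegral_pd_mul_test hΩ (f := fun _ => 1) contDiffOn_const (hH1 n) (h2 n) (h3 n) i
    simp only [pd_const, zero_mul, integral_zero] at this
    linarith
  simp only [h0] at ht
  simpa using tendsto_nhds_unique ht tendsto_const_nhds

/-- The Jacobian determinant `∂₁F ∂₂b - ∂₂F ∂₁b` integrates to zero if `F` vanishes at the
boundary, whatever the boundary values of `b`. -/
lemma setIntegral_jacobian_eq_zero {F b : Plane → ℝ} (hF : Reg1 Ω F) (hv : Vanish Ω F)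
    (hbr : Reg1 Ω b) : ∫ x in Ω, (pd 0 F x * pd 1 b x - pd 1 F x * pd 0 b x) = 0 := by
  obtain ⟨H, M, h1, h2, h3, h4, h5, h6, h7⟩ := exists_test_approx hΩ hb hF hv
  have hH1 : ∀ n, ContDiff ℝ 1 (H n) := fun n => (h1 n).of_le (by exact_mod_cast le_top)
  have hpd : ∀ n i, ContDiff ℝ 1 (pd i (H n)) := fun n i =>
    ((h1 n).fderiv_right (m := 1) (by norm_cast)).clm_apply contDiff_const
  have ht : ∀ i j, Tendsto (fun n => ∫ x in Ω, pd j b x * pd i (H n) x) atTop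
      (𝓝 (∫ x in Ω, pd j b x * pd i F x)) := fun i j =>
    tendsto_setIntegral_mul hΩ (fun n => (hpd n i).continuous) (fun n => h5 n i)
      (hbr.integrableOn_pd hΩ hb j) (h7 i)
  have hsub : ∀ n i, tsupport (pd i (H n)) ⊆ tsupport (H n) := fun n i =>
    closure_minimal (fun x hx => by
      by_contra h
      exact hx (pd_eq_zero_of_notMem_tsupport h i)) (isClosed_tsupport _)
  have hpart : ∀ n i j, ∫ x in Ω, pd j b x * pd i (H n) x =
      -∫ x in Ω, b x * pd j (pd i (H n)) x := fun n i j =>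
    setIntegral_pd_mul_test hΩ hbr.contDiffOn (hpd n i)
      ((h2 n).of_isClosed_subset (isClosed_tsupport _) (hsub n i)) ((hsub n i).trans (h3 n)) j
  have hEq : ∀ n, ∫ x in Ω, pd 1 b x * pd 0 (H n) x = ∫ x in Ω, pd 0 b x * pd 1 (H n) x := by
    intro n
    rw [hpart, hpart]
    congr 1
    refine integral_congr_ae (.of_forall fun x => ?_)
    have h2n : ContDiffOn ℝ 2 (H n) univ := (contDiff_infty.1 (h1 n) 2).contDiffOn
    simp only [pd_comm isOpen_univ h2n 1 0 (mem_univ x)]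
  have hlim := tendsto_nhds_unique (ht 0 1) ((ht 1 0).congr fun n => (hEq n).symm)
  have hint : ∀ i j, IntegrableOn (fun x => pd i F x * pd j b x) Ω := fun i j => by
    obtain ⟨K, hK⟩ := hF.bdd_pd
    obtain ⟨L, hL⟩ := hbr.bdd_pd
    refine integrableOn_of_bdd hΩ hb ((hF.continuousOn_pd hΩ i).mul (hbr.continuousOn_pd hΩ j))
      ⟨K * L, fun x hx => ?_⟩
    rw [norm_mul]
    exact mul_le_mul (hK i x hx) (hL j x hx) (abs_nonneg _) ((abs_nonneg _).trans (hK i x hx))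
  rw [integral_sub (hint 0 1) (hint 1 0), sub_eq_zero]
  simpa only [mul_comm] using hlim

/-- The weak derivatives of an `H¹` function may be tested against functions with bounded
derivatives that vanish at the boundary. -/
lemma IsH1.setIntegral_mul_pd {w : Plane → Plane} {g : Fin 2 → Plane → Plane} (hw : IsH1 Ω w g)
    {F : Plane → ℝ} (hF : Reg1 Ω F) (hv : Vanish Ω F) (i k : Fin 2) :
    ∫ x in Ω, w x k * pd i F x = -∫ x in Ω, g i x k * F x := by
  obtain ⟨H, M, h1, h2, h3, h4, h5, h6, h7⟩ := exists_test_approx hΩ hb hF hv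
  have hH1 : ∀ n, ContDiff ℝ 1 (H n) := fun n => (h1 n).of_le (by exact_mod_cast le_top)
  have hfin : IsFiniteMeasure (volume.restrict Ω) := ⟨by simpa using hb.measure_lt_top⟩
  have hcomp : ∀ {z : Plane → Plane}, MemLp z 2 (volume.restrict Ω) →
      IntegrableOn (fun x => z x k) Ω := by
    intro z hz
    exact ((EuclideanSpace.proj k : Plane →L[ℝ] ℝ).integrable_comp (hz.integrable (by norm_num)))
  have ht1 := tendsto_setIntegral_mul hΩ (h := fun n => pd i (H n))
    (fun n => ((hH1 n).continuous_fderiv (by norm_num)).clm_apply continuous_const)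
    (fun n => h5 n i) (hcomp hw.memLp) (h7 i)
  have ht2 := tendsto_setIntegral_mul hΩ (h := H) (h' := F)
    (fun n => (h1 n).continuous) h4 (hcomp (hw.memLp_grad i))
    ((ae_restrict_mem hΩ.measurableSet).mono h6)
  refine tendsto_nhds_unique ht1 (ht2.neg.congr fun n => ?_)
  exact (hw.weak (H n) (h1 n) (h2 n) (h3 n) i k).symm

end Integral

/-! ### Regularity up to the boundary of the space-time cylinder -/

/-- The closed space-time cylinder. -/
def closedCyl (T : ℝ) (Ω : Set Plane) : Set (ℝ × Plane) := Icc 0 T ×ˢ closure Ω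

/-- `f` and its first space derivatives are continuous up to the boundary of the space-time
cylinder; the conditions include the initial and the final time. -/
structure SpaceReg1 (T : ℝ) (Ω : Set Plane) (f : ℝ → Plane → ℝ) : Prop where
  continuousOn : ContinuousOn (Function.uncurry f) (closedCyl T Ω)
  contDiffOn : ∀ t ∈ Icc 0 T, ContDiffOn ℝ 1 (f t) Ω
  exists_ext : ∃ G : Fin 2 → ℝ → Plane → ℝ,
    (∀ i, ContinuousOn (Function.uncurry (G i)) (closedCyl T Ω)) ∧
      ∀ i, ∀ t ∈ Icc 0 T, ∀ x ∈ Ω, pd i (f t) x = G i t x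

/-- `f` and its space derivatives of orders one and two are continuous up to the boundary of the
space-time cylinder. -/
structure SpaceReg2 (T : ℝ) (Ω : Set Plane) (f : ℝ → Plane → ℝ) : Prop where
  reg1 : SpaceReg1 T Ω f
  exists_ext : ∃ G : Fin 2 → ℝ → Plane → ℝ,
    (∀ i, SpaceReg1 T Ω (G i)) ∧ ∀ i, ∀ t ∈ Icc 0 T, ∀ x ∈ Ω, pd i (f t) x = G i t x

/-- `f` has a time derivative in the open space-time cylinder that is continuous and bounded. -/
structure TimeReg (T : ℝ) (Ω : Set Plane) (f : ℝ → Plane → ℝ) : Prop where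
  hasDerivAt : ∀ t ∈ Ioo 0 T, ∀ x ∈ Ω, HasDerivAt (fun s => f s x) (deriv (fun s => f s x) t) t
  continuousOn : ContinuousOn (fun p : ℝ × Plane => deriv (fun s => f s p.2) p.1) (cyl T Ω)
  bdd : ∃ K, ∀ t ∈ Ioo 0 T, ∀ x ∈ Ω, |deriv (fun s => f s x) t| ≤ K

section Cyl

variable {T : ℝ} {Ω : Set Plane} {f : ℝ → Plane → ℝ}

lemma isCompact_closedCyl (hb : Bornology.IsBounded Ω) : IsCompact (closedCyl T Ω) :=
  isCompact_Icc.prod hb.isCompact_closure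

lemma closure_cyl (hT : 0 < T) : closure (cyl T Ω) = closedCyl T Ω := by
  rw [cyl, closedCyl, closure_prod_eq, closure_Ioo hT.ne]

lemma cyl_subset_closedCyl : cyl T Ω ⊆ closedCyl T Ω :=
  prod_mono Ioo_subset_Icc_self subset_closure

lemma isOpen_cyl (hΩ : IsOpen Ω) : IsOpen (cyl T Ω) := isOpen_Ioo.prod hΩ

lemma exists_continuousOn_extension (hT : 0 < T) {E : Type*} [NormedAddCommGroup E]
    [CompleteSpace E] {G : ℝ × Plane → E} (hG : UniformContinuousOn G (cyl T Ω)) :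
    ∃ G' : ℝ × Plane → E, ContinuousOn G' (closedCyl T Ω) ∧ EqOn G' G (cyl T Ω) := by
  refine ⟨extendFrom (cyl T Ω) G, continuousOn_extendFrom (closure_cyl hT).ge fun p hp => ?_,
    fun p hp => extendFrom_eq (subset_closure hp) (hG.continuousOn p hp)⟩
  rw [← closure_cyl hT, mem_closure_iff_nhdsWithin_neBot] at hp
  exact cauchy_iff_exists_le_nhds.1
    ((cauchy_nhds.mono nhdsWithin_le_nhds).map_of_le hG inf_le_right)

lemma fderiv_eq_sum {f : Plane → ℝ} (x : Plane) :
    fderiv ℝ f x = ∑ i, pd i f x • (EuclideanSpace.proj i : Plane →L[ℝ] ℝ) := by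
  ext v
  rw [fderiv_apply_eq]
  simp [Fin.sum_univ_two, mul_comm]

lemma contDiffOn_one_of_hasFDerivAt (hΩ : IsOpen Ω) {f : Plane → ℝ} {G : Fin 2 → Plane → ℝ}
    (h : ∀ x ∈ Ω, HasFDerivAt f (∑ i, G i x • (EuclideanSpace.proj i : Plane →L[ℝ] ℝ)) x)
    (hG : ∀ i, ContinuousOn (G i) Ω) : ContDiffOn ℝ 1 f Ω := by
  have h01 : (1 : WithTop ℕ∞) = 0 + 1 := by norm_num
  rw [h01, contDiffOn_succ_iff_fderiv_of_isOpen hΩ, contDiffOn_zero]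
  refine ⟨fun x hx => (h x hx).differentiableAt.differentiableWithinAt, by simp, ?_⟩
  have h1 : ContinuousOn (fun x => ∑ i, G i x • (EuclideanSpace.proj i : Plane →L[ℝ] ℝ)) Ω :=
    continuousOn_finsetSum _ fun i _ => (hG i).smul continuousOn_const
  exact h1.congr fun x hx => (h x hx).fderiv

lemma contDiffOn_two_of_pd (hΩ : IsOpen Ω) {f : Plane → ℝ} (h : ContDiffOn ℝ 1 f Ω)
    (h' : ∀ i, ContDiffOn ℝ 1 (pd i f) Ω) : ContDiffOn ℝ 2 f Ω := by
  have : (2 : WithTop ℕ∞) = 1 + 1 := by norm_num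
  rw [this, contDiffOn_succ_iff_fderiv_of_isOpen hΩ]
  refine ⟨h.differentiableOn (by norm_num), by simp, ?_⟩
  have h1 : ContDiffOn ℝ 1
      (fun x => ∑ i, pd i f x • (EuclideanSpace.proj i : Plane →L[ℝ] ℝ)) Ω :=
    ContDiffOn.sum fun i _ => (h' i).smul contDiffOn_const
  exact h1.congr fun x _ => fderiv_eq_sum x

/-- If the space derivatives of `f` inside the cylinder extend continuously to the closed
cylinder, then the extensions are the derivatives at the initial and final times, too. -/
lemma spaceReg1_of_ext (hT : 0 < T) (hΩ : IsOpen Ω) (hb : Bornology.IsBounded Ω)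
    (hf : ContinuousOn (Function.uncurry f) (closedCyl T Ω))
    (hd : ∀ t ∈ Ioo 0 T, ContDiffOn ℝ 1 (f t) Ω) {G : Fin 2 → ℝ → Plane → ℝ}
    (hG : ∀ i, ContinuousOn (Function.uncurry (G i)) (closedCyl T Ω))
    (hfG : ∀ i, ∀ t ∈ Ioo 0 T, ∀ x ∈ Ω, pd i (f t) x = G i t x) :
    SpaceReg1 T Ω f ∧ ∀ i, ∀ t ∈ Icc 0 T, ∀ x ∈ Ω, pd i (f t) x = G i t x := by
  have key : ∀ t ∈ Icc 0 T, ∀ x ∈ Ω,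
      HasFDerivAt (f t) (∑ i, G i t x • (EuclideanSpace.proj i : Plane →L[ℝ] ℝ)) x := by
    intro t ht x hx
    rw [← closure_Ioo hT.ne, mem_closure_iff_seq_limit] at ht
    obtain ⟨s, hs, hst⟩ := ht
    have htI : t ∈ Icc 0 T := by
      rw [← closure_Ioo hT.ne]; exact mem_closure_iff_seq_limit.2 ⟨s, hs, hst⟩
    have hGu : ∀ i, TendstoUniformlyOn (fun n x => G i (s n) x) (fun x => G i t x) atTop Ω := by
      intro i
      have hu := (isCompact_closedCyl hb).uniformContinuousOn_of_continuous (hG i)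
      rw [Metric.uniformContinuousOn_iff] at hu
      rw [Metric.tendstoUniformlyOn_iff]
      intro ε hε
      obtain ⟨δ, hδ, h⟩ := hu ε hε
      filter_upwards [Metric.tendsto_nhds.1 hst δ hδ] with n hn x hx
      refine h (t, x) ⟨htI, subset_closure hx⟩ (s n, x)
        ⟨Ioo_subset_Icc_self (hs n), subset_closure hx⟩ ?_
      simpa [Prod.dist_eq, dist_comm, hδ] using hn
    have hsm : ∀ i, TendstoUniformlyOn
        (fun n x => G i (s n) x • (EuclideanSpace.proj i : Plane →L[ℝ] ℝ))
        (fun x => G i t x • (EuclideanSpace.proj i : Plane →L[ℝ] ℝ)) atTop Ω := by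
      intro i
      exact ((ContinuousLinearMap.toSpanSingleton ℝ
        (EuclideanSpace.proj i : Plane →L[ℝ] ℝ)).uniformContinuous).comp_tendstoUniformlyOn (hGu i)
    have hsum : TendstoUniformlyOn
        (fun n x => ∑ i, G i (s n) x • (EuclideanSpace.proj i : Plane →L[ℝ] ℝ))
        (fun x => ∑ i, G i t x • (EuclideanSpace.proj i : Plane →L[ℝ] ℝ)) atTop Ω := by
      simp only [Fin.sum_univ_two]
      exact (hsm 0).add (hsm 1)
    refine hasFDerivAt_of_tendstoUniformlyOn (f := fun n => f (s n)) hΩ hsum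
      (fun n y hy => ?_) (fun y hy => ?_) hx
    · have := (differentiableAt_of_contDiffOn hΩ (hd _ (hs n)) hy).hasFDerivAt
      rw [fderiv_eq_sum] at this
      simpa only [hfG _ _ (hs n) y hy] using this
    · have h1 : ContinuousWithinAt (Function.uncurry f) (closedCyl T Ω) (t, y) :=
        hf _ ⟨htI, subset_closure hy⟩
      refine h1.tendsto.comp (tendsto_nhdsWithin_iff.2 ⟨hst.prodMk_nhds tendsto_const_nhds,
        .of_forall fun n => ⟨Ioo_subset_Icc_self (hs n), subset_closure hy⟩⟩)
  have hpd : ∀ i, ∀ t ∈ Icc 0 T, ∀ x ∈ Ω, pd i (f t) x = G i t x := by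
    intro i t ht x hx
    rw [pd_of_hasFDerivAt (key t ht x hx)]
    fin_cases i <;> simp [Fin.sum_univ_two]
  refine ⟨⟨hf, fun t ht => contDiffOn_one_of_hasFDerivAt hΩ (key t ht) fun i => ?_,
    G, hG, hpd⟩, hpd⟩
  exact (hG i).comp (f := fun x => (t, x)) (by fun_prop) fun x hx => ⟨ht, subset_closure hx⟩

lemma IsC1Closed.hasFDerivAt (hΩ : IsOpen Ω) (hf : IsC1Closed T Ω f) {t : ℝ} (ht : t ∈ Ioo 0 T)
    {x : Plane} (hx : x ∈ Ω) :
    HasFDerivAt (Function.uncurry f) (fderiv ℝ (Function.uncurry f) (t, x)) (t, x) :=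
  ((hf.contDiffOn.differentiableOn (by norm_num)).differentiableAt
    ((isOpen_cyl hΩ).mem_nhds ⟨ht, hx⟩)).hasFDerivAt

lemma IsC1Closed.hasDerivAt (hΩ : IsOpen Ω) (hf : IsC1Closed T Ω f) {t : ℝ} (ht : t ∈ Ioo 0 T)
    {x : Plane} (hx : x ∈ Ω) :
    HasDerivAt (fun s => f s x) (fderiv ℝ (Function.uncurry f) (t, x) (1, 0)) t :=
  HasFDerivAt.comp_hasDerivAt (f := fun s => (s, x)) t (hf.hasFDerivAt hΩ ht hx)
    ((hasDerivAt_id t).prodMk (hasDerivAt_const t x))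

lemma IsC1Closed.pd_eq (hΩ : IsOpen Ω) (hf : IsC1Closed T Ω f) {t : ℝ} (ht : t ∈ Ioo 0 T)
    {x : Plane} (hx : x ∈ Ω) (i : Fin 2) :
    pd i (f t) x = fderiv ℝ (Function.uncurry f) (t, x) (0, EuclideanSpace.single i 1) := by
  have h := (hf.hasFDerivAt hΩ ht hx).comp (f := fun y => (t, y)) x
    ((hasFDerivAt_const t x).prodMk (hasFDerivAt_id x))
  exact (pd_of_hasFDerivAt (f := f t) h i).trans (by simp)

lemma IsC1Closed.timeReg (hT : 0 < T) (hΩ : IsOpen Ω) (hb : Bornology.IsBounded Ω)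
    (hf : IsC1Closed T Ω f) : TimeReg T Ω f := by
  obtain ⟨G, hG, hGf⟩ := exists_continuousOn_extension hT hf.uniformContinuousOn
  have hG' : ContinuousOn (fun p => G p (1, 0)) (closedCyl T Ω) := hG.clm_apply continuousOn_const
  have heq : ∀ t ∈ Ioo 0 T, ∀ x ∈ Ω, deriv (fun s => f s x) t = G (t, x) (1, 0) := by
    intro t ht x hx
    rw [(hf.hasDerivAt hΩ ht hx).deriv, hGf ⟨ht, hx⟩]
  refine ⟨fun t ht x hx => (hf.hasDerivAt hΩ ht hx).differentiableAt.hasDerivAt, ?_, ?_⟩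
  · exact (hG'.mono cyl_subset_closedCyl).congr fun p hp => heq p.1 hp.1 p.2 hp.2
  · obtain ⟨K, hK⟩ := (isCompact_closedCyl hb).exists_bound_of_continuousOn hG'
    exact ⟨K, fun t ht x hx => by
      rw [heq t ht x hx]; exact hK (t, x) (cyl_subset_closedCyl ⟨ht, hx⟩)⟩

lemma IsC1Closed.spaceReg1 (hT : 0 < T) (hΩ : IsOpen Ω) (hb : Bornology.IsBounded Ω)
    (hf : IsC1Closed T Ω f) : SpaceReg1 T Ω f := by
  obtain ⟨G, hG, hGf⟩ := exists_continuousOn_extension hT hf.uniformContinuousOn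
  refine (spaceReg1_of_ext hT hΩ hb hf.continuousOn (fun t ht => ?_)
    (G := fun i t x => G (t, x) (0, EuclideanSpace.single i 1))
    (fun i => hG.clm_apply continuousOn_const) fun i t ht x hx => ?_).1
  · exact hf.contDiffOn.comp (f := fun x => (t, x)) (by fun_prop) fun x hx => ⟨ht, hx⟩
  · rw [hf.pd_eq hΩ ht hx, hGf ⟨ht, hx⟩]

lemma IsC21Closed.spaceReg2 (hT : 0 < T) (hΩ : IsOpen Ω) (hb : Bornology.IsBounded Ω)
    (hf : IsC21Closed T Ω f) : SpaceReg2 T Ω f := by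
  have h1 := hf.toIsC1Closed.spaceReg1 hT hΩ hb
  obtain ⟨G, hG, hfG⟩ := h1.exists_ext
  choose G₂ hG₂ hfG₂ using fun i j => exists_continuousOn_extension hT
    (hf.uniformContinuousOn_snd i j)
  refine ⟨h1, G, fun j => (spaceReg1_of_ext hT hΩ hb (hG j) (fun t ht => ?_)
    (G := fun i t x => G₂ i j (t, x)) (fun i => hG₂ i j) fun i t ht x hx => ?_).1, hfG⟩
  · have h2 : ContDiffOn ℝ 1 (pd j (f t)) Ω :=
      ((hf.contDiffOn_slice t ht).fderiv_of_isOpen hΩ (m := 1) (by norm_num)).clm_apply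
        contDiffOn_const
    exact h2.congr fun x hx => (hfG j t (Ioo_subset_Icc_self ht) x hx).symm
  · rw [hfG₂ i j ⟨ht, hx⟩]
    exact pd_congr_on hΩ (fun y hy => (hfG j t (Ioo_subset_Icc_self ht) y hy).symm) i hx

lemma SpaceReg1.bdd (hb : Bornology.IsBounded Ω) (hf : SpaceReg1 T Ω f) :
    ∃ K, 0 ≤ K ∧ ∀ t ∈ Icc 0 T, ∀ x ∈ closure Ω, |f t x| ≤ K := by
  obtain ⟨K, hK⟩ := (isCompact_closedCyl hb).exists_bound_of_continuousOn hf.continuousOn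
  exact ⟨max K 0, le_max_right _ _, fun t ht x hx => le_max_of_le_left (hK (t, x) ⟨ht, hx⟩)⟩

lemma SpaceReg1.bdd_pd (hb : Bornology.IsBounded Ω) (hf : SpaceReg1 T Ω f) :
    ∃ K, 0 ≤ K ∧ ∀ i, ∀ t ∈ Icc 0 T, ∀ x ∈ Ω, |pd i (f t) x| ≤ K := by
  obtain ⟨G, hG, hfG⟩ := hf.exists_ext
  choose K hK using fun i => (isCompact_closedCyl hb).exists_bound_of_continuousOn (hG i)
  refine ⟨|K 0| + |K 1|, by positivity, fun i t ht x hx => ?_⟩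
  rw [hfG i t ht x hx]
  have := hK i (t, x) ⟨ht, subset_closure hx⟩
  rw [Real.norm_eq_abs] at this
  refine this.trans ?_
  have h0 := le_abs_self (K 0)
  have h1 := le_abs_self (K 1)
  have h2 := abs_nonneg (K 0)
  have h3 := abs_nonneg (K 1)
  fin_cases i
  · exact h0.trans (by linarith)
  · exact h1.trans (by linarith)

lemma SpaceReg1.continuousOn_pd (hf : SpaceReg1 T Ω f) (i : Fin 2) :
    ContinuousOn (fun p : ℝ × Plane => pd i (f p.1) p.2) (Icc 0 T ×ˢ Ω) := by
  obtain ⟨G, hG, hfG⟩ := hf.exists_ext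
  exact ((hG i).mono (prod_mono_right subset_closure)).congr fun p hp => hfG i p.1 hp.1 p.2 hp.2

lemma SpaceReg1.continuousOn_prod (hf : SpaceReg1 T Ω f) :
    ContinuousOn (fun p : ℝ × Plane => f p.1 p.2) (Icc 0 T ×ˢ Ω) :=
  hf.continuousOn.mono (prod_mono_right subset_closure)

lemma SpaceReg1.continuousOn_slice (hf : SpaceReg1 T Ω f) {t : ℝ} (ht : t ∈ Icc 0 T) :
    ContinuousOn (f t) (closure Ω) :=
  hf.continuousOn.comp (f := fun x => (t, x)) (by fun_prop) fun x hx => ⟨ht, hx⟩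

lemma SpaceReg1.reg1_slice (hb : Bornology.IsBounded Ω) (hf : SpaceReg1 T Ω f) {t : ℝ}
    (ht : t ∈ Icc 0 T) : Reg1 Ω (f t) := by
  obtain ⟨K, -, hK⟩ := hf.bdd hb
  obtain ⟨L, -, hL⟩ := hf.bdd_pd hb
  exact ⟨hf.contDiffOn t ht, ⟨K, fun x hx => hK t ht x (subset_closure hx)⟩,
    ⟨L, fun i x hx => hL i t ht x hx⟩⟩

lemma SpaceReg2.reg2_slice (hΩ : IsOpen Ω) (hb : Bornology.IsBounded Ω) (hf : SpaceReg2 T Ω f)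
    {t : ℝ} (ht : t ∈ Icc 0 T) : Reg2 Ω (f t) := by
  obtain ⟨G, hG, hfG⟩ := hf.exists_ext
  have h : ∀ i, Reg1 Ω (pd i (f t)) := fun i =>
    ((hG i).reg1_slice hb ht).congr hΩ fun x hx => hfG i t ht x hx
  exact ⟨hf.reg1.reg1_slice hb ht,
    contDiffOn_two_of_pd hΩ (hf.reg1.contDiffOn t ht) fun i => (h i).contDiffOn, h⟩

lemma SpaceReg2.continuousOn_pd_pd (hΩ : IsOpen Ω) (hf : SpaceReg2 T Ω f) (i j : Fin 2) :
    ContinuousOn (fun p : ℝ × Plane => pd i (pd j (f p.1)) p.2) (Icc 0 T ×ˢ Ω) := by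
  obtain ⟨G, hG, hfG⟩ := hf.exists_ext
  exact ((hG j).continuousOn_pd i).congr fun p hp => pd_congr_on hΩ (hfG j p.1 hp.1) i hp.2

lemma SpaceReg2.bdd_pd_pd (hΩ : IsOpen Ω) (hb : Bornology.IsBounded Ω) (hf : SpaceReg2 T Ω f) :
    ∃ K, 0 ≤ K ∧ ∀ i j, ∀ t ∈ Icc 0 T, ∀ x ∈ Ω, |pd i (pd j (f t)) x| ≤ K := by
  obtain ⟨G, hG, hfG⟩ := hf.exists_ext
  choose K hK0 hK using fun j => (hG j).bdd_pd hb
  refine ⟨K 0 + K 1, add_nonneg (hK0 0) (hK0 1), fun i j t ht x hx => ?_⟩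
  rw [pd_congr_on hΩ (hfG j t ht) i hx]
  refine (hK j i t ht x hx).trans ?_
  fin_cases j
  · simpa using hK0 1
  · simpa using hK0 0

/-- At boundary points the space derivatives have limits. -/
lemma SpaceReg1.exists_tendsto_pd (hf : SpaceReg1 T Ω f) {t : ℝ} (ht : t ∈ Icc 0 T) :
    ∃ g : Fin 2 → Plane → ℝ, (∀ i, ContinuousOn (g i) (closure Ω)) ∧
      ∀ i, EqOn (pd i (f t)) (g i) Ω := by
  obtain ⟨G, hG, hfG⟩ := hf.exists_ext
  exact ⟨fun i => G i t, fun i => (hG i).comp (f := fun x => (t, x)) (by fun_prop)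
    fun x hx => ⟨ht, hx⟩, fun i x hx => hfG i t ht x hx⟩

/-! ### Integrals depending on time -/

lemma continuousOn_setIntegral (hΩ : IsOpen Ω) (hb : Bornology.IsBounded Ω) {S : Set ℝ}
    {e : ℝ → Plane → ℝ} (he : ContinuousOn (fun p : ℝ × Plane => e p.1 p.2) (S ×ˢ Ω))
    (hK : ∃ K, ∀ t ∈ S, ∀ x ∈ Ω, |e t x| ≤ K) :
    ContinuousOn (fun t => ∫ x in Ω, e t x) S := by
  obtain ⟨K, hK⟩ := hK
  refine continuousOn_of_dominated (bound := fun _ => K) (fun t ht => ?_) (fun t ht => ?_)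
    (integrableOn_const hb.measure_lt_top.ne) ?_
  · exact (he.comp (f := fun x => (t, x)) (by fun_prop)
      fun x hx => ⟨ht, hx⟩).aestronglyMeasurable hΩ.measurableSet
  · exact (ae_restrict_mem hΩ.measurableSet).mono (hK t ht)
  · exact (ae_restrict_mem hΩ.measurableSet).mono fun x hx =>
      he.comp (f := fun t => (t, x)) (by fun_prop) fun t ht => ⟨ht, hx⟩

lemma integrableOn_and_hasDerivAt_setIntegral (hΩ : IsOpen Ω) (hb : Bornology.IsBounded Ω)
    {e e' : ℝ → Plane → ℝ} {t : ℝ} (ht : t ∈ Ioo 0 T)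
    (he : ∀ s ∈ Ioo 0 T, IntegrableOn (e s) Ω) (he' : ContinuousOn (e' t) Ω)
    (hd : ∀ s ∈ Ioo 0 T, ∀ x ∈ Ω, HasDerivAt (fun r => e r x) (e' s x) s)
    (hK : ∃ K, ∀ s ∈ Ioo 0 T, ∀ x ∈ Ω, |e' s x| ≤ K) :
    IntegrableOn (e' t) Ω ∧ HasDerivAt (fun s => ∫ x in Ω, e s x) (∫ x in Ω, e' t x) t := by
  obtain ⟨K, hK⟩ := hK
  have hnh : Ioo 0 T ∈ 𝓝 t := isOpen_Ioo.mem_nhds ht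
  refine hasDerivAt_integral_of_dominated_loc_of_deriv_le (bound := fun _ => K) hnh
    ?_ (he t ht) (he'.aestronglyMeasurable hΩ.measurableSet) ?_
    (integrableOn_const hb.measure_lt_top.ne) ?_
  · filter_upwards [hnh] with s hs using (he s hs).aestronglyMeasurable
  · exact (ae_restrict_mem hΩ.measurableSet).mono fun x hx s hs => hK s hs x hx
  · exact (ae_restrict_mem hΩ.measurableSet).mono fun x hx s hs => hd s hs x hx

lemma hasDerivAt_setIntegral (hΩ : IsOpen Ω) (hb : Bornology.IsBounded Ω)
    {e e' : ℝ → Plane → ℝ} {t : ℝ} (ht : t ∈ Ioo 0 T)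
    (he : ∀ s ∈ Ioo 0 T, IntegrableOn (e s) Ω) (he' : ContinuousOn (e' t) Ω)
    (hd : ∀ s ∈ Ioo 0 T, ∀ x ∈ Ω, HasDerivAt (fun r => e r x) (e' s x) s)
    (hK : ∃ K, ∀ s ∈ Ioo 0 T, ∀ x ∈ Ω, |e' s x| ≤ K) :
    HasDerivAt (fun s => ∫ x in Ω, e s x) (∫ x in Ω, e' t x) t :=
  (integrableOn_and_hasDerivAt_setIntegral hΩ hb ht he he' hd hK).2

/-- A form of Gronwall's lemma: a function with `y' ≤ K y` that starts below zero stays there. -/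
lemma nonpos_of_deriv_le {y y' : ℝ → ℝ} {K : ℝ} (hc : ContinuousOn y (Icc 0 T))
    (hd : ∀ t ∈ Ioo 0 T, HasDerivAt y (y' t) t) (hK : ∀ t ∈ Ioo 0 T, y' t ≤ K * y t)
    (h0 : y 0 ≤ 0) : ∀ t ∈ Icc 0 T, y t ≤ 0 := by
  have hanti : AntitoneOn (fun t => Real.exp (-K * t) * y t) (Icc 0 T) := by
    have hder : ∀ t ∈ Ioo 0 T, HasDerivAt (fun t => Real.exp (-K * t) * y t)
        (Real.exp (-K * t) * (y' t - K * y t)) t := by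
      intro t ht
      have h1 : HasDerivAt (fun t => Real.exp (-K * t)) (Real.exp (-K * t) * -K) t := by
        simpa using ((hasDerivAt_id t).const_mul (-K)).exp
      exact (h1.mul (hd t ht)).congr_deriv (by ring)
    refine antitoneOn_of_deriv_nonpos (convex_Icc 0 T) ?_ ?_ ?_
    · exact (by fun_prop : Continuous fun t => Real.exp (-K * t)).continuousOn.mul hc
    · rw [interior_Icc]
      exact fun t ht => (hder t ht).differentiableAt.differentiableWithinAt
    · rw [interior_Icc]
      intro t ht
      rw [(hder t ht).deriv]
      exact mul_nonpos_of_nonneg_of_nonpos (Real.exp_nonneg _) (by linarith [hK t ht])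
  intro t ht
  have h := hanti ⟨le_rfl, ht.1.trans ht.2⟩ ht ht.1
  simp only [mul_zero, Real.exp_zero, one_mul] at h
  by_contra! hpos
  have : 0 < Real.exp (-K * t) * y t := by positivity
  linarith

lemma eq_zero_of_setIntegral_nonpos (hΩ : IsOpen Ω) (hb : Bornology.IsBounded Ω) {e : Plane → ℝ}
    (he : ContinuousOn e Ω) (hK : ∃ K, ∀ x ∈ Ω, |e x| ≤ K) (h0 : ∀ x ∈ Ω, 0 ≤ e x)
    (h : ∫ x in Ω, e x ≤ 0) : ∀ x ∈ Ω, e x = 0 := by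
  have hint := integrableOn_of_bdd hΩ hb he hK
  have h1 := (setIntegral_eq_zero_iff_of_nonneg_ae
    ((ae_restrict_mem hΩ.measurableSet).mono h0) hint).1
    (le_antisymm h (setIntegral_nonneg hΩ.measurableSet h0))
  have h2 : EqOn e 0 Ω := MeasureTheory.Measure.eqOn_open_of_ae_eq h1 hΩ he continuousOn_const
  exact h2

end Cyl

/-! ### Positivity of the density and the length of the director -/

lemma hasDerivAt_min_sq (s : ℝ) : HasDerivAt (fun r : ℝ => min r 0 ^ 2) (2 * min s 0) s := by
  rcases lt_trichotomy s 0 with hs | rfl | hs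
  · rw [min_eq_left hs.le]
    have h1 : HasDerivAt (fun r : ℝ => r ^ 2) (2 * s) s := by simpa using hasDerivAt_pow 2 s
    refine h1.congr_of_eventuallyEq ?_
    filter_upwards [gt_mem_nhds hs] with r hr
    rw [min_eq_left (le_of_lt hr)]
  · rw [hasDerivAt_iff_isLittleO_nhds_zero]
    have h2 : (fun h : ℝ => h ^ 2) =o[𝓝 0] fun h => h :=
      Asymptotics.isLittleO_pow_id (by norm_num)
    refine Asymptotics.IsBigO.trans_isLittleO ?_ h2
    refine Asymptotics.IsBigO.of_bound 1 (.of_forall fun h => ?_)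
    have : min h 0 ^ 2 ≤ h ^ 2 := by
      rcases le_total h 0 with hh | hh
      · rw [min_eq_left hh]
      · rw [min_eq_right hh, zero_pow two_ne_zero]; exact sq_nonneg h
    simpa using this
  · rw [min_eq_right hs.le]
    refine (hasDerivAt_const s (0 : ℝ)).congr_of_eventuallyEq ?_ |>.congr_deriv (by simp)
    filter_upwards [lt_mem_nhds hs] with r hr
    simp [min_eq_right (le_of_lt hr)]

lemma contDiff_min_sq : ContDiff ℝ 1 fun r : ℝ => min r 0 ^ 2 := by
  rw [contDiff_one_iff_deriv]
  refine ⟨fun s => (hasDerivAt_min_sq s).differentiableAt, ?_⟩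
  have : deriv (fun r : ℝ => min r 0 ^ 2) = fun s => 2 * min s 0 :=
    funext fun s => (hasDerivAt_min_sq s).deriv
  rw [this]
  fun_prop

lemma norm_grad_sq (u : Plane → Plane) (x : Plane) :
    ‖grad u x‖ ^ 2 = ∑ i, ∑ k, pd i (fun y => u y k) x ^ 2 := by
  rw [EuclideanSpace.norm_sq_eq, Fintype.sum_prod_type]
  simp [grad]

section Solution

variable {A γ μ lam ν θ T : ℝ} {Ω : Set Plane} {ρ₀ : Plane → ℝ} {m₀ d₀ : Plane → Plane}
  {ρ : ℝ → Plane → ℝ} {v d : ℝ → Plane → Plane}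
  (h : IsClassicalSolution A γ μ lam ν θ T Ω ρ₀ m₀ d₀ ρ v d)
  (hT : 0 < T) (hΩ : IsOpen Ω) (hb : Bornology.IsBounded Ω)

include h

lemma IsClassicalSolution.vanish_velocity (hT : 0 < T) (hΩ : IsOpen Ω)
    (hb : Bornology.IsBounded Ω) {t : ℝ} (ht : t ∈ Ioo 0 T) (k : Fin 2) :
    Vanish Ω fun x => v t x k :=
  vanish_of_continuousOn (((h.reg_velocity k).spaceReg2 hT hΩ hb).reg1.continuousOn_slice
    (Ioo_subset_Icc_self ht)) fun y hy => by simp [h.bdry_velocity t ht y hy]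

lemma IsClassicalSolution.mass_expanded (hT : 0 < T) (hΩ : IsOpen Ω)
    (hb : Bornology.IsBounded Ω) {t : ℝ} (ht : t ∈ Ioo 0 T) {x : Plane} (hx : x ∈ Ω) :
    deriv (fun s => ρ s x) t + ∑ i, (pd i (ρ t) x * v t x i + ρ t x * pd i (fun y => v t y i) x)
      = 0 := by
  have hI := Ioo_subset_Icc_self ht
  rw [← h.mass t ht x hx, dvg]
  congr 1
  refine Finset.sum_congr rfl fun i _ => ?_
  rw [← pd_mul i ((h.reg_density.spaceReg1 hT hΩ hb |>.reg1_slice hb hI).differentiableAt hΩ hx)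
    (((h.reg_velocity i).spaceReg2 hT hΩ hb |>.reg1.reg1_slice hb hI).differentiableAt hΩ hx)]
  simp

/-- The density stays nonnegative: the square of its negative part satisfies a Gronwall
inequality. -/
lemma IsClassicalSolution.density_nonneg (hT : 0 < T) (hΩ : IsOpen Ω)
    (hb : Bornology.IsBounded Ω) (hρ₀ : ∀ x ∈ Ω, 0 ≤ ρ₀ x) :
    ∀ t ∈ Icc 0 T, ∀ x ∈ Ω, 0 ≤ ρ t x := by
  have hρ := h.reg_density.spaceReg1 hT hΩ hb
  have hρt := h.reg_density.timeReg hT hΩ hb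
  have hv := fun k => ((h.reg_velocity k).spaceReg2 hT hΩ hb).reg1
  obtain ⟨Kρ, hKρ0, hKρ⟩ := hρ.bdd hb
  obtain ⟨R, hR⟩ := hρt.bdd
  choose L hL0 hL using fun k => (hv k).bdd_pd hb
  have hmin : ∀ t ∈ Icc 0 T, ∀ x ∈ Ω, |min (ρ t x) 0| ≤ Kρ := fun t ht x hx => by
    have := abs_le.1 (hKρ t ht x (subset_closure hx))
    rw [abs_le]
    exact ⟨le_min this.1 (by linarith), (min_le_right _ _).trans hKρ0⟩
  have hsq : ∀ t ∈ Icc 0 T, ∀ x ∈ Ω, |min (ρ t x) 0 ^ 2| ≤ Kρ ^ 2 := fun t ht x hx => by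
    rw [abs_pow]; exact pow_le_pow_left₀ (abs_nonneg _) (hmin t ht x hx) 2
  have hcφ : ContinuousOn (fun p : ℝ × Plane => min (ρ p.1 p.2) 0 ^ 2) (Icc 0 T ×ˢ Ω) :=
    contDiff_min_sq.continuous.comp_continuousOn hρ.continuousOn_prod
  have hreg : ∀ t ∈ Icc 0 T, Reg1 Ω fun x => min (ρ t x) 0 ^ 2 := fun t ht =>
    (hρ.reg1_slice hb ht).comp hΩ contDiff_min_sq
  have hderiv : ∀ t ∈ Ioo 0 T, HasDerivAt (fun s => ∫ x in Ω, min (ρ s x) 0 ^ 2)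
      (∫ x in Ω, 2 * min (ρ t x) 0 * deriv (fun s => ρ s x) t) t := by
    intro t ht
    refine hasDerivAt_setIntegral hΩ hb ht
      (e' := fun t x => 2 * min (ρ t x) 0 * deriv (fun s => ρ s x) t)
      (fun s hs => (hreg s (Ioo_subset_Icc_self hs)).integrableOn hΩ hb) ?_ ?_
      ⟨2 * Kρ * R, fun s hs x hx => ?_⟩
    · have h1 : ContinuousOn (fun x => deriv (fun s => ρ s x) t) Ω :=
        hρt.continuousOn.comp (f := fun x => (t, x)) (by fun_prop) fun x hx => ⟨ht, hx⟩
      have h2 := (hρ.reg1_slice hb (Ioo_subset_Icc_self ht)).continuousOn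
      exact ((by fun_prop : Continuous fun s : ℝ => 2 * min s 0).comp_continuousOn h2).mul h1
    · intro s hs x hx
      exact (hasDerivAt_min_sq (ρ s x)).comp s (hρt.hasDerivAt s hs x hx)
    · rw [abs_mul, abs_mul, abs_two]
      gcongr
      · exact hmin s (Ioo_subset_Icc_self hs) x hx
      · exact hR s hs x hx
  have hle := nonpos_of_deriv_le (y := fun s => ∫ x in Ω, min (ρ s x) 0 ^ 2) (K := L 0 + L 1)
    (continuousOn_setIntegral hΩ hb hcφ ⟨_, hsq⟩) hderiv (fun t ht => ?_) ?_
  · intro t ht x hx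
    have := eq_zero_of_setIntegral_nonpos hΩ hb (hreg t ht).continuousOn (hreg t ht).bdd
      (fun x _ => sq_nonneg _) (hle t ht) x hx
    have := pow_eq_zero_iff (two_ne_zero) |>.1 this
    rw [← this]; exact min_le_left _ _
  · have hI := Ioo_subset_Icc_self ht
    have hF : ∀ i, Reg1 Ω fun x => v t x i * min (ρ t x) 0 ^ 2 := fun i =>
      ((hv i).reg1_slice hb hI).mul (hreg t hI) hΩ
    have hFv : ∀ i, Vanish Ω fun x => v t x i * min (ρ t x) 0 ^ 2 := fun i =>
      (h.vanish_velocity hT hΩ hb ht i).mul_bdd (hreg t hI).bdd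
    have hz := fun i => setIntegral_pd_eq_zero hΩ hb (hF i) (hFv i) i
    have hpoint : ∀ x ∈ Ω, 2 * min (ρ t x) 0 * deriv (fun s => ρ s x) t ≤
        (L 0 + L 1) * min (ρ t x) 0 ^ 2 +
          -(pd 0 (fun x => v t x 0 * min (ρ t x) 0 ^ 2) x +
            pd 1 (fun x => v t x 1 * min (ρ t x) 0 ^ 2) x) := by
      intro x hx
      have hpd : ∀ i, pd i (fun x => v t x i * min (ρ t x) 0 ^ 2) x =
          pd i (fun x => v t x i) x * min (ρ t x) 0 ^ 2 +
            v t x i * (2 * min (ρ t x) 0 * pd i (ρ t) x) := fun i => by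
        rw [pd_mul i (((hv i).reg1_slice hb hI).differentiableAt hΩ hx)
          ((hreg t hI).differentiableAt hΩ hx), pd_comp i (hasDerivAt_min_sq (ρ t x))
          ((hρ.reg1_slice hb hI).differentiableAt hΩ hx)]
      have hm := h.mass_expanded hT hΩ hb ht hx
      rw [Fin.sum_univ_two] at hm
      have hρm : ρ t x * min (ρ t x) 0 = min (ρ t x) 0 ^ 2 := by
        rcases le_total (ρ t x) 0 with hh | hh
        · rw [min_eq_left hh]; ring
        · rw [min_eq_right hh]; ring
      have h0 := neg_le_of_abs_le (hL 0 0 t hI x hx)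
      have h1 := neg_le_of_abs_le (hL 1 1 t hI x hx)
      rw [hpd, hpd]
      have hdR : deriv (fun s => ρ s x) t = -(pd 0 (ρ t) x * v t x 0 +
        ρ t x * pd 0 (fun y => v t y 0) x + (pd 1 (ρ t) x * v t x 1 +
        ρ t x * pd 1 (fun y => v t y 1) x)) := by linarith
      have h3 : 0 ≤ (L 0 + pd 0 (fun y => v t y 0) x) * min (ρ t x) 0 ^ 2 :=
        mul_nonneg (by linarith) (sq_nonneg _)
      have h4 : 0 ≤ (L 1 + pd 1 (fun y => v t y 1) x) * min (ρ t x) 0 ^ 2 :=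
        mul_nonneg (by linarith) (sq_nonneg _)
      rw [hdR]
      linear_combination h3 + h4 - 2 * (pd 0 (fun y => v t y 0) x + pd 1 (fun y => v t y 1) x) * hρm
    have hi1 := ((hreg t hI).const_mul hΩ (L 0 + L 1)).integrableOn hΩ hb
    have hi2 := ((hF 0).integrableOn_pd hΩ hb 0).add ((hF 1).integrableOn_pd hΩ hb 1)
    have hi3 : IntegrableOn (fun x => 2 * min (ρ t x) 0 * deriv (fun s => ρ s x) t) Ω := by
      have h1 : ContinuousOn (fun x => deriv (fun s => ρ s x) t) Ω :=
        hρt.continuousOn.comp (f := fun x => (t, x)) (by fun_prop) fun x hx => ⟨ht, hx⟩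
      have h2 := (hρ.reg1_slice hb (Ioo_subset_Icc_self ht)).continuousOn
      refine integrableOn_of_bdd hΩ hb
        (((by fun_prop : Continuous fun s : ℝ => 2 * min s 0).comp_continuousOn h2).mul h1)
        ⟨2 * Kρ * R, fun x hx => ?_⟩
      rw [Real.norm_eq_abs, abs_mul, abs_mul, abs_two]
      gcongr
      · exact hmin t hI x hx
      · exact hR t ht x hx
    have := setIntegral_mono_on hi3 (hi1.add hi2.neg) hΩ.measurableSet hpoint
    refine this.trans (le_of_eq ?_)
    have e1 := integral_add hi1 hi2.neg
    have e2 := integral_add ((hF 0).integrableOn_pd hΩ hb 0) ((hF 1).integrableOn_pd hΩ hb 1)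
    simp only [Pi.add_apply, Pi.neg_apply] at e1 e2 ⊢
    rw [e1, integral_neg, e2, hz, hz, integral_const_mul]
    ring
  · refine le_of_eq (setIntegral_eq_zero_of_forall_eq_zero fun x hx => ?_)
    rw [h.init_density x hx, min_eq_right (hρ₀ x hx)]; simp

/-- On the boundary the director does not depend on time. -/
lemma IsClassicalSolution.director_bdry (hT : 0 < T) {t : ℝ} (ht : t ∈ Ioo 0 T)
    {y : Plane} (hy : y ∈ frontier Ω) (k : Fin 2) : d t y k = d 0 y k := by
  have hc : ContinuousWithinAt (fun s => d s y k) (Icc 0 T) 0 :=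
    ((h.reg_director k).continuousOn.comp (f := fun s => (s, y)) (by fun_prop)
      fun s hs => ⟨hs, frontier_subset_closure hy⟩) 0 ⟨le_rfl, hT.le⟩
  have h1 : Tendsto (fun s => d s y k) (𝓝[Ioo 0 T] 0) (𝓝 (d 0 y k)) :=
    hc.mono_left (nhdsWithin_mono _ Ioo_subset_Icc_self)
  have h2 : Tendsto (fun s => d s y k) (𝓝[Ioo 0 T] 0) (𝓝 (d t y k)) := by
    refine tendsto_const_nhds.congr' (eventually_nhdsWithin_of_forall fun s hs => ?_)
    simp only [h.bdry_director t ht y hy, h.bdry_director s hs y hy]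
  have : (𝓝[Ioo 0 T] (0 : ℝ)).NeBot := by
    rw [← mem_closure_iff_nhdsWithin_neBot, closure_Ioo hT.ne]
    exact ⟨le_rfl, hT.le⟩
  exact tendsto_nhds_unique h2 h1

lemma IsClassicalSolution.director_expanded {t : ℝ} (ht : t ∈ Ioo 0 T) {x : Plane} (hx : x ∈ Ω)
    (k : Fin 2) :
    deriv (fun s => d s x k) t = -∑ i, v t x i * pd i (fun y => d t y k) x +
      θ * (∑ i, pd i (pd i fun y => d t y k) x + (∑ i, ∑ l, pd i (fun y => d t y l) x ^ 2) *
        d t x k) := by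
  have := h.director t ht x hx k
  rw [norm_grad_sq, lapl] at this
  linarith

/-- The director has length one: `|d|² - 1` vanishes initially and at the boundary, and the square
of its `L²` norm satisfies a Gronwall inequality. -/
lemma IsClassicalSolution.director_sq (hT : 0 < T) (hΩ : IsOpen Ω)
    (hb : Bornology.IsBounded Ω) (hθ : 0 < θ) (hd₀ : ∀ x ∈ Ω, ‖d₀ x‖ = 1) :
    ∀ t ∈ Icc 0 T, ∀ x ∈ closure Ω, d t x 0 ^ 2 + d t x 1 ^ 2 = 1 := by
  have hd := fun k => (h.reg_director k).spaceReg2 hT hΩ hb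
  have hdt := fun k => ((h.reg_director k).toIsC1Closed).timeReg hT hΩ hb
  have hv := fun k => ((h.reg_velocity k).spaceReg2 hT hΩ hb).reg1
  have hcont : ∀ t ∈ Icc 0 T, ContinuousOn (fun x => d t x 0 ^ 2 + d t x 1 ^ 2) (closure Ω) :=
    fun t ht => (((hd 0).reg1.continuousOn_slice ht).pow 2).add
      (((hd 1).reg1.continuousOn_slice ht).pow 2)
  have hclos : ∀ t ∈ Icc 0 T, (∀ x ∈ Ω, d t x 0 ^ 2 + d t x 1 ^ 2 = 1) →
      ∀ x ∈ closure Ω, d t x 0 ^ 2 + d t x 1 ^ 2 = 1 := by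
    intro t ht hx
    exact EqOn.of_subset_closure (s := Ω) (g := fun _ => 1) hx (hcont t ht) continuousOn_const
      subset_closure subset_rfl
  have h0I : (0 : ℝ) ∈ Icc 0 T := ⟨le_rfl, hT.le⟩
  have hinit : ∀ x ∈ closure Ω, d 0 x 0 ^ 2 + d 0 x 1 ^ 2 = 1 := by
    refine hclos 0 h0I fun x hx => ?_
    have := hd₀ x hx
    rw [← h.init_director x hx] at this
    have h2 := EuclideanSpace.norm_sq_eq (d 0 x)
    rw [this, Fin.sum_univ_two] at h2
    simpa using h2.symm
  let w : ℝ → Plane → ℝ := fun t x => d t x 0 * d t x 0 + d t x 1 * d t x 1 - 1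
  have hwreg : ∀ t ∈ Icc 0 T, Reg1 Ω (w t) := fun t ht =>
    (((((hd 0).reg1.reg1_slice hb ht).mul ((hd 0).reg1.reg1_slice hb ht) hΩ).add
      (((hd 1).reg1.reg1_slice hb ht).mul ((hd 1).reg1.reg1_slice hb ht) hΩ) hΩ).sub
      (reg1_const 1) hΩ)
  obtain ⟨K₀, hK₀n, hK₀⟩ := (hd 0).reg1.bdd hb
  obtain ⟨K₁, hK₁n, hK₁⟩ := (hd 1).reg1.bdd hb
  have hwK : ∀ t ∈ Icc 0 T, ∀ x ∈ Ω, |w t x| ≤ K₀ * K₀ + K₁ * K₁ + 1 := by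
    intro t ht x hx
    have e0 := hK₀ t ht x (subset_closure hx)
    have e1 := hK₁ t ht x (subset_closure hx)
    refine (abs_sub _ _).trans (add_le_add ((abs_add_le _ _).trans (add_le_add ?_ ?_)) (by simp))
      <;> rw [abs_mul] <;> gcongr
  have hwc : ContinuousOn (fun p : ℝ × Plane => w p.1 p.2) (Icc 0 T ×ˢ Ω) :=
    (((hd 0).reg1.continuousOn_prod.mul (hd 0).reg1.continuousOn_prod).add
      ((hd 1).reg1.continuousOn_prod.mul (hd 1).reg1.continuousOn_prod)).sub continuousOn_const
  choose R hR using fun k => (hdt k).bdd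
  choose L hL0 hL using fun k => (hv k).bdd_pd hb
  choose G hG0 hG using fun k => (hd k).reg1.bdd_pd hb
  have hwt : ∀ t ∈ Ioo 0 T, ∀ x ∈ Ω, HasDerivAt (fun s => w s x)
      (2 * (d t x 0 * deriv (fun s => d s x 0) t + d t x 1 * deriv (fun s => d s x 1) t)) t := by
    intro t ht x hx
    have e0 := (hdt 0).hasDerivAt t ht x hx
    have e1 := (hdt 1).hasDerivAt t ht x hx
    exact (((e0.mul e0).add (e1.mul e1)).sub_const 1).congr_deriv (by ring)
  let e' : ℝ → Plane → ℝ := fun t x => 2 * w t x *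
    (2 * (d t x 0 * deriv (fun s => d s x 0) t + d t x 1 * deriv (fun s => d s x 1) t))
  have he'c : ∀ t ∈ Ioo 0 T, ContinuousOn (e' t) Ω := by
    intro t ht
    have h1 : ∀ k, ContinuousOn (fun x => deriv (fun s => d s x k) t) Ω := fun k =>
      (hdt k).continuousOn.comp (f := fun x => (t, x)) (by fun_prop) fun x hx => ⟨ht, hx⟩
    have h2 := fun k => ((hd k).reg1.reg1_slice hb (Ioo_subset_Icc_self ht)).continuousOn
    exact (continuousOn_const.mul (hwreg t (Ioo_subset_Icc_self ht)).continuousOn).mul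
      (continuousOn_const.mul (((h2 0).mul (h1 0)).add ((h2 1).mul (h1 1))))
  have he'K : ∀ t ∈ Ioo 0 T, ∀ x ∈ Ω, |e' t x| ≤
      2 * (K₀ * K₀ + K₁ * K₁ + 1) * (2 * (K₀ * R 0 + K₁ * R 1)) := by
    intro t ht x hx
    have hI := Ioo_subset_Icc_self ht
    have hR0 : 0 ≤ R 0 := (abs_nonneg _).trans (hR 0 t ht x hx)
    have hR1 : 0 ≤ R 1 := (abs_nonneg _).trans (hR 1 t ht x hx)
    simp only [e']
    rw [abs_mul, abs_mul, abs_two, abs_mul, abs_two]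
    have := hwK t hI x hx
    gcongr
    refine (abs_add_le _ _).trans (add_le_add ?_ ?_) <;> rw [abs_mul] <;> gcongr
    · exact hK₀ t hI x (subset_closure hx)
    · exact hR 0 t ht x hx
    · exact hK₁ t hI x (subset_closure hx)
    · exact hR 1 t ht x hx
  have hderiv : ∀ t ∈ Ioo 0 T, HasDerivAt (fun s => ∫ x in Ω, w s x ^ 2)
      (∫ x in Ω, e' t x) t := by
    intro t ht
    refine hasDerivAt_setIntegral hΩ hb ht (e := fun t x => w t x ^ 2) (e' := e')
      (fun s hs => ((hwreg s (Ioo_subset_Icc_self hs)).pow hΩ 2).integrableOn hΩ hb)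
      (he'c t ht) (fun s hs x hx => ?_) ⟨_, he'K⟩
    exact ((hwt s hs x hx).pow 2).congr_deriv (by simp [e'])
  have hsqK : ∃ K, ∀ t ∈ Icc 0 T, ∀ x ∈ Ω, |w t x ^ 2| ≤ K := ⟨(K₀ * K₀ + K₁ * K₁ + 1) ^ 2,
    fun t ht x hx => by
      rw [abs_pow]; exact pow_le_pow_left₀ (abs_nonneg _) (hwK t ht x hx) 2⟩
  have hle := nonpos_of_deriv_le (y := fun s => ∫ x in Ω, w s x ^ 2)
    (K := L 0 + L 1 + 4 * θ * (2 * G 0 ^ 2 + 2 * G 1 ^ 2))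
    (continuousOn_setIntegral hΩ hb (hwc.pow 2) hsqK) hderiv (fun t ht => ?_) ?_
  · intro t ht
    refine hclos t ht fun x hx => ?_
    have := eq_zero_of_setIntegral_nonpos hΩ hb ((hwreg t ht).pow hΩ 2).continuousOn
      ((hwreg t ht).pow hΩ 2).bdd (fun x _ => sq_nonneg _) (hle t ht) x hx
    have := pow_eq_zero_iff (two_ne_zero) |>.1 this
    simp only [w] at this
    linarith
  · have hI := Ioo_subset_Icc_self ht
    have hd2 := fun k => (hd k).reg2_slice hΩ hb hI
    have hv1 := fun k => (hv k).reg1_slice hb hI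
    have hw := hwreg t hI
    have hwv : Vanish Ω (w t) := by
      refine vanish_of_continuousOn (f := w t) ?_ fun y hy => ?_
      · have h2 := fun k => (hd k).reg1.continuousOn_slice hI
        exact (((h2 0).mul (h2 0)).add ((h2 1).mul (h2 1))).sub continuousOn_const
      · simp only [w]
        rw [h.director_bdry hT ht hy, h.director_bdry hT ht hy]
        linarith [hinit y (frontier_subset_closure hy)]
    have hpdw : ∀ i, ∀ x ∈ Ω, pd i (w t) x = 2 * (d t x 0 * pd i (fun y => d t y 0) x +
        d t x 1 * pd i (fun y => d t y 1) x) := by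
      intro i x hx
      have e0 := (hd2 0).reg1.differentiableAt hΩ hx
      have e1 := (hd2 1).reg1.differentiableAt hΩ hx
      simp only [w]
      rw [pd_sub i ((e0.fun_mul e0).fun_add (e1.fun_mul e1)) (differentiableAt_const _), pd_const,
        pd_add i (e0.fun_mul e0) (e1.fun_mul e1), pd_mul i e0 e0, pd_mul i e1 e1]
      ring
    let s : Fin 2 → Plane → ℝ := fun i x => d t x 0 * pd i (fun y => d t y 0) x +
        d t x 1 * pd i (fun y => d t y 1) x
    have hs : ∀ i, Reg1 Ω (s i) := fun i => (((hd2 0).reg1.mul ((hd2 0).pd i) hΩ).add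
      ((hd2 1).reg1.mul ((hd2 1).pd i) hΩ) hΩ)
    let F : Fin 2 → Plane → ℝ := fun i x => w t x * (4 * θ * s i x - v t x i * w t x)
    have hB : ∀ i, Reg1 Ω fun x => 4 * θ * s i x - v t x i * w t x := fun i =>
      ((hs i).const_mul hΩ _).sub ((hv1 i).mul hw hΩ) hΩ
    have hF : ∀ i, Reg1 Ω (F i) := fun i => hw.mul (hB i) hΩ
    have hz := fun i => setIntegral_pd_eq_zero hΩ hb (hF i) (hwv.mul_bdd (hB i).bdd) i
    have hpoint : ∀ x ∈ Ω, e' t x ≤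
        (L 0 + L 1 + 4 * θ * (2 * G 0 ^ 2 + 2 * G 1 ^ 2)) * w t x ^ 2 +
          (pd 0 (F 0) x + pd 1 (F 1) x) := by
      intro x hx
      have e0 := (hd2 0).reg1.differentiableAt hΩ hx
      have e1 := (hd2 1).reg1.differentiableAt hΩ hx
      have g0 := fun i => ((hd2 0).pd i).differentiableAt hΩ hx
      have g1 := fun i => ((hd2 1).pd i).differentiableAt hΩ hx
      have hpds : ∀ i, pd i (s i) x = pd i (fun y => d t y 0) x ^ 2 +
          pd i (fun y => d t y 1) x ^ 2 + d t x 0 * pd i (pd i fun y => d t y 0) x +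
          d t x 1 * pd i (pd i fun y => d t y 1) x := by
        intro i
        simp only [s]
        rw [pd_add i (e0.fun_mul (g0 i)) (e1.fun_mul (g1 i)), pd_mul i e0 (g0 i),
          pd_mul i e1 (g1 i)]
        ring
      have hpdF : ∀ i, pd i (F i) x = 2 * s i x * (4 * θ * s i x - v t x i * w t x) +
          w t x * (4 * θ * pd i (s i) x - (pd i (fun y => v t y i) x * w t x +
            v t x i * (2 * s i x))) := by
        intro i
        have ew := hw.differentiableAt hΩ hx
        have es := (hs i).differentiableAt hΩ hx
        have ev := (hv1 i).differentiableAt hΩ hx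
        simp only [F]
        rw [pd_mul i ew ((hB i).differentiableAt hΩ hx), pd_sub i (es.const_mul _) (ev.fun_mul ew),
          pd_const_mul i _ es, pd_mul i ev ew, hpdw i x hx]
      have a0 := le_of_abs_le (hL 0 0 t hI x hx)
      have a1 := le_of_abs_le (hL 1 1 t hI x hx)
      have hg : ∀ i k, pd i (fun y => d t y k) x ^ 2 ≤ G k ^ 2 := fun i k =>
        sq_le_sq' (neg_le_of_abs_le (hG k i t hI x hx)) (le_of_abs_le (hG k i t hI x hx))
      have h3 : 0 ≤ (L 0 - pd 0 (fun y => v t y 0) x) * w t x ^ 2 :=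
        mul_nonneg (by linarith) (sq_nonneg _)
      have h4 : 0 ≤ (L 1 - pd 1 (fun y => v t y 1) x) * w t x ^ 2 :=
        mul_nonneg (by linarith) (sq_nonneg _)
      have h5 : 0 ≤ θ * (s 0 x ^ 2 + s 1 x ^ 2) := by positivity
      have h6 : 0 ≤ θ * ((2 * G 0 ^ 2 + 2 * G 1 ^ 2 - (pd 0 (fun y => d t y 0) x ^ 2 +
          pd 0 (fun y => d t y 1) x ^ 2 + (pd 1 (fun y => d t y 0) x ^ 2 +
          pd 1 (fun y => d t y 1) x ^ 2))) * w t x ^ 2) :=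
        mul_nonneg hθ.le (mul_nonneg (by linarith [hg 0 0, hg 0 1, hg 1 0, hg 1 1]) (sq_nonneg _))
      have hd0 := h.director_expanded ht hx 0
      have hd1 := h.director_expanded ht hx 1
      simp only [Fin.sum_univ_two] at hd0 hd1
      rw [hpdF, hpdF, hpds, hpds]
      simp only [e']
      rw [hd0, hd1]
      simp only [s] at h5 ⊢
      simp only [w] at h3 h4 h6 ⊢
      linear_combination h3 + h4 + 8 * h5 + 4 * h6
    have hi1 := ((hw.pow hΩ 2).const_mul hΩ
      (L 0 + L 1 + 4 * θ * (2 * G 0 ^ 2 + 2 * G 1 ^ 2))).integrableOn hΩ hb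
    have hi2 := ((hF 0).integrableOn_pd hΩ hb 0).add ((hF 1).integrableOn_pd hΩ hb 1)
    have hi3 : IntegrableOn (e' t) Ω := integrableOn_of_bdd hΩ hb (he'c t ht) ⟨_, he'K t ht⟩
    have := setIntegral_mono_on hi3 (hi1.add hi2) hΩ.measurableSet hpoint
    refine this.trans (le_of_eq ?_)
    have e1 := integral_add hi1 hi2
    have e2 := integral_add ((hF 0).integrableOn_pd hΩ hb 0) ((hF 1).integrableOn_pd hΩ hb 1)
    simp only [Pi.add_apply] at e1 e2 ⊢
    rw [e1, e2, hz, hz, integral_const_mul]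
    ring
  · refine le_of_eq (setIntegral_eq_zero_of_forall_eq_zero fun x hx => ?_)
    have := hinit x (subset_closure hx)
    have : w 0 x = 0 := by simp only [w]; linarith
    simp [this]

end Solution

/-! ### The energy identity -/

lemma pd_sq {f : Plane → ℝ} {x : Plane} (i : Fin 2) (hf : DifferentiableAt ℝ f x) :
    pd i (fun y => f y ^ 2) x = 2 * f x * pd i f x := by
  simp only [pow_two]
  rw [pd_mul i hf hf]; ring

/-- The divergence of the stress `∇f ⊗ ∇f - ½ |∇f|² I` is `Δf ∇f`. -/
lemma sum_pd_stress {Ω : Set Plane} (hΩ : IsOpen Ω) {f : Plane → ℝ} (hf : Reg2 Ω f) {x : Plane}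
    (hx : x ∈ Ω) (k : Fin 2) :
    ∑ i, pd i (fun y => pd i f y * pd k f y -
      1 / 2 * (pd 0 f y ^ 2 + pd 1 f y ^ 2) * (if i = k then 1 else 0)) x =
      (∑ i, pd i (pd i f) x) * pd k f x := by
  have g := fun i => (hf.pd i).differentiableAt hΩ hx
  have hterm : ∀ i, pd i (fun y => pd i f y * pd k f y -
      1 / 2 * (pd 0 f y ^ 2 + pd 1 f y ^ 2) * (if i = k then 1 else 0)) x =
      pd i (pd i f) x * pd k f x + pd i f x * pd i (pd k f) x -
        (if i = k then 1 else 0) * (pd 0 f x * pd i (pd 0 f) x + pd 1 f x * pd i (pd 1 f) x) := by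
    intro i
    have e : (fun y => pd i f y * pd k f y -
        1 / 2 * (pd 0 f y ^ 2 + pd 1 f y ^ 2) * (if i = k then 1 else 0)) =
        fun y => pd i f y * pd k f y -
          (1 / 2 * (if i = k then 1 else 0)) * (pd 0 f y ^ 2 + pd 1 f y ^ 2) := by
      funext y; ring
    rw [e, pd_sub i ((g i).fun_mul (g k))
        ((((g 0).fun_pow 2).fun_add ((g 1).fun_pow 2)).const_mul _),
      pd_mul i (g i) (g k), pd_const_mul i _ (((g 0).fun_pow 2).fun_add ((g 1).fun_pow 2)),
      pd_add i ((g 0).fun_pow 2) ((g 1).fun_pow 2), pd_sq i (g 0), pd_sq i (g 1)]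
    ring
  simp only [hterm, Fin.sum_univ_two]
  have hc := pd_comm hΩ hf.contDiffOn_two 0 1 hx
  fin_cases k
  · simp; rw [hc]; ring
  · simp; rw [hc]; ring

lemma hasDerivAt_potential {A γ r : ℝ} (hγ : 1 < γ) (s : ℝ) :
    HasDerivAt (potential A γ r) (A / (γ - 1) * (γ * s ^ (γ - 1) - γ * r ^ (γ - 1))) s := by
  have h1 := Real.hasDerivAt_rpow_const (x := s) (p := γ) (Or.inr hγ.le)
  have h2 := (((h1.sub (((hasDerivAt_id s).const_mul γ).mul_const (r ^ (γ - 1)))).add_const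
    ((γ - 1) * r ^ γ)).const_mul (A / (γ - 1)))
  exact h2.congr_deriv (by simp)

lemma contDiff_rpow {γ : ℝ} (hγ : 1 < γ) : ContDiff ℝ 1 fun s : ℝ => s ^ γ := by
  have := Real.contDiff_rpow_const_of_le (p := γ) (n := 1) (by simpa using hγ.le)
  simpa using this

lemma contDiff_potential {A γ r : ℝ} (hγ : 1 < γ) : ContDiff ℝ 1 (potential A γ r) := by
  have h := contDiff_rpow hγ
  unfold potential
  fun_prop

section Dirichlet

variable {T : ℝ} {Ω : Set Plane}

/-- The derivative of the Dirichlet energy, for boundary values independent of time. No mixed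
derivatives are needed: the difference of two energies equals
`-∫ (f s - f t) Δ (f s + f t)`. -/
lemma hasDerivAt_dirichlet (hΩ : IsOpen Ω) (hb : Bornology.IsBounded Ω) {f : ℝ → Plane → ℝ}
    (hf : SpaceReg2 T Ω f) (hft : TimeReg T Ω f)
    (hbd : ∀ s ∈ Ioo 0 T, ∀ t ∈ Ioo 0 T, ∀ y ∈ frontier Ω, f s y = f t y) {t : ℝ}
    (ht : t ∈ Ioo 0 T) :
    HasDerivAt (fun s => ∫ x in Ω, ∑ i, pd i (f s) x ^ 2)
      (∫ x in Ω, -2 * (deriv (fun s => f s x) t * lapl (f t) x)) t := by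
  have hI := Ioo_subset_Icc_self ht
  have h2 := fun {s} (hs : s ∈ Icc 0 T) => hf.reg2_slice hΩ hb hs
  have hint : ∀ s ∈ Icc 0 T, IntegrableOn (fun x => ∑ i, pd i (f s) x ^ 2) Ω := fun s hs =>
    (Reg1.sum _ hΩ fun i _ => ((h2 hs).pd i).pow hΩ 2).integrableOn hΩ hb
  have hlap : ∀ s ∈ Icc 0 T, ContinuousOn (lapl (f s)) Ω := fun s hs =>
    continuousOn_finsetSum _ fun i _ => ((h2 hs).pd i).continuousOn_pd hΩ i
  obtain ⟨K, hK0, hK⟩ := hf.bdd_pd_pd hΩ hb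
  have hlapK : ∀ s ∈ Icc 0 T, ∀ x ∈ Ω, |lapl (f s) x| ≤ 2 * K := by
    intro s hs x hx
    rw [lapl, Fin.sum_univ_two]
    exact (abs_add_le _ _).trans (by linarith [hK 0 0 s hs x hx, hK 1 1 s hs x hx])
  obtain ⟨R, hR⟩ := hft.bdd
  have hdiff : ∀ s ∈ Ioo 0 T, ∫ x in Ω, ∑ i, pd i (f s) x ^ 2 =
      (∫ x in Ω, ∑ i, pd i (f t) x ^ 2) -
        ∫ x in Ω, (f s x - f t x) * (lapl (f s) x + lapl (f t) x) := by
    intro s hs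
    have hsI := Ioo_subset_Icc_self hs
    have hg : Reg1 Ω fun x => f s x - f t x := (h2 hsI).reg1.sub (h2 hI).reg1 hΩ
    have hgv : Vanish Ω fun x => f s x - f t x :=
      vanish_of_continuousOn ((hf.reg1.continuousOn_slice hsI).sub (hf.reg1.continuousOn_slice hI))
        fun y hy => by rw [hbd s hs t ht y hy, sub_self]
    have hk : ∀ i, Reg1 Ω fun x => pd i (f s) x + pd i (f t) x := fun i =>
      ((h2 hsI).pd i).add ((h2 hI).pd i) hΩ
    have hF := fun i => hg.mul (hk i) hΩ
    have hz := fun i => setIntegral_pd_eq_zero hΩ hb (hF i) (hgv.mul_bdd (hk i).bdd) i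
    have hiP : IntegrableOn (fun x => (f s x - f t x) * (lapl (f s) x + lapl (f t) x)) Ω := by
      obtain ⟨M, hM⟩ := hg.bdd
      refine integrableOn_of_bdd hΩ hb (hg.continuousOn.mul ((hlap s hsI).add (hlap t hI)))
        ⟨M * (2 * K + 2 * K), fun x hx => ?_⟩
      rw [norm_mul]
      exact mul_le_mul (hM x hx) ((norm_add_le _ _).trans
        (add_le_add (hlapK s hsI x hx) (hlapK t hI x hx))) (norm_nonneg _)
        ((abs_nonneg _).trans (hM x hx))
    have e0 := integral_add ((hF 0).integrableOn_pd hΩ hb 0) ((hF 1).integrableOn_pd hΩ hb 1)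
    rw [hz, hz] at e0
    rw [← integral_sub (hint t hI) hiP]
    have e1 : ∫ x in Ω, ((∑ i, pd i (f s) x ^ 2) -
        ((∑ i, pd i (f t) x ^ 2) - (f s x - f t x) * (lapl (f s) x + lapl (f t) x))) = 0 := by
      rw [← add_zero (0 : ℝ), ← e0]
      refine setIntegral_congr_fun hΩ.measurableSet fun x hx => ?_
      have a := (h2 hsI).reg1.differentiableAt hΩ hx
      have b := (h2 hI).reg1.differentiableAt hΩ hx
      have c := fun i => ((h2 hsI).pd i).differentiableAt hΩ hx
      have e := fun i => ((h2 hI).pd i).differentiableAt hΩ hx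
      have hpd : ∀ i, pd i (fun x => (f s x - f t x) * (pd i (f s) x + pd i (f t) x)) x =
          (pd i (f s) x - pd i (f t) x) * (pd i (f s) x + pd i (f t) x) +
            (f s x - f t x) * (pd i (pd i (f s)) x + pd i (pd i (f t)) x) := fun i => by
        rw [pd_mul i (a.fun_sub b) ((c i).fun_add (e i)), pd_sub i a b, pd_add i (c i) (e i)]
      simp only [hpd, Fin.sum_univ_two, lapl]
      ring
    have e2 := integral_sub (hint s hsI) ((hint t hI).sub hiP)
    simp only [Pi.sub_apply] at e2
    linarith
  rw [hasDerivAt_iff_tendsto_slope]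
  have hnh : ∀ᶠ s in 𝓝[≠] t, s ∈ Ioo 0 T ∧ s ≠ t :=
    ((eventually_nhdsWithin_of_eventually_nhds (isOpen_Ioo.mem_nhds ht))).and
      (eventually_nhdsWithin_of_forall fun s hs => hs)
  have hslope : ∀ᶠ s in 𝓝[≠] t, ∫ x in Ω,
      -((s - t)⁻¹ * (f s x - f t x) * (lapl (f s) x + lapl (f t) x)) =
      slope (fun s => ∫ x in Ω, ∑ i, pd i (f s) x ^ 2) t s := by
    filter_upwards [hnh] with s hs
    rw [slope_def_module, hdiff s hs.1, smul_eq_mul, sub_sub_cancel_left, integral_neg,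
      mul_neg, ← integral_const_mul]
    simp only [mul_assoc]
  refine Tendsto.congr' hslope ?_
  refine tendsto_integral_filter_of_dominated_convergence (fun _ => R * (2 * K + 2 * K)) ?_ ?_
    (integrableOn_const hb.measure_lt_top.ne) ?_
  · filter_upwards [hnh] with s hs
    have hsI := Ioo_subset_Icc_self hs.1
    exact (((continuousOn_const.mul ((h2 hsI).reg1.continuousOn.sub (h2 hI).reg1.continuousOn)).mul
      ((hlap s hsI).add (hlap t hI))).neg).aestronglyMeasurable hΩ.measurableSet
  · filter_upwards [hnh] with s hs
    have hsI := Ioo_subset_Icc_self hs.1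
    filter_upwards [ae_restrict_mem hΩ.measurableSet] with x hx
    rw [norm_neg, norm_mul, norm_mul]
    have hlip := (convex_Ioo 0 T).norm_image_sub_le_of_norm_hasDerivWithin_le
      (fun r hr => (hft.hasDerivAt r hr x hx).hasDerivWithinAt) (fun r hr => hR r hr x hx) ht hs.1
    have hst : 0 < ‖s - t‖ := norm_pos_iff.2 (sub_ne_zero.2 hs.2)
    have h3 : ‖(s - t)⁻¹‖ * ‖f s x - f t x‖ ≤ R := by
      rw [norm_inv, inv_mul_le_iff₀ hst, mul_comm]; exact hlip
    exact mul_le_mul h3 ((norm_add_le _ _).trans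
        (add_le_add (hlapK s hsI x hx) (hlapK t hI x hx))) (norm_nonneg _)
        ((by positivity : (0 : ℝ) ≤ _).trans h3)
  · filter_upwards [ae_restrict_mem hΩ.measurableSet] with x hx
    have h4 : Tendsto (fun s => (s - t)⁻¹ * (f s x - f t x)) (𝓝[≠] t)
        (𝓝 (deriv (fun s => f s x) t)) := by
      have := hasDerivAt_iff_tendsto_slope.1 (hft.hasDerivAt t ht x hx)
      exact this.congr fun s => by rw [slope_def_module, smul_eq_mul]
    have h5 : Tendsto (fun s => lapl (f s) x) (𝓝[≠] t) (𝓝 (lapl (f t) x)) := by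
      have hc : ContinuousOn (fun s => lapl (f s) x) (Icc 0 T) :=
        continuousOn_finsetSum _ fun i _ => (hf.continuousOn_pd_pd hΩ i i).comp
          (f := fun s => (s, x)) (by fun_prop) fun s hs => ⟨hs, hx⟩
      exact (hc.continuousAt (Icc_mem_nhds ht.1 ht.2)).tendsto.mono_left nhdsWithin_le_nhds
    have h6 := (h4.mul (h5.add_const (lapl (f t) x))).neg
    convert h6 using 2
    ring

end Dirichlet

section Solution

variable {A γ μ lam ν θ T : ℝ} {Ω : Set Plane} {ρ₀ : Plane → ℝ} {m₀ d₀ : Plane → Plane}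
  {ρ : ℝ → Plane → ℝ} {v d : ℝ → Plane → Plane}
  (h : IsClassicalSolution A γ μ lam ν θ T Ω ρ₀ m₀ d₀ ρ v d)

include h

/-- The momentum equation with all products differentiated; the director enters through
`-ν Σₗ Δdₗ ∇dₗ`. -/
lemma IsClassicalSolution.momentum_expanded (hγ : 1 < γ) (hT : 0 < T) (hΩ : IsOpen Ω)
    (hb : Bornology.IsBounded Ω) {t : ℝ} (ht : t ∈ Ioo 0 T) {x : Plane} (hx : x ∈ Ω) (k : Fin 2) :
    deriv (fun s => ρ s x) t * v t x k + ρ t x * deriv (fun s => v s x k) t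
        + ∑ i, ((pd i (ρ t) x * v t x i + ρ t x * pd i (fun y => v t y i) x) * v t x k
          + ρ t x * v t x i * pd i (fun y => v t y k) x)
        + A * (γ * ρ t x ^ (γ - 1) * pd k (ρ t) x)
      = μ * lapl (fun y => v t y k) x + (μ + lam) * ∑ i, pd k (pd i fun y => v t y i) x
        - ν * ∑ l, lapl (fun y => d t y l) x * pd k (fun y => d t y l) x := by
  have hI := Ioo_subset_Icc_self ht
  have eρ := (h.reg_density.spaceReg1 hT hΩ hb |>.reg1_slice hb hI).differentiableAt hΩ hx
  have hv2 := fun i => (h.reg_velocity i).spaceReg2 hT hΩ hb |>.reg2_slice hΩ hb hI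
  have hd2 := fun i => (h.reg_director i).spaceReg2 hT hΩ hb |>.reg2_slice hΩ hb hI
  have ev := fun i => (hv2 i).reg1.differentiableAt hΩ hx
  have hm := h.momentum t ht x hx k
  have h1 : deriv (fun s => ρ s x * v s x k) t =
      deriv (fun s => ρ s x) t * v t x k + ρ t x * deriv (fun s => v s x k) t :=
    (((h.reg_density.timeReg hT hΩ hb).hasDerivAt t ht x hx).mul
      (((h.reg_velocity k).toIsC1Closed.timeReg hT hΩ hb).hasDerivAt t ht x hx)).deriv
  have h2 : ∀ i, pd i (fun y => ρ t y * v t y i * v t y k) x =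
      (pd i (ρ t) x * v t x i + ρ t x * pd i (fun y => v t y i) x) * v t x k
          + ρ t x * v t x i * pd i (fun y => v t y k) x := fun i => by
    rw [pd_mul i (eρ.fun_mul (ev i)) (ev k), pd_mul i eρ (ev i)]
  have h3 : pd k (fun y => A * ρ t y ^ γ) x = A * (γ * ρ t x ^ (γ - 1) * pd k (ρ t) x) := by
    have hr := Real.hasDerivAt_rpow_const (x := ρ t x) (p := γ) (Or.inr hγ.le)
    rw [pd_comp (φ := fun s => A * s ^ γ) k (hr.const_mul A) eρ]; ring
  have h4 : pd k (dvg (v t)) x = ∑ i, pd k (pd i fun y => v t y i) x :=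
    pd_sum _ k fun i _ => ((hv2 i).pd i).differentiableAt hΩ hx
  have h5 : ∑ i, pd i (fun y =>
        (∑ l, pd i (fun z => d t z l) y * pd k (fun z => d t z l) y)
          - 1 / 2 * ‖grad (d t) y‖ ^ 2 * (if i = k then 1 else 0)) x =
      ∑ l, lapl (fun y => d t y l) x * pd k (fun y => d t y l) x := by
    have e : ∀ l, lapl (fun y => d t y l) x * pd k (fun y => d t y l) x = _ :=
      fun l => (sum_pd_stress hΩ (hd2 l) hx k).symm
    simp only [e]
    rw [Finset.sum_comm]
    refine Finset.sum_congr rfl fun i _ => ?_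
    have g := fun l i => ((hd2 l).pd i).differentiableAt hΩ hx
    rw [← pd_sum _ i fun l _ => ?_]
    · refine congrFun (congrArg (pd i) ?_) x
      funext y
      rw [norm_grad_sq]
      simp only [Fin.sum_univ_two]
      ring
    · exact ((g l i).fun_mul (g l k)).fun_sub
        (((((g l 0).fun_pow 2).fun_add ((g l 1).fun_pow 2)).const_mul _).mul_const _)
  simp only [h1, h2, h3, h4, h5] at hm
  exact hm

/-- The consequences of `|d| = 1` for the derivatives of the director. -/
lemma IsClassicalSolution.director_orthogonal (hT : 0 < T) (hΩ : IsOpen Ω)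
    (hb : Bornology.IsBounded Ω) (hθ : 0 < θ) (hd₀ : ∀ x ∈ Ω, ‖d₀ x‖ = 1) {t : ℝ}
    (ht : t ∈ Icc 0 T) {x : Plane} (hx : x ∈ Ω) (i : Fin 2) :
    d t x 0 * pd i (fun y => d t y 0) x + d t x 1 * pd i (fun y => d t y 1) x = 0 ∧
    ∀ j, pd j (fun y => d t y 0) x * pd i (fun y => d t y 0) x +
      pd j (fun y => d t y 1) x * pd i (fun y => d t y 1) x +
      (d t x 0 * pd j (pd i fun y => d t y 0) x +
        d t x 1 * pd j (pd i fun y => d t y 1) x) = 0 := by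
  have hd2 := fun i => (h.reg_director i).spaceReg2 hT hΩ hb |>.reg2_slice hΩ hb ht
  have key : ∀ x ∈ Ω,
      d t x 0 * pd i (fun y => d t y 0) x + d t x 1 * pd i (fun y => d t y 1) x = 0 := by
    intro x hx
    have e := fun k => (hd2 k).reg1.differentiableAt hΩ hx
    have h1 := pd_congr_on hΩ (g := fun _ => 1)
      (fun y hy => h.director_sq hT hΩ hb hθ hd₀ t ht y (subset_closure hy)) i hx
    rw [pd_const, pd_add i ((e 0).fun_pow 2) ((e 1).fun_pow 2), pd_sq i (e 0), pd_sq i (e 1)] at h1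
    linarith
  refine ⟨key x hx, fun j => ?_⟩
  have e := fun k => (hd2 k).reg1.differentiableAt hΩ hx
  have g := fun k => ((hd2 k).pd i).differentiableAt hΩ hx
  have h1 := pd_congr_on hΩ (g := fun _ => 0) key j hx
  rw [pd_const, pd_add j ((e 0).fun_mul (g 0)) ((e 1).fun_mul (g 1)), pd_mul j (e 0) (g 0),
    pd_mul j (e 1) (g 1)] at h1
  linarith

end Solution

/-- The tension field `Δu + |∇u|² u` of a director field. -/
noncomputable def tension (u : Plane → Plane) (x : Plane) (k : Fin 2) : ℝ :=
  lapl (fun y => u y k) x + (∑ i, ∑ l, pd i (fun y => u y l) x ^ 2) * u x k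

/-- The density of the energy dissipation. -/
noncomputable def dissip (μ lam ν θ : ℝ) (v d : Plane → Plane) (x : Plane) : ℝ :=
  μ * ∑ i, ∑ k, pd i (fun y => v y k) x ^ 2 + (μ + lam) * (∑ i, pd i (fun y => v y i) x) ^ 2
    + ν * θ * ∑ k, tension d x k ^ 2

/-- The density of the kinetic and potential energy. -/
noncomputable def kinPot (A γ r : ℝ) (ρ : Plane → ℝ) (v : Plane → Plane) (x : Plane) : ℝ :=
  1 / 2 * (ρ x * (v x 0 ^ 2 + v x 1 ^ 2)) + potential A γ r (ρ x)

section Solution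

variable {A γ μ lam ν θ T r : ℝ} {Ω : Set Plane} {ρ₀ : Plane → ℝ} {m₀ d₀ : Plane → Plane}
  {ρ : ℝ → Plane → ℝ} {v d : ℝ → Plane → Plane}
  (h : IsClassicalSolution A γ μ lam ν θ T Ω ρ₀ m₀ d₀ ρ v d)

include h

lemma IsClassicalSolution.reg1_kinPot (hγ : 1 < γ) (hT : 0 < T) (hΩ : IsOpen Ω)
    (hb : Bornology.IsBounded Ω) {t : ℝ} (ht : t ∈ Icc 0 T) :
    Reg1 Ω (kinPot A γ r (ρ t) (v t)) := by
  have hρ := (h.reg_density.spaceReg1 hT hΩ hb).reg1_slice hb ht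
  have hv := fun k => ((h.reg_velocity k).spaceReg2 hT hΩ hb).reg1.reg1_slice hb ht
  exact ((hρ.mul (((hv 0).pow hΩ 2).add ((hv 1).pow hΩ 2) hΩ) hΩ).const_mul hΩ _).add
    (hρ.comp hΩ (contDiff_potential hγ)) hΩ

lemma IsClassicalSolution.energy_eq (hγ : 1 < γ) (hT : 0 < T) (hΩ : IsOpen Ω)
    (hb : Bornology.IsBounded Ω) (hρ₀ : ∀ x ∈ Ω, 0 ≤ ρ₀ x) {t : ℝ} (ht : t ∈ Icc 0 T) :
    energy A γ ν r Ω (ρ t) (fun x => ρ t x • v t x) (d t) =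
      (∫ x in Ω, kinPot A γ r (ρ t) (v t) x) +
        ν / 2 * ∑ k, ∫ x in Ω, ∑ i, pd i (fun y => d t y k) x ^ 2 := by
  have hd2 := fun i => (h.reg_director i).spaceReg2 hT hΩ hb |>.reg2_slice hΩ hb ht
  have hi : ∀ k, IntegrableOn (fun x => ∑ i, pd i (fun y => d t y k) x ^ 2) Ω := fun k =>
    (Reg1.sum _ hΩ fun i _ => ((hd2 k).pd i).pow hΩ 2).integrableOn hΩ hb
  have hk := (h.reg1_kinPot (r := r) hγ hT hΩ hb ht).integrableOn hΩ hb
  rw [← integral_finsetSum _ fun k _ => hi k, ← integral_const_mul, ← integral_add hk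
    ((integrable_finsetSum _ fun k _ => hi k).const_mul _), energy]
  refine setIntegral_congr_fun hΩ.measurableSet fun x hx => ?_
  have h0 := h.density_nonneg hT hΩ hb hρ₀ t ht x hx
  have h1 : indicator {y | 0 < ρ t y} (fun y => ‖ρ t y • v t y‖ ^ 2 / ρ t y) x =
      ρ t x * (v t x 0 ^ 2 + v t x 1 ^ 2) := by
    rcases h0.eq_or_lt with h0 | h0
    · rw [indicator_of_notMem (by simp [← h0]), ← h0, zero_mul]
    · rw [indicator_of_mem (by simpa using h0), norm_smul, mul_pow, EuclideanSpace.norm_sq_eq,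
        Fin.sum_univ_two, Real.norm_eq_abs, sq_abs]
      simp only [Real.norm_eq_abs, sq_abs]
      field_simp
  simp only [h1, norm_grad_sq, kinPot]
  rw [Finset.sum_comm]

lemma IsClassicalSolution.continuousOn_dissip (hT : 0 < T) (hΩ : IsOpen Ω)
    (hb : Bornology.IsBounded Ω) :
    ContinuousOn (fun p : ℝ × Plane => dissip μ lam ν θ (v p.1) (d p.1) p.2) (Icc 0 T ×ˢ Ω) := by
  have hv := fun k => ((h.reg_velocity k).spaceReg2 hT hΩ hb).reg1
  have hd := fun k => (h.reg_director k).spaceReg2 hT hΩ hb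
  have hg := fun k i => (hv k).continuousOn_pd i
  have hgd := fun k i => (hd k).reg1.continuousOn_pd i
  have hl := fun k i => (hd k).continuousOn_pd_pd hΩ i i
  have h0 := fun k => (hd k).reg1.continuousOn_prod
  unfold dissip tension lapl
  refine ((continuousOn_const.mul (continuousOn_finsetSum _ fun i _ => continuousOn_finsetSum _
    fun k _ => (hg k i).pow 2)).add (continuousOn_const.mul ((continuousOn_finsetSum _
    fun i _ => hg i i).pow 2))).add (continuousOn_const.mul (continuousOn_finsetSum _
    fun k _ => ContinuousOn.pow ?_ 2))
  exact (continuousOn_finsetSum _ fun i _ => hl k i).add ((continuousOn_finsetSum _ fun i _ =>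
    continuousOn_finsetSum _ fun l _ => (hgd l i).pow 2).mul (h0 k))

lemma IsClassicalSolution.exists_dissip_le (hT : 0 < T) (hΩ : IsOpen Ω)
    (hb : Bornology.IsBounded Ω) :
    ∃ K, ∀ t ∈ Icc 0 T, ∀ x ∈ Ω, |dissip μ lam ν θ (v t) (d t) x| ≤ K := by
  have hv := fun k => ((h.reg_velocity k).spaceReg2 hT hΩ hb).reg1
  have hd := fun k => (h.reg_director k).spaceReg2 hT hΩ hb
  choose a ha0 ha using fun k => (hv k).bdd_pd hb
  choose b hb0 hb' using fun k => (hd k).reg1.bdd_pd hb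
  choose c hc0 hc using fun k => (hd k).bdd_pd_pd hΩ hb
  choose e he0 he using fun k => (hd k).reg1.bdd hb
  refine ⟨|μ| * ∑ _i : Fin 2, ∑ k, a k ^ 2 + |μ + lam| * (∑ i, a i) ^ 2 +
    |ν * θ| * ∑ k, (∑ _i : Fin 2, c k + (∑ _i : Fin 2, ∑ l, b l ^ 2) * e k) ^ 2,
    fun t ht x hx => ?_⟩
  have hsq : ∀ {p q : ℝ}, |p| ≤ q → |p ^ 2| ≤ q ^ 2 := fun {p q} hpq => by
    rw [abs_pow]; exact pow_le_pow_left₀ (abs_nonneg _) hpq 2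
  have hsum : ∀ {p q : Fin 2 → ℝ}, (∀ i, |p i| ≤ q i) → |∑ i, p i| ≤ ∑ i, q i := fun hpq =>
    (Finset.abs_sum_le_sum_abs _ _).trans (Finset.sum_le_sum fun i _ => hpq i)
  unfold dissip tension lapl
  refine (abs_add_le _ _).trans (add_le_add ((abs_add_le _ _).trans (add_le_add ?_ ?_)) ?_)
  · rw [abs_mul]
    exact mul_le_mul_of_nonneg_left (hsum fun i => hsum fun k => hsq (ha k i t ht x hx))
      (abs_nonneg _)
  · rw [abs_mul]
    exact mul_le_mul_of_nonneg_left (hsq (hsum fun i => ha i i t ht x hx)) (abs_nonneg _)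
  · rw [abs_mul]
    refine mul_le_mul_of_nonneg_left (hsum fun k => hsq ((abs_add_le _ _).trans (add_le_add
      (hsum fun i => hc k i i t ht x hx) ?_))) (abs_nonneg _)
    rw [abs_mul]
    have h1 : |∑ i, ∑ l, pd i (fun y => d t y l) x ^ 2| ≤ ∑ _i : Fin 2, ∑ l, b l ^ 2 :=
      hsum fun i => hsum fun l => hsq (hb' l i t ht x hx)
    exact mul_le_mul h1 (he k t ht x (subset_closure hx)) (abs_nonneg _) ((abs_nonneg _).trans h1)

/-- The rate of change of the energy density and the dissipation add up to a divergence. The flux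
is a multiple of the velocity and its gradient is bounded, so its divergence integrates to
zero. -/
lemma IsClassicalSolution.setIntegral_energy_rate (hγ : 1 < γ) (hθ : 0 < θ)
    (hT : 0 < T) (hΩ : IsOpen Ω) (hb : Bornology.IsBounded Ω) (hρ₀ : ∀ x ∈ Ω, 0 ≤ ρ₀ x)
    (hd₀ : ∀ x ∈ Ω, ‖d₀ x‖ = 1) {t : ℝ} (ht : t ∈ Ioo 0 T) :
    ∫ x in Ω, (1 / 2 * (deriv (fun s => ρ s x) t * (v t x 0 ^ 2 + v t x 1 ^ 2) +
        ρ t x * (2 * v t x 0 * deriv (fun s => v s x 0) t +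
          2 * v t x 1 * deriv (fun s => v s x 1) t)) +
        A / (γ - 1) * (γ * ρ t x ^ (γ - 1) - γ * r ^ (γ - 1)) * deriv (fun s => ρ s x) t +
      ν / 2 * ∑ k, -2 * (deriv (fun s => d s x k) t * lapl (fun y => d t y k) x) +
      dissip μ lam ν θ (v t) (d t) x) = 0 := by
  have hI := Ioo_subset_Icc_self ht
  have hρ := h.reg_density.spaceReg1 hT hΩ hb |>.reg1_slice hb hI
  have hv2 := fun i => (h.reg_velocity i).spaceReg2 hT hΩ hb |>.reg2_slice hΩ hb hI
  let B : Plane → ℝ := fun x => -(1 / 2 * (ρ t x * (v t x 0 ^ 2 + v t x 1 ^ 2)))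
    - potential A γ r (ρ t x) - A * (ρ t x ^ γ - r ^ γ)
    + (μ + lam) * (pd 0 (fun y => v t y 0) x + pd 1 (fun y => v t y 1) x)
  let F : Fin 2 → Plane → ℝ := fun i x => v t x i * B x +
    (v t x 0 * (μ * pd i (fun y => v t y 0) x) + v t x 1 * (μ * pd i (fun y => v t y 1) x))
  have hB1 : Reg1 Ω fun x => 1 / 2 * (ρ t x * (v t x 0 ^ 2 + v t x 1 ^ 2)) :=
    (hρ.mul (((hv2 0).reg1.pow hΩ 2).add ((hv2 1).reg1.pow hΩ 2) hΩ) hΩ).const_mul hΩ _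
  have hB2 : Reg1 Ω fun x => potential A γ r (ρ t x) := hρ.comp hΩ (contDiff_potential hγ)
  have hB3 : Reg1 Ω fun x => A * (ρ t x ^ γ - r ^ γ) :=
    ((hρ.comp hΩ (contDiff_rpow hγ)).sub (reg1_const _) hΩ).const_mul hΩ _
  have hB4 : Reg1 Ω fun x =>
      (μ + lam) * (pd 0 (fun y => v t y 0) x + pd 1 (fun y => v t y 1) x) :=
    (((hv2 0).pd 0).add ((hv2 1).pd 1) hΩ).const_mul hΩ _
  have hB : Reg1 Ω B := (((hB1.neg hΩ).sub hB2 hΩ).sub hB3 hΩ).add hB4 hΩ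
  have hμ := fun k i => ((hv2 k).pd i).const_mul hΩ μ
  have hF : ∀ i, Reg1 Ω (F i) := fun i => ((hv2 i).reg1.mul hB hΩ).add
    (((hv2 0).reg1.mul (hμ 0 i) hΩ).add ((hv2 1).reg1.mul (hμ 1 i) hΩ) hΩ) hΩ
  have hvan := fun k => h.vanish_velocity hT hΩ hb ht k
  have hFv : ∀ i, Vanish Ω (F i) := fun i => ((hvan i).mul_bdd hB.bdd).add
    (((hvan 0).mul_bdd (hμ 0 i).bdd).add ((hvan 1).mul_bdd (hμ 1 i).bdd))
  have hz := fun i => setIntegral_pd_eq_zero hΩ hb (hF i) (hFv i) i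
  have e0 := integral_add ((hF 0).integrableOn_pd hΩ hb 0) ((hF 1).integrableOn_pd hΩ hb 1)
  rw [hz, hz, add_zero] at e0
  rw [← e0]
  refine setIntegral_congr_fun hΩ.measurableSet fun x hx => ?_
  have eρ := hρ.differentiableAt hΩ hx
  have ev := fun i => (hv2 i).reg1.differentiableAt hΩ hx
  have eg := fun k i => ((hv2 k).pd i).differentiableAt hΩ hx
  have hpdB : ∀ i, pd i B x = -(1 / 2 * (pd i (ρ t) x * (v t x 0 ^ 2 + v t x 1 ^ 2) +
      ρ t x * (2 * v t x 0 * pd i (fun y => v t y 0) x +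
        2 * v t x 1 * pd i (fun y => v t y 1) x))) -
      A / (γ - 1) * (γ * ρ t x ^ (γ - 1) - γ * r ^ (γ - 1)) * pd i (ρ t) x -
      A * (γ * ρ t x ^ (γ - 1)) * pd i (ρ t) x +
      (μ + lam) * (pd i (pd 0 fun y => v t y 0) x + pd i (pd 1 fun y => v t y 1) x) := by
    intro i
    have d1 := hB1.differentiableAt hΩ hx
    have d2 := hB2.differentiableAt hΩ hx
    have d3 := hB3.differentiableAt hΩ hx
    have d4 := hB4.differentiableAt hΩ hx
    have hr := ((Real.hasDerivAt_rpow_const (x := ρ t x) (p := γ) (Or.inr hγ.le)).sub_const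
      (r ^ γ)).const_mul A
    have dv := ((ev 0).fun_pow 2).fun_add ((ev 1).fun_pow 2)
    simp only [B]
    rw [pd_add i ((d1.fun_neg.fun_sub d2).fun_sub d3) d4, pd_sub i (d1.fun_neg.fun_sub d2) d3,
      pd_sub i d1.fun_neg d2, pd_neg, pd_const_mul i _ (eρ.fun_mul dv),
      pd_mul i eρ dv, pd_add i ((ev 0).fun_pow 2) ((ev 1).fun_pow 2), pd_sq i (ev 0),
      pd_sq i (ev 1), pd_comp i (hasDerivAt_potential hγ (ρ t x)) eρ,
      pd_comp (φ := fun s => A * (s ^ γ - r ^ γ)) i hr eρ,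
      pd_const_mul i _ ((eg 0 0).fun_add (eg 1 1)), pd_add i (eg 0 0) (eg 1 1)]
  have hpdF : ∀ i, pd i (F i) x = pd i (fun y => v t y i) x * B x + v t x i * pd i B x +
      (pd i (fun y => v t y 0) x * (μ * pd i (fun y => v t y 0) x) +
        v t x 0 * (μ * pd i (pd i fun y => v t y 0) x) +
        (pd i (fun y => v t y 1) x * (μ * pd i (fun y => v t y 1) x) +
        v t x 1 * (μ * pd i (pd i fun y => v t y 1) x))) := by
    intro i
    have dB := hB.differentiableAt hΩ hx
    have dg := fun k => (hμ k i).differentiableAt hΩ hx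
    simp only [F]
    rw [pd_add i ((ev i).fun_mul dB) (((ev 0).fun_mul (dg 0)).fun_add ((ev 1).fun_mul (dg 1))),
      pd_mul i (ev i) dB, pd_add i ((ev 0).fun_mul (dg 0)) ((ev 1).fun_mul (dg 1)),
      pd_mul i (ev 0) (dg 0), pd_mul i (ev 1) (dg 1), pd_const_mul i _ (eg 0 i),
      pd_const_mul i _ (eg 1 i)]
  have hmass := h.mass_expanded hT hΩ hb ht hx
  have hm0 := h.momentum_expanded hγ hT hΩ hb ht hx 0
  have hm1 := h.momentum_expanded hγ hT hΩ hb ht hx 1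
  have hd0 := h.director_expanded ht hx 0
  have hd1 := h.director_expanded ht hx 1
  have ho := fun i => (h.director_orthogonal hT hΩ hb hθ hd₀ hI hx i).2 i
  have ho0 := ho 0
  have ho1 := ho 1
  have hsq := h.director_sq hT hΩ hb hθ hd₀ t hI x (subset_closure hx)
  have hpow : ρ t x * ρ t x ^ (γ - 1) = ρ t x ^ γ := by
    have h0 := h.density_nonneg hT hΩ hb hρ₀ t hI x hx
    rw [← Real.rpow_one_add' h0 (by linarith)]; congr 1; ring
  have hγ1 : γ - 1 ≠ 0 := by linarith
  have hQ : A / (γ - 1) * (γ - 1) = A := div_mul_cancel₀ _ hγ1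
  simp only [hpdF, hpdB, B, potential, dissip, tension, lapl, Fin.sum_univ_two] at *
  rw [hd0, hd1]
  set a := A / (γ - 1) with ha
  linear_combination v t x 0 * hm0 + v t x 1 * hm1 +
    (-(1 / 2) * (v t x 0 ^ 2 + v t x 1 ^ 2) + a * (γ * ρ t x ^ (γ - 1) - γ * r ^ (γ - 1))) * hmass
    + ν * θ * (pd 0 (fun y => d t y 0) x ^ 2 + pd 0 (fun y => d t y 1) x ^ 2 +
      (pd 1 (fun y => d t y 0) x ^ 2 + pd 1 (fun y => d t y 1) x ^ 2)) * (ho0 + ho1)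
    + ν * θ * (pd 0 (fun y => d t y 0) x ^ 2 + pd 0 (fun y => d t y 1) x ^ 2 +
      (pd 1 (fun y => d t y 0) x ^ 2 + pd 1 (fun y => d t y 1) x ^ 2)) ^ 2 * hsq
    - a * γ * (pd 0 (fun y => v t y 0) x + pd 1 (fun y => v t y 1) x) * hpow
    - (pd 0 (fun y => v t y 0) x + pd 1 (fun y => v t y 1) x) * (ρ t x ^ γ - r ^ γ) * hQ

end Solution

lemma continuousOn_timeDeriv {T : ℝ} {Ω : Set Plane} {f : ℝ → Plane → ℝ} (hf : TimeReg T Ω f)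
    {t : ℝ} (ht : t ∈ Ioo 0 T) : ContinuousOn (fun x => deriv (fun s => f s x) t) Ω :=
  hf.continuousOn.comp (f := fun x => (t, x)) (by fun_prop) fun x hx => ⟨ht, hx⟩

lemma dissip_eq (μ lam ν θ : ℝ) (v d : Plane → Plane) (x : Plane) :
    dissip μ lam ν θ v d x = μ * ‖grad v x‖ ^ 2 + (μ + lam) * (dvg v x) ^ 2
      + ν * θ * ∑ k, tension d x k ^ 2 := by
  rw [dissip, norm_grad_sq, dvg]

lemma potential_nonneg {A γ r s : ℝ} (hA : 0 < A) (hγ : 1 < γ) (hr : 0 ≤ r) (hs : 0 ≤ s) :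
    0 ≤ potential A γ r s := by
  have hγ0 : 0 < γ := by linarith
  have h1 := Real.geom_mean_le_arith_mean2_weighted (w₁ := 1 / γ) (w₂ := (γ - 1) / γ)
    (by positivity) (div_nonneg (by linarith) hγ0.le) (Real.rpow_nonneg hs γ)
    (Real.rpow_nonneg hr γ) (by field_simp; ring)
  rw [← Real.rpow_mul hs, ← Real.rpow_mul hr, mul_one_div_cancel hγ0.ne',
    mul_div_cancel₀ _ hγ0.ne', Real.rpow_one] at h1
  have h2 : γ * s * r ^ (γ - 1) ≤ s ^ γ + (γ - 1) * r ^ γ := by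
    calc γ * s * r ^ (γ - 1) = γ * (s * r ^ (γ - 1)) := by ring
      _ ≤ γ * (1 / γ * s ^ γ + (γ - 1) / γ * r ^ γ) := by gcongr
      _ = _ := by field_simp
  exact mul_nonneg (div_nonneg hA.le (by linarith)) (by linarith)

lemma rpow_le_potential {A γ r s : ℝ} (hA : 0 < A) (hγ : 1 < γ) (hr : 0 ≤ r) (hs : 0 ≤ s) :
    s ^ γ ≤ 2 * (γ - 1) / A * potential A γ r s + (2 * γ) ^ (γ / (γ - 1)) * r ^ γ := by
  have hγ1 : 0 < γ - 1 := by linarith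
  have hγ0 : 0 < γ := by linarith
  have hK : 0 ≤ (2 * γ) ^ (γ / (γ - 1)) * r ^ γ := by positivity
  have hrγ : 0 ≤ r ^ γ := by positivity
  by_cases hcase : γ * s * r ^ (γ - 1) ≤ 1 / 2 * s ^ γ
  · have : 2 * (γ - 1) / A * potential A γ r s =
        2 * (s ^ γ - γ * s * r ^ (γ - 1) + (γ - 1) * r ^ γ) := by
      rw [potential]; field_simp
    rw [this]
    nlinarith [mul_nonneg hγ1.le hrγ]
  · have hQ : 0 ≤ 2 * (γ - 1) / A * potential A γ r s :=
      mul_nonneg (by positivity) (potential_nonneg hA hγ hr hs)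
    have hs0 : 0 < s := by
      refine hs.lt_of_ne fun h0 => hcase ?_
      rw [← h0, Real.zero_rpow hγ0.ne']; simp
    have hsγ : s ^ γ = s * s ^ (γ - 1) := by
      rw [← Real.rpow_one_add' hs (by linarith)]; congr 1; ring
    have h1 : s ^ (γ - 1) ≤ 2 * γ * r ^ (γ - 1) := by
      rw [not_le, hsγ] at hcase
      by_contra! hlt
      nlinarith
    have h2 : (s ^ (γ - 1)) ^ (γ / (γ - 1)) ≤ (2 * γ * r ^ (γ - 1)) ^ (γ / (γ - 1)) := by
      gcongr
    rw [Real.mul_rpow (by positivity) (by positivity), ← Real.rpow_mul hs, ← Real.rpow_mul hr,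
      mul_div_cancel₀ _ hγ1.ne'] at h2
    linarith

section Solution

variable {A γ μ lam ν θ T r : ℝ} {Ω : Set Plane} {ρ₀ : Plane → ℝ} {m₀ d₀ : Plane → Plane}
  {ρ : ℝ → Plane → ℝ} {v d : ℝ → Plane → Plane}
  (h : IsClassicalSolution A γ μ lam ν θ T Ω ρ₀ m₀ d₀ ρ v d)

include h

lemma IsClassicalSolution.hasDerivAt_kinPot (hγ : 1 < γ) (hT : 0 < T) (hΩ : IsOpen Ω)
    (hb : Bornology.IsBounded Ω) {t : ℝ} (ht : t ∈ Ioo 0 T) :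
    IntegrableOn (fun x => 1 / 2 * (deriv (fun s => ρ s x) t * (v t x 0 ^ 2 + v t x 1 ^ 2) +
        ρ t x * (2 * v t x 0 * deriv (fun s => v s x 0) t +
          2 * v t x 1 * deriv (fun s => v s x 1) t)) +
        A / (γ - 1) * (γ * ρ t x ^ (γ - 1) - γ * r ^ (γ - 1)) * deriv (fun s => ρ s x) t) Ω ∧
    HasDerivAt (fun s => ∫ x in Ω, kinPot A γ r (ρ s) (v s) x)
      (∫ x in Ω, (1 / 2 * (deriv (fun s => ρ s x) t * (v t x 0 ^ 2 + v t x 1 ^ 2) +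
        ρ t x * (2 * v t x 0 * deriv (fun s => v s x 0) t +
          2 * v t x 1 * deriv (fun s => v s x 1) t)) +
        A / (γ - 1) * (γ * ρ t x ^ (γ - 1) - γ * r ^ (γ - 1)) * deriv (fun s => ρ s x) t)) t := by
  have hρ := h.reg_density.spaceReg1 hT hΩ hb
  have hρt := h.reg_density.timeReg hT hΩ hb
  have hv := fun k => ((h.reg_velocity k).spaceReg2 hT hΩ hb).reg1
  have hvt := fun k => (h.reg_velocity k).toIsC1Closed.timeReg hT hΩ hb
  have hpow : Continuous fun s : ℝ => A / (γ - 1) * (γ * s ^ (γ - 1) - γ * r ^ (γ - 1)) := by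
    have := Real.continuous_rpow_const (q := γ - 1) (by linarith)
    fun_prop
  obtain ⟨a, ha0, ha⟩ := hρ.bdd hb
  obtain ⟨b, hb'⟩ := hρt.bdd
  choose c hc0 hc using fun k => (hv k).bdd hb
  choose e he using fun k => (hvt k).bdd
  obtain ⟨g, hg⟩ := (isCompact_Icc (a := -a) (b := a)).exists_bound_of_continuousOn
    hpow.continuousOn
  refine integrableOn_and_hasDerivAt_setIntegral hΩ hb ht
    (e := fun s x => kinPot A γ r (ρ s) (v s) x)
    (e' := fun t x => 1 / 2 * (deriv (fun s => ρ s x) t * (v t x 0 ^ 2 + v t x 1 ^ 2) +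
        ρ t x * (2 * v t x 0 * deriv (fun s => v s x 0) t +
          2 * v t x 1 * deriv (fun s => v s x 1) t)) +
        A / (γ - 1) * (γ * ρ t x ^ (γ - 1) - γ * r ^ (γ - 1)) * deriv (fun s => ρ s x) t)
    (fun s hs => (h.reg1_kinPot hγ hT hΩ hb (Ioo_subset_Icc_self hs)).integrableOn hΩ hb) ?_ ?_
    ⟨1 / 2 * (b * (c 0 ^ 2 + c 1 ^ 2) + a * (2 * c 0 * e 0 + 2 * c 1 * e 1)) + g * b, ?_⟩
  · have hI := Ioo_subset_Icc_self ht
    have e1 := continuousOn_timeDeriv hρt ht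
    have e2 := fun k => continuousOn_timeDeriv (hvt k) ht
    have e3 := (hρ.reg1_slice hb hI).continuousOn
    have e4 := fun k => ((hv k).reg1_slice hb hI).continuousOn
    have e5 := hpow.comp_continuousOn e3
    exact (continuousOn_const.mul ((e1.mul (((e4 0).pow 2).add ((e4 1).pow 2))).add (e3.mul
      (((continuousOn_const.mul (e4 0)).mul (e2 0)).add
        ((continuousOn_const.mul (e4 1)).mul (e2 1)))))).add (e5.mul e1)
  · intro s hs x hx
    have e1 := hρt.hasDerivAt s hs x hx
    have e2 := fun k => (hvt k).hasDerivAt s hs x hx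
    have e3 := (hasDerivAt_potential (A := A) (r := r) hγ (ρ s x)).comp s e1
    have e4 := ((e1.mul (((e2 0).pow 2).add ((e2 1).pow 2))).const_mul (1 / 2)).add e3
    exact e4.congr_deriv (by simp)
  · intro s hs x hx
    have hI := Ioo_subset_Icc_self hs
    have hx' := subset_closure hx
    have e1 := hb' s hs x hx
    have e2 := fun k => he k s hs x hx
    have e3 := ha s hI x hx'
    have e4 := fun k => hc k s hI x hx'
    have e5 := hg _ (abs_le.1 e3)
    have b0 := (abs_nonneg _).trans e1
    have h0 := fun k => (abs_nonneg _).trans (e2 k)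
    have hsq : ∀ k, |v s x k ^ 2| ≤ c k ^ 2 := fun k => by
      rw [abs_pow]; exact pow_le_pow_left₀ (abs_nonneg _) (e4 k) 2
    have hm : ∀ k, |2 * v s x k * deriv (fun s => v s x k) s| ≤ 2 * c k * e k := fun k => by
      rw [abs_mul, abs_mul, abs_two]
      exact mul_le_mul (mul_le_mul_of_nonneg_left (e4 k) (by norm_num)) (e2 k) (abs_nonneg _)
        (mul_nonneg (by norm_num) (hc0 k))
    refine (abs_add_le _ _).trans (add_le_add ?_ ?_)
    · rw [abs_mul, abs_of_pos (by norm_num : (0 : ℝ) < 1 / 2)]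
      refine mul_le_mul_of_nonneg_left ((abs_add_le _ _).trans (add_le_add ?_ ?_)) (by norm_num)
      · rw [abs_mul]
        exact mul_le_mul e1 ((abs_add_le _ _).trans (add_le_add (hsq 0) (hsq 1))) (abs_nonneg _) b0
      · rw [abs_mul]
        exact mul_le_mul e3 ((abs_add_le _ _).trans (add_le_add (hm 0) (hm 1))) (abs_nonneg _) ha0
    · rw [abs_mul]
      exact mul_le_mul e5 e1 (abs_nonneg _) ((norm_nonneg _).trans e5)

/-- The energy balance. -/
lemma IsClassicalSolution.energy_balance (hγ : 1 < γ) (hθ : 0 < θ) (hT : 0 < T) (hΩ : IsOpen Ω)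
    (hb : Bornology.IsBounded Ω) (hρ₀ : ∀ x ∈ Ω, 0 ≤ ρ₀ x) (hd₀ : ∀ x ∈ Ω, ‖d₀ x‖ = 1) {t : ℝ}
    (ht : t ∈ Icc 0 T) :
    (∫ x in Ω, kinPot A γ r (ρ t) (v t) x) + ν / 2 * (∫ x in Ω, ‖grad (d t) x‖ ^ 2) +
      ∫ s in Ioo 0 t, ∫ x in Ω, dissip μ lam ν θ (v s) (d s) x =
      energy A γ ν r Ω ρ₀ m₀ d₀ := by
  have hρ := h.reg_density.spaceReg1 hT hΩ hb
  have hv := fun k => ((h.reg_velocity k).spaceReg2 hT hΩ hb).reg1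
  have hd := fun k => (h.reg_director k).spaceReg2 hT hΩ hb
  have hdt := fun k => (h.reg_director k).toIsC1Closed.timeReg hT hΩ hb
  have h0I : (0 : ℝ) ∈ Icc 0 T := ⟨le_rfl, hT.le⟩
  have hiD : ∀ s ∈ Icc 0 T, ∀ k, IntegrableOn (fun x => ∑ i, pd i (fun y => d s y k) x ^ 2) Ω :=
    fun s hs k => (Reg1.sum _ hΩ fun i _ =>
      (((hd k).reg2_slice hΩ hb hs).pd i).pow hΩ 2).integrableOn hΩ hb
  set E : ℝ → ℝ := fun s => (∫ x in Ω, kinPot A γ r (ρ s) (v s) x) +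
    ν / 2 * ∑ k, ∫ x in Ω, ∑ i, pd i (fun y => d s y k) x ^ 2 with hE
  set D : ℝ → ℝ := fun s => ∫ x in Ω, dissip μ lam ν θ (v s) (d s) x with hD
  have hE0 : E 0 = energy A γ ν r Ω ρ₀ m₀ d₀ := by
    simp only [hE]
    rw [← h.energy_eq (r := r) hγ hT hΩ hb hρ₀ h0I, energy, energy]
    refine setIntegral_congr_fun hΩ.measurableSet fun x hx => ?_
    have e1 : ∀ y ∈ Ω, indicator {y | 0 < ρ 0 y} (fun y => ‖ρ 0 y • v 0 y‖ ^ 2 / ρ 0 y) y =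
        indicator {y | 0 < ρ₀ y} (fun y => ‖m₀ y‖ ^ 2 / ρ₀ y) y := by
      intro y hy
      simp only [indicator, mem_ofPred_eq, h.init_density y hy, ← h.init_momentum y hy]
    have e2 : grad (d 0) x = grad d₀ x := by
      ext p
      exact pd_congr_on hΩ (fun y hy => by rw [h.init_director y hy]) p.1 hx
    simp only [e1 x hx, e2, h.init_density x hx]
  have hEc : ContinuousOn E (Icc 0 T) := by
    refine ContinuousOn.add (continuousOn_setIntegral hΩ hb ?_ ?_)
      (continuousOn_const.mul (continuousOn_finsetSum _ fun k _ =>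
        continuousOn_setIntegral hΩ hb ?_ ?_))
    · have e3 := hρ.continuousOn_prod
      have e4 := fun k => (hv k).continuousOn_prod
      exact (continuousOn_const.mul (e3.mul (((e4 0).pow 2).add ((e4 1).pow 2)))).add
        ((contDiff_potential hγ).continuous.comp_continuousOn e3)
    · obtain ⟨a, ha0, ha⟩ := hρ.bdd hb
      choose c hc0 hc using fun k => (hv k).bdd hb
      obtain ⟨g, hg⟩ := (isCompact_Icc (a := -a) (b := a)).exists_bound_of_continuousOn
        (contDiff_potential (A := A) (r := r) hγ).continuous.continuousOn
      refine ⟨1 / 2 * (a * (c 0 ^ 2 + c 1 ^ 2)) + g, fun s hs x hx => ?_⟩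
      have e3 := ha s hs x (subset_closure hx)
      have e4 := fun k => hc k s hs x (subset_closure hx)
      have hsq : ∀ k, |v s x k ^ 2| ≤ c k ^ 2 := fun k => by
        rw [abs_pow]; exact pow_le_pow_left₀ (abs_nonneg _) (e4 k) 2
      refine (abs_add_le _ _).trans (add_le_add ?_ (hg _ (abs_le.1 e3)))
      rw [abs_mul, abs_of_pos (by norm_num : (0 : ℝ) < 1 / 2), abs_mul]
      refine mul_le_mul_of_nonneg_left ?_ (by norm_num)
      exact mul_le_mul e3 ((abs_add_le _ _).trans (add_le_add (hsq 0) (hsq 1))) (abs_nonneg _) ha0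
    · exact continuousOn_finsetSum _ fun i _ => ((hd k).reg1.continuousOn_pd i).pow 2
    · obtain ⟨a, ha0, ha⟩ := (hd k).reg1.bdd_pd hb
      refine ⟨∑ _i : Fin 2, a ^ 2, fun s hs x hx => (Finset.abs_sum_le_sum_abs _ _).trans
        (Finset.sum_le_sum fun i _ => ?_)⟩
      rw [abs_pow]; exact pow_le_pow_left₀ (abs_nonneg _) (ha i s hs x hx) 2
  have hDc : ContinuousOn D (Icc 0 T) :=
    continuousOn_setIntegral hΩ hb (h.continuousOn_dissip hT hΩ hb)
      (h.exists_dissip_le hT hΩ hb)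
  have hderiv : ∀ s ∈ Ioo 0 T, HasDerivAt E (-D s) s := by
    intro s hs
    have hI := Ioo_subset_Icc_self hs
    obtain ⟨hi1, h1⟩ := h.hasDerivAt_kinPot (r := r) hγ hT hΩ hb hs
    have h2 := fun k => hasDerivAt_dirichlet hΩ hb (hd k) (hdt k)
      (fun s hs t ht y hy => by rw [h.director_bdry hT hs hy, h.director_bdry hT ht hy]) hs
    have h3 := h1.add ((HasDerivAt.fun_sum (u := Finset.univ) fun k _ => h2 k).const_mul (ν / 2))
    refine h3.congr_deriv ?_
    have hrate := h.setIntegral_energy_rate (r := r) hγ hθ hT hΩ hb hρ₀ hd₀ hs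
    have hi2 : ∀ k, IntegrableOn
        (fun x => -2 * (deriv (fun s => d s x k) s * lapl (fun y => d s y k) x)) Ω := by
      intro k
      obtain ⟨R, hR⟩ := (hdt k).bdd
      obtain ⟨K, hK0, hK⟩ := (hd k).bdd_pd_pd hΩ hb
      have hc : ContinuousOn (lapl fun y => d s y k) Ω := continuousOn_finsetSum _ fun i _ =>
        (((hd k).reg2_slice hΩ hb hI).pd i).continuousOn_pd hΩ i
      refine integrableOn_of_bdd hΩ hb
        (continuousOn_const.mul ((continuousOn_timeDeriv (hdt k) hs).mul hc))
        ⟨2 * (R * ∑ _i : Fin 2, K), fun x hx => ?_⟩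
      rw [Real.norm_eq_abs, abs_mul, abs_mul, abs_neg, abs_two]
      refine mul_le_mul_of_nonneg_left (mul_le_mul (hR s hs x hx) ?_ (abs_nonneg _)
        ((abs_nonneg _).trans (hR s hs x hx))) (by norm_num)
      exact (Finset.abs_sum_le_sum_abs _ _).trans (Finset.sum_le_sum fun i _ => hK i i s hI x hx)
    have hi3 : IntegrableOn (dissip μ lam ν θ (v s) (d s)) Ω := by
      obtain ⟨K, hK⟩ := h.exists_dissip_le hT hΩ hb
      exact integrableOn_of_bdd hΩ hb ((h.continuousOn_dissip hT hΩ hb).comp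
        (f := fun x => (s, x)) (by fun_prop) fun x hx => ⟨hI, hx⟩) ⟨K, hK s hI⟩
    have hisum := (integrable_finsetSum Finset.univ fun k _ => hi2 k).const_mul (ν / 2)
    have e1 := integral_add (hi1.add hisum) hi3
    have e2 := integral_add hi1 hisum
    simp only [Pi.add_apply] at e1 e2
    rw [hrate, e2, integral_const_mul, integral_finsetSum _ fun k _ => hi2 k] at e1
    simp only [hD]
    linarith
  have hsub : Icc 0 t ⊆ Icc 0 T := Icc_subset_Icc_right ht.2
  have hfund := intervalIntegral.integral_eq_sub_of_hasDerivAt_of_le ht.1 (hEc.mono hsub)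
    (fun s hs => hderiv s ⟨hs.1, hs.2.trans_le ht.2⟩)
    (ContinuousOn.intervalIntegrable (by
      rw [uIcc_of_le ht.1]; exact (hDc.mono hsub).neg))
  rw [intervalIntegral.integral_neg, intervalIntegral.integral_of_le ht.1,
    integral_Ioc_eq_integral_Ioo, hE0] at hfund
  have hEt : E t = (∫ x in Ω, kinPot A γ r (ρ t) (v t) x) +
      ν / 2 * (∫ x in Ω, ‖grad (d t) x‖ ^ 2) := by
    simp only [hE]
    rw [← integral_finsetSum _ fun k _ => hiD t ht k]
    congr 2
    refine setIntegral_congr_fun hΩ.measurableSet fun x hx => ?_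
    simp only [norm_grad_sq]
    rw [Finset.sum_comm]
  rw [← hEt]
  linarith

end Solution

/-! ### The energy bound -/

lemma rpow_le_one_add {B p : ℝ} (hB : 0 ≤ B) (hp0 : 0 ≤ p) (hp1 : p ≤ 1) : B ^ p ≤ 1 + B := by
  rcases le_total B 1 with h | h
  · exact (Real.rpow_le_one hB h hp0).trans (by linarith)
  · exact (Real.rpow_le_rpow_of_exponent_le h hp1).trans (by rw [Real.rpow_one]; linarith)

/-- `(∫ |f|ᵖ)^{1/p} ≤ 1 + B` if `∫ |f|ᵖ ≤ B`; the bound serves all exponents `p` at once. -/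
lemma eLpNorm_le_one_add {α ε : Type*} [MeasurableSpace α] [ENorm ε] {κ : Measure α} {f : α → ε}
    {p : ℝ} {P : ℝ≥0∞} (hP : P = ENNReal.ofReal p) (hp : 1 ≤ p) {g : α → ℝ}
    (hg : Integrable g κ) (hg0 : 0 ≤ᵐ[κ] g)
    (h : ∀ᵐ x ∂κ, ‖f x‖ₑ ^ p ≤ ENNReal.ofReal (g x)) {B : ℝ} (hB : ∫ x, g x ∂κ ≤ B) :
    eLpNorm f P κ ≤ ENNReal.ofReal (1 + B) := by
  subst hP
  have hp0 : 0 < p := by linarith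
  rw [eLpNorm_eq_lintegral_rpow_enorm_toReal (by simpa using hp0) ENNReal.ofReal_ne_top,
    ENNReal.toReal_ofReal hp0.le]
  have h1 : ∫⁻ x, ‖f x‖ₑ ^ p ∂κ ≤ ENNReal.ofReal B := by
    refine (lintegral_mono_ae h).trans ?_
    rw [← ofReal_integral_eq_lintegral_ofReal hg hg0]
    exact ENNReal.ofReal_le_ofReal hB
  have hB0 : 0 ≤ B := (integral_nonneg_of_ae hg0).trans hB
  calc (∫⁻ x, ‖f x‖ₑ ^ p ∂κ) ^ (1 / p) ≤ (ENNReal.ofReal B) ^ (1 / p) := by gcongr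
    _ = ENNReal.ofReal (B ^ (1 / p)) := ENNReal.ofReal_rpow_of_nonneg hB0 (by positivity)
    _ ≤ _ := ENNReal.ofReal_le_ofReal
        (rpow_le_one_add hB0 (by positivity) (by rw [div_le_one hp0]; exact hp))

lemma enorm_rpow_two_eq {F : Type*} [NormedAddCommGroup F] (a : F) :
    ‖a‖ₑ ^ (2 : ℝ) = ENNReal.ofReal (‖a‖ ^ 2) := by
  rw [← ofReal_norm, ENNReal.ofReal_rpow_of_nonneg (norm_nonneg _) (by norm_num)]
  norm_num

/-- The square of the `L²` norm is the integral of the square. -/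
lemma eLpNorm_two_rpow {α F : Type*} [MeasurableSpace α] [NormedAddCommGroup F] {κ : Measure α}
    {f : α → F} (hf : Integrable (fun x => ‖f x‖ ^ 2) κ) :
    eLpNorm f 2 κ ^ (2 : ℝ) = ENNReal.ofReal (∫ x, ‖f x‖ ^ 2 ∂κ) := by
  rw [eLpNorm_eq_lintegral_rpow_enorm_toReal (by norm_num) (by norm_num),
    ← ENNReal.rpow_mul, ENNReal.toReal_ofNat, one_div, inv_mul_cancel₀ two_ne_zero,
    ENNReal.rpow_one, ofReal_integral_eq_lintegral_ofReal hf (.of_forall fun x => by positivity)]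
  exact lintegral_congr fun x => enorm_rpow_two_eq (f x)

lemma two_eq_ofReal : 2 = ENNReal.ofReal 2 := by simp

/-- The square of the norm of the gradient is continuous on the space-time cylinder. -/
lemma continuousOn_norm_grad_sq {T : ℝ} {Ω : Set Plane} {u : ℝ → Plane → Plane}
    (hu : ∀ k, SpaceReg1 T Ω fun t x => u t x k) :
    ContinuousOn (fun p : ℝ × Plane => ‖grad (u p.1) p.2‖ ^ 2) (Icc 0 T ×ˢ Ω) := by
  simp only [norm_grad_sq]
  exact continuousOn_finsetSum _ fun i _ => continuousOn_finsetSum _ fun k _ =>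
    ((hu k).continuousOn_pd i).pow 2

lemma exists_norm_grad_sq_le {T : ℝ} {Ω : Set Plane} {u : ℝ → Plane → Plane}
    (hb : Bornology.IsBounded Ω) (hu : ∀ k, SpaceReg1 T Ω fun t x => u t x k) :
    ∃ K, ∀ t ∈ Icc 0 T, ∀ x ∈ Ω, |‖grad (u t) x‖ ^ 2| ≤ K := by
  choose a ha0 ha using fun k => (hu k).bdd_pd hb
  refine ⟨∑ _i : Fin 2, ∑ k, a k ^ 2, fun t ht x hx => ?_⟩
  rw [abs_of_nonneg (by positivity), norm_grad_sq]
  exact Finset.sum_le_sum fun i _ => Finset.sum_le_sum fun k _ =>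
    sq_le_sq' (neg_le_of_abs_le (ha k i t ht x hx)) (le_of_abs_le (ha k i t ht x hx))

lemma integrableOn_norm_grad_sq {Ω : Set Plane} {u : Plane → Plane} (hΩ : IsOpen Ω)
    (hb : Bornology.IsBounded Ω) (hu : ∀ k, Reg2 Ω fun x => u x k) :
    IntegrableOn (fun x => ‖grad u x‖ ^ 2) Ω := by
  simp only [norm_grad_sq]
  exact (Reg1.sum _ hΩ fun i _ => Reg1.sum _ hΩ fun k _ => ((hu k).pd i).pow hΩ 2).integrableOn
    hΩ hb

section Solution

variable {A γ μ lam ν θ T r : ℝ} {Ω : Set Plane} {ρ₀ : Plane → ℝ} {m₀ d₀ : Plane → Plane}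
  {ρ : ℝ → Plane → ℝ} {v d : ℝ → Plane → Plane}
  (h : IsClassicalSolution A γ μ lam ν θ T Ω ρ₀ m₀ d₀ ρ v d)

include h

lemma IsClassicalSolution.continuousOn_tension (hT : 0 < T) (hΩ : IsOpen Ω)
    (hb : Bornology.IsBounded Ω) :
    ContinuousOn (fun p : ℝ × Plane => ∑ k, tension (d p.1) p.2 k ^ 2) (Icc 0 T ×ˢ Ω) := by
  have hd := fun k => (h.reg_director k).spaceReg2 hT hΩ hb
  unfold tension lapl
  refine continuousOn_finsetSum _ fun k _ => ContinuousOn.pow ?_ 2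
  exact (continuousOn_finsetSum _ fun i _ => (hd k).continuousOn_pd_pd hΩ i i).add
    ((continuousOn_finsetSum _ fun i _ => continuousOn_finsetSum _ fun l _ =>
      ((hd l).reg1.continuousOn_pd i).pow 2).mul (hd k).reg1.continuousOn_prod)

lemma IsClassicalSolution.exists_tension_le (hT : 0 < T) (hΩ : IsOpen Ω)
    (hb : Bornology.IsBounded Ω) :
    ∃ K, ∀ t ∈ Icc 0 T, ∀ x ∈ Ω, |∑ k, tension (d t) x k ^ 2| ≤ K := by
  have hd := fun k => (h.reg_director k).spaceReg2 hT hΩ hb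
  choose b hb0 hb' using fun k => (hd k).reg1.bdd_pd hb
  choose c hc0 hc using fun k => (hd k).bdd_pd_pd hΩ hb
  choose e he0 he using fun k => (hd k).reg1.bdd hb
  refine ⟨∑ k, (∑ _i : Fin 2, c k + (∑ _i : Fin 2, ∑ l, b l ^ 2) * e k) ^ 2, fun t ht x hx => ?_⟩
  have hsum : ∀ {p q : Fin 2 → ℝ}, (∀ i, |p i| ≤ q i) → |∑ i, p i| ≤ ∑ i, q i := fun hpq =>
    (Finset.abs_sum_le_sum_abs _ _).trans (Finset.sum_le_sum fun i _ => hpq i)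
  have hsq : ∀ {p q : ℝ}, |p| ≤ q → |p ^ 2| ≤ q ^ 2 := fun {p q} hpq => by
    rw [abs_pow]; exact pow_le_pow_left₀ (abs_nonneg _) hpq 2
  unfold tension lapl
  refine hsum fun k => hsq ((abs_add_le _ _).trans (add_le_add
      (hsum fun i => hc k i i t ht x hx) ?_))
  rw [abs_mul]
  have h1 : |∑ i, ∑ l, pd i (fun y => d t y l) x ^ 2| ≤ ∑ _i : Fin 2, ∑ l, b l ^ 2 :=
    hsum fun i => hsum fun l => hsq (hb' l i t ht x hx)
  exact mul_le_mul h1 (he k t ht x (subset_closure hx)) (abs_nonneg _) ((abs_nonneg _).trans h1)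

/-- The bounds on the solution that the energy balance gives. -/
lemma IsClassicalSolution.energy_bounds (hA : 0 < A) (hγ : 1 < γ) (hμ : 0 < μ) (hν : 0 < ν)
    (hθ : 0 < θ) (hlam : 0 ≤ lam + μ) (hr : 0 ≤ r) (hT : 0 < T) (hΩ : IsOpen Ω)
    (hb : Bornology.IsBounded Ω) (hρ₀ : ∀ x ∈ Ω, 0 ≤ ρ₀ x) (hd₀ : ∀ x ∈ Ω, ‖d₀ x‖ = 1) :
    0 ≤ energy A γ ν r Ω ρ₀ m₀ d₀ ∧
    (∀ t ∈ Icc 0 T, ∫ x in Ω, kinPot A γ r (ρ t) (v t) x ≤ energy A γ ν r Ω ρ₀ m₀ d₀) ∧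
    (∀ t ∈ Icc 0 T, ∫ x in Ω, ‖grad (d t) x‖ ^ 2 ≤ 2 / ν * energy A γ ν r Ω ρ₀ m₀ d₀) ∧
    (∫ t in Ioo 0 T, ∫ x in Ω, ‖grad (v t) x‖ ^ 2) ≤ 1 / μ * energy A γ ν r Ω ρ₀ m₀ d₀ ∧
    (∫ t in Ioo 0 T, ∫ x in Ω, ∑ k, tension (d t) x k ^ 2) ≤
      1 / (ν * θ) * energy A γ ν r Ω ρ₀ m₀ d₀ := by
  set e := energy A γ ν r Ω ρ₀ m₀ d₀ with he
  have hkp : ∀ t ∈ Icc 0 T, 0 ≤ ∫ x in Ω, kinPot A γ r (ρ t) (v t) x := fun t ht =>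
    setIntegral_nonneg hΩ.measurableSet fun x hx => by
      have h0 := h.density_nonneg hT hΩ hb hρ₀ t ht x hx
      have := potential_nonneg hA hγ hr h0
      unfold kinPot; positivity
  have hvreg := fun k => ((h.reg_velocity k).spaceReg2 hT hΩ hb).reg1
  have hdir : ∀ t, 0 ≤ ∫ x in Ω, ‖grad (d t) x‖ ^ 2 := fun t =>
    integral_nonneg fun x => by positivity
  have hlam' : 0 ≤ μ + lam := by linarith
  have htens : ∀ (u : Plane → Plane) x, 0 ≤ ∑ k, tension u x k ^ 2 := fun u x => by positivity
  have hdis : ∀ t, 0 ≤ ∫ x in Ω, dissip μ lam ν θ (v t) (d t) x := fun t =>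
    integral_nonneg fun x => by
      rw [dissip_eq]
      have := htens (d t) x
      positivity
  have hdis' : ∀ t, 0 ≤ ∫ s in Ioo 0 t, ∫ x in Ω, dissip μ lam ν θ (v s) (d s) x := fun t =>
    integral_nonneg fun s => hdis s
  have hbal := fun {t} (ht : t ∈ Icc 0 T) => h.energy_balance (r := r) hγ hθ hT hΩ hb hρ₀ hd₀ ht
  have hTI : T ∈ Icc 0 T := ⟨hT.le, le_rfl⟩
  have hdirν : ∀ t, 0 ≤ ν / 2 * ∫ x in Ω, ‖grad (d t) x‖ ^ 2 := fun t =>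
    mul_nonneg (by positivity) (hdir t)
  have hdT : (∫ s in Ioo 0 T, ∫ x in Ω, dissip μ lam ν θ (v s) (d s) x) ≤ e := by
    linarith [hbal hTI, hkp T hTI, hdirν T]
  have hiD : ∀ t ∈ Icc 0 T, IntegrableOn (dissip μ lam ν θ (v t) (d t)) Ω := fun t ht => by
    obtain ⟨K, hK⟩ := h.exists_dissip_le hT hΩ hb
    exact integrableOn_of_bdd hΩ hb ((h.continuousOn_dissip hT hΩ hb).comp
      (f := fun x => (t, x)) (by fun_prop) fun x hx => ⟨ht, hx⟩) ⟨K, hK t ht⟩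
  have hmono : ∀ {q : ℝ → Plane → ℝ} {c : ℝ}, 0 < c →
      ContinuousOn (fun p : ℝ × Plane => q p.1 p.2) (Icc 0 T ×ˢ Ω) →
      (∃ K, ∀ t ∈ Icc 0 T, ∀ x ∈ Ω, |q t x| ≤ K) →
      (∀ t x, c * q t x ≤ dissip μ lam ν θ (v t) (d t) x) →
      ∫ t in Ioo 0 T, ∫ x in Ω, q t x ≤ 1 / c * e := by
    intro q c hc hqc hqK hq
    have h1 := continuousOn_setIntegral hΩ hb hqc hqK
    have h2 := continuousOn_setIntegral hΩ hb (h.continuousOn_dissip hT hΩ hb)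
      (h.exists_dissip_le hT hΩ hb)
    have i1 : IntegrableOn (fun t => c * ∫ x in Ω, q t x) (Ioo 0 T) :=
      ((h1.integrableOn_Icc).mono_set Ioo_subset_Icc_self).const_mul c
    have i2 := (h2.integrableOn_Icc (μ := volume)).mono_set
      (Ioo_subset_Icc_self (a := (0 : ℝ)) (b := T))
    have h3 := setIntegral_mono_on i1 i2 measurableSet_Ioo fun t ht => by
      have hI := Ioo_subset_Icc_self ht
      rw [← integral_const_mul]
      refine setIntegral_mono_on ?_ (hiD t hI) hΩ.measurableSet fun x _ => hq t x
      obtain ⟨K, hK⟩ := hqK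
      exact (integrableOn_of_bdd hΩ hb (hqc.comp (f := fun x => (t, x)) (by fun_prop)
        fun x hx => ⟨hI, hx⟩) ⟨K, hK t hI⟩).const_mul c
    rw [integral_const_mul] at h3
    rw [one_div, ← div_eq_inv_mul, le_div_iff₀ hc]
    linarith
  refine ⟨?_, fun t ht => ?_, fun t ht => ?_, ?_, ?_⟩
  · linarith [hbal hTI, hkp T hTI, hdirν T, hdis' T]
  · linarith [hbal ht, hdirν t, hdis' t]
  · have : ν / 2 * ∫ x in Ω, ‖grad (d t) x‖ ^ 2 ≤ e := by linarith [hbal ht, hkp t ht, hdis' t]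
    calc ∫ x in Ω, ‖grad (d t) x‖ ^ 2 = 2 / ν * (ν / 2 * ∫ x in Ω, ‖grad (d t) x‖ ^ 2) := by
          field_simp
      _ ≤ 2 / ν * e := by gcongr
  · refine hmono hμ (continuousOn_norm_grad_sq hvreg) (exists_norm_grad_sq_le hb hvreg)
      fun t x => ?_
    rw [dissip_eq]
    have := htens (d t) x
    have : 0 ≤ (μ + lam) * dvg (v t) x ^ 2 + ν * θ * ∑ k, tension (d t) x k ^ 2 := by positivity
    linarith
  · refine hmono (by positivity) (h.continuousOn_tension hT hΩ hb) (h.exists_tension_le hT hΩ hb)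
      fun t x => ?_
    rw [dissip_eq]
    have : 0 ≤ μ * ‖grad (v t) x‖ ^ 2 + (μ + lam) * dvg (v t) x ^ 2 := by positivity
    linarith

/-- The norms in the energy bound, estimated by the initial energy and `ρ∞ ^ γ |Ω|`. -/
lemma IsClassicalSolution.sum_norms_le (hA : 0 < A) (hγ : 1 < γ) (hμ : 0 < μ) (hν : 0 < ν)
    (hθ : 0 < θ) (hlam : 0 ≤ lam + μ) (hr : 0 ≤ r) (hT : 0 < T) (hΩ : IsOpen Ω)
    (hb : Bornology.IsBounded Ω) (hρ₀ : ∀ x ∈ Ω, 0 ≤ ρ₀ x) (hd₀ : ∀ x ∈ Ω, ‖d₀ x‖ = 1) {t : ℝ}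
    (ht : t ∈ Icc 0 T) :
    lpNormSpace Ω 2 (fun x => Real.sqrt (ρ t x) • v t x)
        + lpNormSpace Ω (ENNReal.ofReal γ) (ρ t)
        + lpNormSpace Ω 2 (grad (d t))
        + lpNormTime T 2 (fun s => lpNormSpace Ω 2 (grad (v s))) ≤
      ENNReal.ofReal (4 + (2 + 2 * (γ - 1) / A + 2 / ν + 1 / μ) * energy A γ ν r Ω ρ₀ m₀ d₀ +
        (2 * γ) ^ (γ / (γ - 1)) * (r ^ γ * (volume Ω).toReal)) := by
  obtain ⟨he, h1, h2, h3, -⟩ := h.energy_bounds hA hγ hμ hν hθ hlam hr hT hΩ hb hρ₀ hd₀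
  set e := energy A γ ν r Ω ρ₀ m₀ d₀ with he_def
  set b := r ^ γ * (volume Ω).toReal with hb_def
  have hb0 : 0 ≤ b := by positivity
  have hγ1 : 0 < γ - 1 := by linarith
  have hρ := h.reg_density.spaceReg1 hT hΩ hb |>.reg1_slice hb ht
  have hv := fun k => ((h.reg_velocity k).spaceReg2 hT hΩ hb).reg1.reg1_slice hb ht
  have hρ0 := h.density_nonneg hT hΩ hb hρ₀ t ht
  have hkin : Reg1 Ω fun x => ρ t x * (v t x 0 ^ 2 + v t x 1 ^ 2) :=
    hρ.mul (((hv 0).pow hΩ 2).add ((hv 1).pow hΩ 2) hΩ) hΩ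
  have hkp := h.reg1_kinPot (r := r) hγ hT hΩ hb ht
  have hpot : Reg1 Ω fun x => potential A γ r (ρ t x) := hρ.comp hΩ (contDiff_potential hγ)
  have hae : ∀ {P : Plane → Prop}, (∀ x ∈ Ω, P x) → ∀ᵐ x ∂(volume.restrict Ω), P x := fun hP =>
    (ae_restrict_mem hΩ.measurableSet).mono hP
  have n1 : lpNormSpace Ω 2 (fun x => Real.sqrt (ρ t x) • v t x) ≤ ENNReal.ofReal (1 + 2 * e) := by
    rw [lpNormSpace]
    refine eLpNorm_le_one_add two_eq_ofReal (by norm_num) (hkin.integrableOn hΩ hb)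
      (hae fun x hx => mul_nonneg (hρ0 x hx) (by positivity)) (hae fun x hx => ?_) ?_
    · rw [enorm_rpow_two_eq, norm_smul, mul_pow, Real.norm_eq_abs, sq_abs, Real.sq_sqrt (hρ0 x hx),
        EuclideanSpace.norm_sq_eq, Fin.sum_univ_two]
      simp
    · have : ∫ x in Ω, ρ t x * (v t x 0 ^ 2 + v t x 1 ^ 2) ≤
          ∫ x in Ω, 2 * kinPot A γ r (ρ t) (v t) x := by
        refine setIntegral_mono_on (hkin.integrableOn hΩ hb)
          ((hkp.const_mul hΩ 2).integrableOn hΩ hb) hΩ.measurableSet fun x hx => ?_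
        have := potential_nonneg hA hγ hr (hρ0 x hx)
        unfold kinPot
        linarith
      rw [integral_const_mul] at this
      linarith [h1 t ht]
  have n2 : lpNormSpace Ω (ENNReal.ofReal γ) (ρ t) ≤
      ENNReal.ofReal (1 + (2 * (γ - 1) / A * e + (2 * γ) ^ (γ / (γ - 1)) * b)) := by
    have hργ : Reg1 Ω fun x => ρ t x ^ γ := hρ.comp hΩ (contDiff_rpow hγ)
    refine eLpNorm_le_one_add rfl hγ.le (hργ.integrableOn hΩ hb)
      (hae fun x hx => Real.rpow_nonneg (hρ0 x hx) _) (hae fun x hx => ?_) ?_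
    · rw [← ofReal_norm, Real.norm_of_nonneg (hρ0 x hx),
        ENNReal.ofReal_rpow_of_nonneg (hρ0 x hx) (by linarith)]
    · have hg : Reg1 Ω fun x => 2 * (γ - 1) / A * kinPot A γ r (ρ t) (v t) x +
          (2 * γ) ^ (γ / (γ - 1)) * r ^ γ := (hkp.const_mul hΩ _).add (reg1_const _) hΩ
      have : ∫ x in Ω, ρ t x ^ γ ≤ ∫ x in Ω, (2 * (γ - 1) / A * kinPot A γ r (ρ t) (v t) x +
          (2 * γ) ^ (γ / (γ - 1)) * r ^ γ) := by
        refine setIntegral_mono_on (hργ.integrableOn hΩ hb) (hg.integrableOn hΩ hb)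
          hΩ.measurableSet fun x hx => (rpow_le_potential hA hγ hr (hρ0 x hx)).trans ?_
        have h0 := hρ0 x hx
        have : potential A γ r (ρ t x) ≤ kinPot A γ r (ρ t) (v t) x := by
          unfold kinPot
          have : 0 ≤ 1 / 2 * (ρ t x * (v t x 0 ^ 2 + v t x 1 ^ 2)) := by positivity
          linarith
        gcongr
      rw [integral_add ((hkp.const_mul hΩ _).integrableOn hΩ hb)
        ((reg1_const _).integrableOn hΩ hb), integral_const_mul, setIntegral_const, smul_eq_mul]
        at this
      refine this.trans (add_le_add (mul_le_mul_of_nonneg_left (h1 t ht) (by positivity)) ?_)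
      rw [hb_def, measureReal_def]
      exact le_of_eq (by ring)
  have n3 : lpNormSpace Ω 2 (grad (d t)) ≤ ENNReal.ofReal (1 + 2 / ν * e) := by
    rw [lpNormSpace]
    exact eLpNorm_le_one_add two_eq_ofReal (by norm_num) 
      (integrableOn_norm_grad_sq hΩ hb fun k =>
        (h.reg_director k).spaceReg2 hT hΩ hb |>.reg2_slice hΩ hb ht)
      (.of_forall fun x => by positivity) (.of_forall fun x => (enorm_rpow_two_eq _).le) (h2 t ht)
  have hvreg := fun k => ((h.reg_velocity k).spaceReg2 hT hΩ hb).reg1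
  have n4 : lpNormTime T 2 (fun s => lpNormSpace Ω 2 (grad (v s))) ≤
      ENNReal.ofReal (1 + 1 / μ * e) := by
    rw [lpNormTime]
    have hc := continuousOn_setIntegral hΩ hb (continuousOn_norm_grad_sq hvreg)
      (exists_norm_grad_sq_le hb hvreg)
    refine eLpNorm_le_one_add two_eq_ofReal (by norm_num)
      (hc.integrableOn_Icc.mono_set Ioo_subset_Icc_self)
      (.of_forall fun s => integral_nonneg fun x => by positivity) ?_ h3
    filter_upwards [ae_restrict_mem measurableSet_Ioo] with s hs
    rw [enorm_eq_self, lpNormSpace]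
    exact (eLpNorm_two_rpow (integrableOn_norm_grad_sq hΩ hb fun k =>
      (h.reg_velocity k).spaceReg2 hT hΩ hb |>.reg2_slice hΩ hb (Ioo_subset_Icc_self hs))).le
  have q2 : 0 ≤ 2 * (γ - 1) / A * e + (2 * γ) ^ (γ / (γ - 1)) * b := by positivity
  have q3 : 0 ≤ 2 / ν * e := by positivity
  have q4 : 0 ≤ 1 / μ * e := by positivity
  refine (add_le_add (add_le_add (add_le_add n1 n2) n3) n4).trans ?_
  rw [← ENNReal.ofReal_add (by positivity) (by positivity),
    ← ENNReal.ofReal_add (by positivity) (by positivity),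
    ← ENNReal.ofReal_add (by positivity) (by positivity)]
  exact ENNReal.ofReal_le_ofReal (le_of_eq (by ring))

end Solution

/-- The energy bound, with its constant. -/
theorem exists_energy_bound (A γ μ ν θ : ℝ) (hA : 0 < A) (hγ : 1 < γ) (hμ : 0 < μ) (hν : 0 < ν)
    (hθ : 0 < θ) :
      ∃ c₂ : ℝ → ℝ → ℝ, (∀ b e, 0 < c₂ b e) ∧ Monotone (Function.uncurry c₂) ∧
        ∀ (lam ρinf T : ℝ) (Ω : Set Plane) (ρ₀ : Plane → ℝ) (m₀ d₀ : Plane → Plane)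
          (ρ : ℝ → Plane → ℝ) (v d : ℝ → Plane → Plane),
          0 ≤ lam + μ → 0 ≤ ρinf → 0 < T → IsBoundedDomain Ω →
          (∀ x ∈ Ω, 0 ≤ ρ₀ x) → (∀ x ∈ Ω, ‖d₀ x‖ = 1) →
          IsClassicalSolution A γ μ lam ν θ T Ω ρ₀ m₀ d₀ ρ v d →
          ∀ t ∈ Set.Icc 0 T,
            lpNormSpace Ω 2 (fun x => Real.sqrt (ρ t x) • v t x)
                + lpNormSpace Ω (ENNReal.ofReal γ) (ρ t)
                + lpNormSpace Ω 2 (grad (d t))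
                + lpNormTime T 2 (fun s => lpNormSpace Ω 2 (grad (v s)))
              ≤ ENNReal.ofReal
                  (c₂ (ρinf ^ γ * (volume Ω).toReal) (energy A γ ν ρinf Ω ρ₀ m₀ d₀)) := by
  have hγ1 : 0 < γ - 1 := by linarith
  refine ⟨fun b e => 4 + (2 + 2 * (γ - 1) / A + 2 / ν + 1 / μ) * max e 0 +
    (2 * γ) ^ (γ / (γ - 1)) * max b 0, fun b e => by positivity, ?_, ?_⟩
  · rintro ⟨b, e⟩ ⟨b', e'⟩ ⟨hbb, hee⟩
    simp only [Function.uncurry_apply_pair]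
    have h1 := max_le_max_right 0 hbb
    have h2 := max_le_max_right 0 hee
    gcongr
  · intro lam r T Ω ρ₀ m₀ d₀ ρ v d hlam hr hT hΩ hρ₀ hd₀ h t ht
    refine (h.sum_norms_le hA hγ hμ hν hθ hlam hr hT hΩ.isOpen hΩ.isBounded hρ₀ hd₀ ht).trans
      (ENNReal.ofReal_le_ofReal ?_)
    dsimp only
    gcongr
    · exact le_max_left _ _
    · exact le_max_left _ _

/-! ### Bounded continuous functions -/

/-- `f` is continuous and bounded in `Ω`. -/
structure BddCont (Ω : Set Plane) (f : Plane → ℝ) : Prop where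
  continuousOn : ContinuousOn f Ω
  bdd : ∃ K, ∀ x ∈ Ω, |f x| ≤ K

section BddCont

variable {Ω : Set Plane} {f g : Plane → ℝ}

lemma Reg1.bddCont (hf : Reg1 Ω f) : BddCont Ω f := ⟨hf.continuousOn, hf.bdd⟩

lemma Reg1.bddCont_pd (hf : Reg1 Ω f) (hΩ : IsOpen Ω) (i : Fin 2) : BddCont Ω (pd i f) :=
  ⟨hf.continuousOn_pd hΩ i, let ⟨K, hK⟩ := hf.bdd_pd; ⟨K, hK i⟩⟩

lemma BddCont.add (hf : BddCont Ω f) (hg : BddCont Ω g) : BddCont Ω fun x => f x + g x where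
  continuousOn := hf.continuousOn.add hg.continuousOn
  bdd := by
    obtain ⟨K, hK⟩ := hf.bdd
    obtain ⟨L, hL⟩ := hg.bdd
    exact ⟨K + L, fun x hx => (abs_add_le _ _).trans (add_le_add (hK x hx) (hL x hx))⟩

lemma BddCont.mul (hf : BddCont Ω f) (hg : BddCont Ω g) : BddCont Ω fun x => f x * g x where
  continuousOn := hf.continuousOn.mul hg.continuousOn
  bdd := by
    obtain ⟨K, hK⟩ := hf.bdd
    obtain ⟨L, hL⟩ := hg.bdd
    refine ⟨K * L, fun x hx => ?_⟩
    rw [abs_mul]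
    exact mul_le_mul (hK x hx) (hL x hx) (abs_nonneg _) ((abs_nonneg _).trans (hK x hx))

lemma bddCont_const (c : ℝ) : BddCont Ω fun _ => c := ⟨continuousOn_const, |c|, fun _ _ => le_rfl⟩

lemma BddCont.sub (hf : BddCont Ω f) (hg : BddCont Ω g) : BddCont Ω fun x => f x - g x := by
  simpa [sub_eq_add_neg] using hf.add ((bddCont_const (-1)).mul hg)

lemma BddCont.pow (hf : BddCont Ω f) (n : ℕ) : BddCont Ω fun x => f x ^ n := by
  induction n with
  | zero => simpa using bddCont_const 1
  | succ n ih => simpa [pow_succ] using ih.mul hf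

lemma BddCont.integrableOn (hf : BddCont Ω f) (hΩ : IsOpen Ω) (hb : Bornology.IsBounded Ω) :
    IntegrableOn f Ω :=
  integrableOn_of_bdd hΩ hb hf.continuousOn hf.bdd

end BddCont

/-! ### Boundary charts and the estimate for curl-free fields -/

/-- In the ball of radius `r` about `x₀`, and in the coordinates given by the isometry `R`, the set
`Ω` is the part above the graph of `g`. For an interior point the graph may lie outside the
ball. -/
structure IsGraphChart (Ω : Set Plane) (x₀ : Plane) (R : Plane ≃ₗᵢ[ℝ] Plane) (g : ℝ → ℝ)
    (r : ℝ) : Prop where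
  pos : 0 < r
  contDiff : ContDiff ℝ 2 g
  mem_iff : ∀ y ∈ Metric.ball x₀ r, (y ∈ Ω ↔ g (R y 0) < R y 1)

/-- The field `R⁻¹(1, g')`, which is tangent to the boundary in a chart. -/
noncomputable def tangent (R : Plane ≃ₗᵢ[ℝ] Plane) (g : ℝ → ℝ) (x : Plane) : Plane :=
  R.symm (EuclideanSpace.single 0 1) + deriv g (R x 0) • R.symm (EuclideanSpace.single 1 1)

lemma exists_isGraphChart {Ω : Set Plane} (hΩ : IsOpen Ω) {α : ℝ≥0}
    (hα : HasC2HolderBoundary α Ω) {x₀ : Plane} (hx₀ : x₀ ∈ closure Ω) :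
    ∃ R g r, IsGraphChart Ω x₀ R g r := by
  by_cases hx : x₀ ∈ Ω
  · obtain ⟨r, hr, hball⟩ := Metric.isOpen_iff.1 hΩ x₀ hx
    refine ⟨LinearIsometryEquiv.refl ℝ Plane, fun _ => x₀ 1 - r, r, hr, contDiff_const,
      fun y hy => ⟨fun _ => ?_, fun _ => hball hy⟩⟩
    have h1 : |(y - x₀) 1| ≤ ‖y - x₀‖ := by simpa using PiLp.norm_apply_le (y - x₀) 1
    have h2 : ‖y - x₀‖ < r := by simpa [dist_eq_norm] using hy
    have h3 := neg_le_of_abs_le h1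
    simp only [PiLp.sub_apply] at h3
    simp only [LinearIsometryEquiv.coe_refl, id_eq]
    linarith
  · obtain ⟨R, g, C, r, hr, hg, -, hiff⟩ := hα x₀ (by rw [hΩ.frontier_eq]; exact ⟨hx₀, hx⟩)
    exact ⟨R, g, r, hr, hg, hiff⟩

lemma norm_tangent_sq (R : Plane ≃ₗᵢ[ℝ] Plane) (g : ℝ → ℝ) (x : Plane) :
    tangent R g x 0 ^ 2 + tangent R g x 1 ^ 2 = 1 + deriv g (R x 0) ^ 2 := by
  have h1 : tangent R g x = R.symm (EuclideanSpace.single 0 1 +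
      deriv g (R x 0) • EuclideanSpace.single 1 1) := by
    simp [tangent]
  have h2 := EuclideanSpace.norm_sq_eq (tangent R g x)
  rw [Fin.sum_univ_two, Real.norm_eq_abs, sq_abs, Real.norm_eq_abs, sq_abs] at h2
  rw [← h2, h1, LinearIsometryEquiv.norm_map, EuclideanSpace.norm_sq_eq, Fin.sum_univ_two]
  simp

lemma contDiff_tangent {g : ℝ → ℝ} (hg : ContDiff ℝ 2 g) (R : Plane ≃ₗᵢ[ℝ] Plane) (i : Fin 2) :
    ContDiff ℝ 1 fun x => tangent R g x i := by
  have h1 : ContDiff ℝ 1 (deriv g) := by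
    have : ContDiff ℝ (1 + 1) g := by simpa [one_add_one_eq_two] using hg
    exact ((contDiff_succ_iff_deriv (n := 1)).1 this).2.2
  have h2 : ContDiff ℝ 1 fun x : Plane => R x 0 :=
    (EuclideanSpace.proj (𝕜 := ℝ) (0 : Fin 2)).contDiff.comp R.contDiff
  have h3 := h1.comp h2
  simp only [tangent, PiLp.add_apply, PiLp.smul_apply, smul_eq_mul]
  exact contDiff_const.add (h3.mul contDiff_const)

section Tangential

variable {Ω : Set Plane} {x₀ : Plane} {R : Plane ≃ₗᵢ[ℝ] Plane} {g : ℝ → ℝ} {r : ℝ}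

/-- At a boundary point, the tangential derivative of a function that vanishes on the boundary is
not positive; with the negative of the function, it is zero. The values are compared along
translates of the boundary into `Ω`. -/
lemma IsGraphChart.tangential_nonpos (hc : IsGraphChart Ω x₀ R g r) (hΩ : IsOpen Ω)
    {ψ : Plane → ℝ} {G : Fin 2 → Plane → ℝ} (hψ : ContinuousOn ψ (closure Ω))
    (hd : ContDiffOn ℝ 1 ψ Ω) (h0 : ∀ y ∈ frontier Ω, ψ y = 0)
    (hG : ∀ i, ContinuousOn (G i) (closure Ω)) (hpd : ∀ i, ∀ x ∈ Ω, pd i ψ x = G i x)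
    {y : Plane} (hy : y ∈ frontier Ω) (hyr : y ∈ Metric.ball x₀ r) :
    ∑ i, tangent R g y i * G i y ≤ 0 := by
  have hgc : Continuous g := hc.contDiff.continuous
  have hg' : Continuous (deriv g) := hc.contDiff.continuous_deriv (by norm_num)
  have hgd : Differentiable ℝ g := hc.contDiff.differentiable (by norm_num)
  have hy' := hy
  rw [hΩ.frontier_eq] at hy'
  have hy1 : R y 1 = g (R y 0) := by
    refine le_antisymm (not_lt.1 fun h => hy'.2 ((hc.mem_iff y hyr).2 h)) ?_
    have hne : (𝓝[Ω] y).NeBot := mem_closure_iff_nhdsWithin_neBot.1 hy'.1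
    have hR : ∀ i : Fin 2, Tendsto (fun x => R x i) (𝓝[Ω] y) (𝓝 (R y i)) := fun i =>
      ((EuclideanSpace.proj (𝕜 := ℝ) i).continuous.comp R.continuous).continuousAt.tendsto.mono_left
        nhdsWithin_le_nhds
    refine le_of_tendsto_of_tendsto ((hgc.tendsto _).comp (hR 0)) (hR 1) ?_
    filter_upwards [self_mem_nhdsWithin,
      mem_nhdsWithin_of_mem_nhds (Metric.isOpen_ball.mem_nhds hyr)] with x hx hxr
    exact ((hc.mem_iff x hxr).1 hx).le
  let c : ℝ × ℝ → Plane := fun p => (R y 0 + p.2) • R.symm (EuclideanSpace.single 0 1) +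
    (g (R y 0 + p.2) + p.1) • R.symm (EuclideanSpace.single 1 1)
  have hcc : Continuous c := by fun_prop
  have hRc : ∀ p, R (c p) 0 = R y 0 + p.2 ∧ R (c p) 1 = g (R y 0 + p.2) + p.1 := fun p => by
    simp [c]
  have hc0 : c (0, 0) = y := by
    apply R.injective
    ext i
    fin_cases i
    · simpa using (hRc (0, 0)).1
    · simpa [hy1] using (hRc (0, 0)).2
  have hball : ∀ᶠ p in 𝓝 (0 : ℝ × ℝ), c p ∈ Metric.ball x₀ r := by
    refine hcc.continuousAt.eventually (Metric.isOpen_ball.mem_nhds ?_)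
    have : c 0 = y := hc0
    rwa [this]
  have hin : ∀ p : ℝ × ℝ, c p ∈ Metric.ball x₀ r → 0 < p.1 → c p ∈ Ω := fun p hp hpos => by
    rw [hc.mem_iff _ hp, (hRc p).1, (hRc p).2]; linarith
  have hclos : ∀ p : ℝ × ℝ, c p ∈ Metric.ball x₀ r → 0 ≤ p.1 → c p ∈ closure Ω := by
    intro p hp hp0
    have ht : Tendsto (fun δ : ℝ => c (p.1 + δ, p.2)) (𝓝[>] 0) (𝓝 (c p)) := by
      have : Continuous fun δ : ℝ => c (p.1 + δ, p.2) := by fun_prop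
      simpa using (this.tendsto 0).mono_left nhdsWithin_le_nhds
    refine mem_closure_of_tendsto ht ?_
    filter_upwards [ht.eventually (Metric.isOpen_ball.mem_nhds hp), self_mem_nhdsWithin]
      with δ h1 h2
    exact hin _ h1 (by simp only [mem_Ioi] at h2; simpa using add_pos_of_nonneg_of_pos hp0 h2)
  have hfr : ∀ s : ℝ, c (0, s) ∈ Metric.ball x₀ r → c (0, s) ∈ frontier Ω := fun s hs => by
    rw [hΩ.frontier_eq]
    refine ⟨hclos _ hs le_rfl, fun h => ?_⟩
    rw [hc.mem_iff _ hs, (hRc _).1, (hRc _).2] at h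
    simp at h
  by_contra! hpos
  set H : Plane → ℝ := fun x => ∑ i, tangent R g x i * G i x with hH
  have hHc : ContinuousOn H (closure Ω) := continuousOn_finsetSum _ fun i _ =>
    (contDiff_tangent hc.contDiff R i).continuous.continuousOn.mul (hG i)
  have hHev : ∀ᶠ x in 𝓝[closure Ω] y, H y / 2 < H x :=
    (hHc y hy'.1).eventually (lt_mem_nhds (by linarith))
  rw [eventually_nhdsWithin_iff] at hHev
  have hev : ∀ᶠ p in 𝓝 (0 : ℝ × ℝ), c p ∈ Metric.ball x₀ r ∧
      (c p ∈ closure Ω → H y / 2 < H (c p)) := by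
    have hc0' : c 0 = y := hc0
    have h2 : ∀ᶠ x in 𝓝 (c 0), x ∈ closure Ω → H y / 2 < H x := by rwa [hc0']
    exact hball.and (hcc.continuousAt.eventually h2)
  obtain ⟨ε, hε, hεp⟩ := Metric.eventually_nhds_iff.1 hev
  have hbox : ∀ p : ℝ × ℝ, p.1 ∈ Icc 0 (ε / 2) → p.2 ∈ Icc 0 (ε / 2) →
      c p ∈ Metric.ball x₀ r ∧ (c p ∈ closure Ω → H y / 2 < H (c p)) := fun p h1 h2 => by
    refine hεp ?_
    rw [dist_zero_right, Prod.norm_def, max_lt_iff, Real.norm_of_nonneg h1.1,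
      Real.norm_of_nonneg h2.1]
    exact ⟨by linarith [h1.2], by linarith [h2.2]⟩
  have hmv : ∀ δ ∈ Ioc 0 (ε / 2), H y / 2 * (ε / 2) ≤ ψ (c (δ, ε / 2)) - ψ (c (δ, 0)) := by
    intro δ hδ
    have hδ' : δ ∈ Icc 0 (ε / 2) := ⟨hδ.1.le, hδ.2⟩
    have hder : ∀ s ∈ Icc 0 (ε / 2), HasDerivAt (fun s => ψ (c (δ, s))) (H (c (δ, s))) s := by
      intro s hs
      have hΩs := hin _ (hbox (δ, s) hδ' hs).1 hδ.1
      have h1 : HasDerivAt (fun s => c (δ, s)) (tangent R g (c (δ, s))) s := by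
        have e1 : HasDerivAt (fun s : ℝ => R y 0 + s) 1 s := by
          simpa using (hasDerivAt_id s).const_add (R y 0)
        have e2 : HasDerivAt (fun s : ℝ => g (R y 0 + s) + δ) (deriv g (R y 0 + s)) s := by
          have := (hgd.differentiableAt (x := R y 0 + s)).hasDerivAt.comp s e1
          simpa using this.add_const δ
        have e3 := (e1.smul_const (R.symm (EuclideanSpace.single 0 1))).add
          (e2.smul_const (R.symm (EuclideanSpace.single 1 1)))
        refine e3.congr_deriv ?_
        rw [tangent, (hRc (δ, s)).1, one_smul]
      have h2 := (differentiableAt_of_contDiffOn hΩ hd hΩs).hasFDerivAt.comp_hasDerivAt s h1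
      refine h2.congr_deriv ?_
      rw [fderiv_apply_eq, hH]
      exact Finset.sum_congr rfl fun i _ => by rw [hpd i _ hΩs]
    have := (convex_Icc (0 : ℝ) (ε / 2)).mul_sub_le_image_sub_of_le_deriv
      (f := fun s => ψ (c (δ, s))) (fun s hs => (hder s hs).continuousAt.continuousWithinAt)
      (fun s hs => (hder s (interior_subset hs)).differentiableAt.differentiableWithinAt)
      (C := H y / 2) (fun s hs => by
        have hs := interior_subset hs
        rw [(hder s hs).deriv]
        have hb := hbox (δ, s) hδ' hs
        exact (hb.2 (hclos _ hb.1 hδ.1.le)).le)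
      0 ⟨le_rfl, by positivity⟩ (ε / 2) ⟨by positivity, le_rfl⟩ (by positivity)
    simpa using this
  have hlim : ∀ s ∈ Icc 0 (ε / 2), Tendsto (fun δ => ψ (c (δ, s))) (𝓝[>] 0) (𝓝 0) := by
    intro s hs
    have hb := hbox (0, s) ⟨le_rfl, by positivity⟩ hs
    suffices hlim' : Tendsto (fun δ => ψ (c (δ, s))) (𝓝[>] 0) (𝓝 (ψ (c (0, s)))) by
      rwa [h0 _ (hfr s hb.1)] at hlim'
    refine (hψ _ (hclos _ hb.1 le_rfl)).tendsto.comp (tendsto_nhdsWithin_iff.2 ⟨?_, ?_⟩)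
    · have : Continuous fun δ : ℝ => c (δ, s) := by fun_prop
      exact (this.tendsto 0).mono_left nhdsWithin_le_nhds
    · filter_upwards [Ioc_mem_nhdsGT (show (0 : ℝ) < ε / 2 by positivity)] with δ hδ
      exact hclos _ (hbox (δ, s) ⟨hδ.1.le, hδ.2⟩ hs).1 hδ.1.le
  have hfin := ge_of_tendsto ((hlim (ε / 2) ⟨by positivity, le_rfl⟩).sub
    (hlim 0 ⟨le_rfl, by positivity⟩)) (b := H y / 2 * (ε / 2)) (by
      filter_upwards [Ioc_mem_nhdsGT (show (0 : ℝ) < ε / 2 by positivity)] with δ hδ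
      exact hmv δ hδ)
  have : 0 < H y / 2 * (ε / 2) := by positivity
  linarith

lemma IsGraphChart.tangential_eq_zero (hc : IsGraphChart Ω x₀ R g r) (hΩ : IsOpen Ω)
    {ψ : Plane → ℝ} {G : Fin 2 → Plane → ℝ} (hψ : ContinuousOn ψ (closure Ω))
    (hd : ContDiffOn ℝ 1 ψ Ω) (h0 : ∀ y ∈ frontier Ω, ψ y = 0)
    (hG : ∀ i, ContinuousOn (G i) (closure Ω)) (hpd : ∀ i, ∀ x ∈ Ω, pd i ψ x = G i x)
    {y : Plane} (hy : y ∈ frontier Ω) (hyr : y ∈ Metric.ball x₀ r) :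
    ∑ i, tangent R g y i * G i y = 0 := by
  refine le_antisymm (hc.tangential_nonpos hΩ hψ hd h0 hG hpd hy hyr) ?_
  have := hc.tangential_nonpos hΩ (ψ := fun x => -ψ x) (G := fun i x => -G i x) hψ.neg hd.neg
    (fun y hy => by simp [h0 y hy]) (fun i => (hG i).neg)
    (fun i x hx => by rw [pd_neg, hpd i x hx]) hy hyr
  simp only [mul_neg, Finset.sum_neg_distrib] at this
  linarith

/-- The tangential component of the field `(w₀, w₁)` tends to zero at the boundary. -/
def TangVanish (Ω : Set Plane) (w₀ w₁ : Plane → ℝ) : Prop :=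
  ∀ x₀ R g r, IsGraphChart Ω x₀ R g r → ∀ y ∈ frontier Ω, y ∈ Metric.ball x₀ r →
    Tendsto (fun x => tangent R g x 0 * w₀ x + tangent R g x 1 * w₁ x) (𝓝[Ω] y) (𝓝 0)

/-- Passing from local to global estimates by compactness. -/
lemma exists_global_bound {ι : Type*} {f : ι → Plane → ℝ} {B : ι → ℝ} (hΩ : IsOpen Ω)
    (hb : Bornology.IsBounded Ω) (hf : ∀ i, IntegrableOn (f i) Ω) (hf0 : ∀ i x, 0 ≤ f i x)
    (hloc : ∀ x₀ ∈ closure Ω, ∃ (η : Plane → ℝ) (C : ℝ), 0 ≤ C ∧ (∀ x, 0 ≤ η x) ∧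
      (∀ᶠ x in 𝓝 x₀, 1 ≤ η x) ∧ ∀ i, IntegrableOn (fun x => η x * f i x) Ω ∧
        ∫ x in Ω, η x * f i x ≤ C * B i) :
    ∃ C, 0 ≤ C ∧ ∀ i, ∫ x in Ω, f i x ≤ C * B i := by
  choose! η C hC0 hη0 hη1 hest using hloc
  obtain ⟨t, ht, hcov⟩ := hb.isCompact_closure.elim_nhds_subcover
    (fun x₀ => {x | 1 ≤ η x₀ x}) (fun x₀ hx₀ => hη1 x₀ hx₀)
  refine ⟨∑ x₀ ∈ t, C x₀, Finset.sum_nonneg fun x₀ hx₀ => hC0 x₀ (ht x₀ hx₀), fun i => ?_⟩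
  calc ∫ x in Ω, f i x ≤ ∫ x in Ω, ∑ x₀ ∈ t, η x₀ x * f i x := by
        refine setIntegral_mono_on (hf i)
          (integrable_finsetSum _ fun x₀ hx₀ => (hest x₀ (ht x₀ hx₀) i).1) hΩ.measurableSet
          fun x hx => ?_
        obtain ⟨x₀, hx₀, hx₁⟩ := mem_iUnion₂.1 (hcov (subset_closure hx))
        have hx₁ : 1 ≤ η x₀ x := hx₁
        calc f i x ≤ η x₀ x * f i x := le_mul_of_one_le_left (hf0 i x) hx₁
          _ ≤ _ := Finset.single_le_sum (f := fun x₀ => η x₀ x * f i x)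
            (fun z hz => mul_nonneg (hη0 z (ht z hz) x) (hf0 i x)) hx₀
    _ = ∑ x₀ ∈ t, ∫ x in Ω, η x₀ x * f i x :=
        integral_finsetSum _ fun x₀ hx₀ => (hest x₀ (ht x₀ hx₀) i).1
    _ ≤ ∑ x₀ ∈ t, C x₀ * B i := Finset.sum_le_sum fun x₀ hx₀ => (hest x₀ (ht x₀ hx₀) i).2
    _ = _ := by rw [Finset.sum_mul]

end Tangential

/-- The sum of the squares of the first derivatives of the field `(w₀, w₁)`. -/
noncomputable def gradSq (w₀ w₁ : Plane → ℝ) (x : Plane) : ℝ :=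
  pd 0 w₀ x ^ 2 + pd 1 w₀ x ^ 2 + (pd 0 w₁ x ^ 2 + pd 1 w₁ x ^ 2)

lemma gradSq_nonneg (w₀ w₁ : Plane → ℝ) (x : Plane) : 0 ≤ gradSq w₀ w₁ x := by
  unfold gradSq; positivity

/-- The terms of lower order in the Jacobian determinant, by Young's inequality. -/
lemma lower_order_le {e κ a : ℝ} {ei A B α β : Fin 2 → ℝ} (he0 : 0 ≤ e) (he1 : e ≤ 1)
    (hae : ∀ i, |a * ei i| ≤ κ) (hα : ∀ i, |α i| ≤ κ) (hβ : ∀ i, |β i| ≤ κ) :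
    4 * (e ^ 2 * (A 0 * β 1 - A 1 * β 0 + α 0 * B 1 - α 1 * B 0 + (α 0 * β 1 - α 1 * β 0))
      + 2 * e * (a * ei 0 * (B 1 + β 1) - a * ei 1 * (B 0 + β 0)))
      ≤ e ^ 2 * (A 0 ^ 2 + A 1 ^ 2 + (B 0 ^ 2 + B 1 ^ 2)) + 216 * κ ^ 2 := by
  have hκ : 0 ≤ κ := (abs_nonneg _).trans (hα 0)
  have hsq : ∀ {Y : ℝ}, |Y| ≤ κ → Y ^ 2 ≤ κ ^ 2 := fun h =>
    sq_le_sq' (neg_le_of_abs_le h) (le_of_abs_le h)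
  have hmul : ∀ {X Y : ℝ}, |X| ≤ κ → |Y| ≤ κ → |X * Y| ≤ κ ^ 2 := fun hX hY => by
    rw [abs_mul, sq]; exact mul_le_mul hX hY (abs_nonneg _) hκ
  -- the factor `4` or `8` on one side of the product is paid for by the bounded factor
  have y1 : ∀ X {Y : ℝ}, |Y| ≤ κ → |4 * (e ^ 2 * (X * Y))| ≤ e ^ 2 * X ^ 2 / 4 + 16 * κ ^ 2 := by
    intro X Y hY
    have h1 : (e * Y) ^ 2 ≤ κ ^ 2 := by
      refine hsq ?_
      rw [abs_mul, abs_of_nonneg he0]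
      exact (mul_le_of_le_one_left (abs_nonneg _) he1).trans hY
    rw [abs_le]
    constructor <;> nlinarith [sq_nonneg (e * X / 2 - 4 * (e * Y)),
      sq_nonneg (e * X / 2 + 4 * (e * Y))]
  have y2 : ∀ X {Y : ℝ}, |Y| ≤ κ → |8 * (e * (X * Y))| ≤ e ^ 2 * X ^ 2 / 4 + 64 * κ ^ 2 := by
    intro X Y hY
    have h1 := hsq hY
    rw [abs_le]
    constructor <;> nlinarith [sq_nonneg (e * X / 2 - 8 * Y), sq_nonneg (e * X / 2 + 8 * Y)]
  have y3 : ∀ {s Z : ℝ}, 0 ≤ s → s ≤ 1 → |Z| ≤ κ ^ 2 → |s * Z| ≤ κ ^ 2 := by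
    intro s Z hs0 hs1 hZ
    rw [abs_mul, abs_of_nonneg hs0]
    exact (mul_le_of_le_one_left (abs_nonneg _) hs1).trans hZ
  have he2 : e ^ 2 ≤ 1 := pow_le_one₀ he0 he1
  have z1 := le_of_abs_le (y1 (A 0) (hβ 1))
  have z2 := neg_le_of_abs_le (y1 (A 1) (hβ 0))
  have z3 := le_of_abs_le (y1 (B 1) (hα 0))
  have z4 := neg_le_of_abs_le (y1 (B 0) (hα 1))
  have z5 := le_of_abs_le (y2 (B 1) (hae 0))
  have z6 := neg_le_of_abs_le (y2 (B 0) (hae 1))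
  have z7 := le_of_abs_le (y3 (sq_nonneg e) he2 (hmul (hα 0) (hβ 1)))
  have z8 := neg_le_of_abs_le (y3 (sq_nonneg e) he2 (hmul (hα 1) (hβ 0)))
  have z9 := le_of_abs_le (y3 he0 he1 (hmul (hae 0) (hβ 1)))
  have z10 := neg_le_of_abs_le (y3 he0 he1 (hmul (hae 1) (hβ 0)))
  have hpos : 0 ≤ e ^ 2 * (A 0 ^ 2 + A 1 ^ 2) := by positivity
  have hpos' : 0 ≤ e ^ 2 * (B 0 ^ 2 + B 1 ^ 2) := by positivity
  have hid : 4 * (e ^ 2 * (A 0 * β 1 - A 1 * β 0 + α 0 * B 1 - α 1 * B 0 + (α 0 * β 1 - α 1 * β 0))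
      + 2 * e * (a * ei 0 * (B 1 + β 1) - a * ei 1 * (B 0 + β 0)))
      = 4 * (e ^ 2 * (A 0 * β 1)) - 4 * (e ^ 2 * (A 1 * β 0)) + 4 * (e ^ 2 * (B 1 * α 0))
        - 4 * (e ^ 2 * (B 0 * α 1)) + 8 * (e * (B 1 * (a * ei 0))) - 8 * (e * (B 0 * (a * ei 1)))
        + 4 * (e ^ 2 * (α 0 * β 1)) - 4 * (e ^ 2 * (α 1 * β 0)) + 8 * (e * (a * ei 0 * β 1))
        - 8 * (e * (a * ei 1 * β 0)) := by ring
  rw [hid]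
  rw [mul_add] at hpos hpos' ⊢
  rw [mul_add, mul_add]
  linarith

/-- The algebra behind the local estimate. Here `(p, q)` is a rotation, `e` a cut-off, `w i j` are
the derivatives of a curl-free field, and `α i`, `β i` collect the terms in which a derivative
falls on `p` or `q`. -/
lemma jacobian_pointwise {e κ : ℝ} {p q a : ℝ} {ei α β : Fin 2 → ℝ} {w : Fin 2 → Fin 2 → ℝ}
    (hpq : p ^ 2 + q ^ 2 = 1) (hcurl : w 0 1 = w 1 0) (he0 : 0 ≤ e) (he1 : e ≤ 1)
    (hae : ∀ i, |a * ei i| ≤ κ) (hα : ∀ i, |α i| ≤ κ) (hβ : ∀ i, |β i| ≤ κ) :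
    e ^ 2 * (w 0 0 ^ 2 + w 1 0 ^ 2 + (w 0 1 ^ 2 + w 1 1 ^ 2)) ≤ 2 * (w 0 0 + w 1 1) ^ 2
      - 4 * ((2 * e * ei 0 * a + e ^ 2 * (p * w 0 0 + q * w 0 1 + α 0)) *
          (-q * w 1 0 + p * w 1 1 + β 1)
        - (2 * e * ei 1 * a + e ^ 2 * (p * w 1 0 + q * w 1 1 + α 1)) *
          (-q * w 0 0 + p * w 0 1 + β 0)) + 216 * κ ^ 2 := by
  have hlow := lower_order_le (A := fun i => p * w i 0 + q * w i 1)
    (B := fun i => -q * w i 0 + p * w i 1) he0 he1 hae hα hβ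
  have hS : (p * w 0 0 + q * w 0 1) ^ 2 + (p * w 1 0 + q * w 1 1) ^ 2
      + ((-q * w 0 0 + p * w 0 1) ^ 2 + (-q * w 1 0 + p * w 1 1) ^ 2)
      = w 0 0 ^ 2 + w 1 0 ^ 2 + (w 0 1 ^ 2 + w 1 1 ^ 2) := by
    linear_combination (w 0 0 ^ 2 + w 1 0 ^ 2 + (w 0 1 ^ 2 + w 1 1 ^ 2)) * hpq
  have hJ : (p * w 0 0 + q * w 0 1) * (-q * w 1 0 + p * w 1 1)
      - (p * w 1 0 + q * w 1 1) * (-q * w 0 0 + p * w 0 1) = w 0 0 * w 1 1 - w 1 0 * w 0 1 := by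
    linear_combination (w 0 0 * w 1 1 - w 1 0 * w 0 1) * hpq
  have hdet : w 0 0 ^ 2 + w 1 0 ^ 2 + (w 0 1 ^ 2 + w 1 1 ^ 2)
      = (w 0 0 + w 1 1) ^ 2 - 2 * (w 0 0 * w 1 1 - w 1 0 * w 0 1) := by
    linear_combination (w 0 1 - w 1 0) * hcurl
  simp only [hS] at hlow
  have hdiv : e ^ 2 * (w 0 0 + w 1 1) ^ 2 ≤ (w 0 0 + w 1 1) ^ 2 :=
    mul_le_of_le_one_left (sq_nonneg _) (pow_le_one₀ he0 he1)
  have hdet' : e ^ 2 * (w 0 0 ^ 2 + w 1 0 ^ 2 + (w 0 1 ^ 2 + w 1 1 ^ 2))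
      = e ^ 2 * (w 0 0 + w 1 1) ^ 2 - 2 * (e ^ 2 * ((p * w 0 0 + q * w 0 1) *
        (-q * w 1 0 + p * w 1 1) - (p * w 1 0 + q * w 1 1) * (-q * w 0 0 + p * w 0 1))) := by
    rw [hJ, hdet]; ring
  clear hS hJ hdet hpq
  generalize p * w 0 0 + q * w 0 1 = A0 at *
  generalize p * w 1 0 + q * w 1 1 = A1 at *
  generalize -q * w 0 0 + p * w 0 1 = B0 at *
  generalize -q * w 1 0 + p * w 1 1 = B1 at *
  generalize e ^ 2 * (w 0 0 ^ 2 + w 1 0 ^ 2 + (w 0 1 ^ 2 + w 1 1 ^ 2)) = S at *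
  have hid : (2 * e * ei 0 * a + e ^ 2 * (A0 + α 0)) * (B1 + β 1)
      - (2 * e * ei 1 * a + e ^ 2 * (A1 + α 1)) * (B0 + β 0)
      = e ^ 2 * (A0 * B1 - A1 * B0)
        + (e ^ 2 * (A0 * β 1 - A1 * β 0 + α 0 * B1 - α 1 * B0 + (α 0 * β 1 - α 1 * β 0))
          + 2 * e * (a * ei 0 * (B1 + β 1) - a * ei 1 * (B0 + β 0))) := by ring
  rw [hid]
  linarith

section Gaffney

variable {Ω : Set Plane}

/-- A rotation by which the first component becomes the tangential one; `ω` is the inverse length of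
the tangent. -/
lemma exists_rotation {g : ℝ → ℝ} (hg : ContDiff ℝ 2 g) (R : Plane ≃ₗᵢ[ℝ] Plane) :
    ∃ p q ω : Plane → ℝ, ContDiff ℝ 1 p ∧ ContDiff ℝ 1 q ∧ (∀ x, p x ^ 2 + q x ^ 2 = 1) ∧
      (∀ x, |ω x| ≤ 1) ∧ (∀ x, p x = ω x * tangent R g x 0) ∧
      ∀ x, q x = ω x * tangent R g x 1 := by
  set N : Plane → ℝ := fun x => Real.sqrt (tangent R g x 0 ^ 2 + tangent R g x 1 ^ 2) with hN
  have h1 : ∀ x, 1 ≤ tangent R g x 0 ^ 2 + tangent R g x 1 ^ 2 := fun x => by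
    rw [norm_tangent_sq]; linarith [sq_nonneg (deriv g (R x 0))]
  have hN1 : ∀ x, 1 ≤ N x := fun x => Real.one_le_sqrt.2 (h1 x)
  have hN0 : ∀ x, N x ≠ 0 := fun x => (zero_lt_one.trans_le (hN1 x)).ne'
  have hNc : ContDiff ℝ 1 N := by
    refine ContDiff.sqrt (((contDiff_tangent hg R 0).pow 2).add ((contDiff_tangent hg R 1).pow 2))
      fun x => (zero_lt_one.trans_le (h1 x)).ne'
  have hinv : ContDiff ℝ 1 fun x => (N x)⁻¹ := hNc.inv hN0
  refine ⟨fun x => (N x)⁻¹ * tangent R g x 0, fun x => (N x)⁻¹ * tangent R g x 1,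
    fun x => (N x)⁻¹, hinv.mul (contDiff_tangent hg R 0), hinv.mul (contDiff_tangent hg R 1),
    fun x => ?_, fun x => ?_, fun _ => rfl, fun _ => rfl⟩
  · have : N x ^ 2 = tangent R g x 0 ^ 2 + tangent R g x 1 ^ 2 :=
      Real.sq_sqrt (by linarith [h1 x])
    have h0 := hN0 x
    field_simp
    linarith
  · rw [abs_inv, abs_of_nonneg (by linarith [hN1 x])]
    exact inv_le_one_of_one_le₀ (hN1 x)

/-- A bound for the gradient of a curl-free field by its divergence, if the tangential component
vanishes at the boundary. With the cut-off `η`, the tangential component `a` and the normal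
component `b`, the integral of the Jacobian determinant of `η² a` and `b` is zero, and the
determinant is that of the field up to terms of lower order. -/
lemma exists_gaffney (hΩ : IsOpen Ω) (hb : Bornology.IsBounded Ω) {α : ℝ≥0}
    (hα : HasC2HolderBoundary α Ω) :
    ∃ C, 0 ≤ C ∧ ∀ w₀ w₁ : Plane → ℝ, Reg1 Ω w₀ → Reg1 Ω w₁ →
      (∀ x ∈ Ω, pd 0 w₁ x = pd 1 w₀ x) → TangVanish Ω w₀ w₁ →
      ∫ x in Ω, gradSq w₀ w₁ x
        ≤ C * ∫ x in Ω, ((pd 0 w₀ x + pd 1 w₁ x) ^ 2 + (w₀ x ^ 2 + w₁ x ^ 2)) := by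
  let ι := {w : (Plane → ℝ) × (Plane → ℝ) // Reg1 Ω w.1 ∧ Reg1 Ω w.2 ∧
    (∀ x ∈ Ω, pd 0 w.2 x = pd 1 w.1 x) ∧ TangVanish Ω w.1 w.2}
  have hgS : ∀ w₀ w₁, Reg1 Ω w₀ → Reg1 Ω w₁ → BddCont Ω (gradSq w₀ w₁) := fun w₀ w₁ h₀ h₁ =>
    (((h₀.bddCont_pd hΩ 0).pow 2).add ((h₀.bddCont_pd hΩ 1).pow 2)).add
      (((h₁.bddCont_pd hΩ 0).pow 2).add ((h₁.bddCont_pd hΩ 1).pow 2))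
  refine Exists.elim (exists_global_bound (ι := ι) (f := fun w => gradSq w.1.1 w.1.2)
    (B := fun w => ∫ x in Ω, ((pd 0 w.1.1 x + pd 1 w.1.2 x) ^ 2 + (w.1.1 x ^ 2 + w.1.2 x ^ 2)))
    hΩ hb (fun w => (hgS _ _ w.2.1 w.2.2.1).integrableOn hΩ hb) (fun w => gradSq_nonneg _ _) ?_)
    fun C hC => ⟨C, hC.1, fun w₀ w₁ h₀ h₁ hcurl ht => hC.2 ⟨(w₀, w₁), h₀, h₁, hcurl, ht⟩⟩
  intro x₀ hx₀
  obtain ⟨R, g, r, hch⟩ := exists_isGraphChart hΩ hα hx₀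
  obtain ⟨p, q, ω, hp, hq, hpq, hω, hpω, hqω⟩ := exists_rotation hch.contDiff R
  have hr := hch.pos
  let bump : ContDiffBump x₀ := ⟨r / 4, r / 2, by linarith, by linarith⟩
  have hbump : ContDiff ℝ 1 (bump : Plane → ℝ) := bump.contDiff
  have rp : Reg1 Ω p := reg1_of_contDiff hb hp
  have rq : Reg1 Ω q := reg1_of_contDiff hb hq
  have re : Reg1 Ω bump := reg1_of_contDiff hb hbump
  obtain ⟨K₁, hK₁⟩ := rp.bdd_pd
  obtain ⟨K₂, hK₂⟩ := rq.bdd_pd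
  obtain ⟨K₃, hK₃⟩ := re.bdd_pd
  set K := |K₁| + |K₂| + |K₃| with hKdef
  have hK0 : 0 ≤ K := by positivity
  have hKp : ∀ i, ∀ x ∈ Ω, |pd i p x| ≤ K := fun i x hx => by
    linarith [hK₁ i x hx, le_abs_self K₁, abs_nonneg K₂, abs_nonneg K₃]
  have hKq : ∀ i, ∀ x ∈ Ω, |pd i q x| ≤ K := fun i x hx => by
    linarith [hK₂ i x hx, le_abs_self K₂, abs_nonneg K₁, abs_nonneg K₃]
  have hKe : ∀ i, ∀ x ∈ Ω, |pd i bump x| ≤ K := fun i x hx => by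
    linarith [hK₃ i x hx, le_abs_self K₃, abs_nonneg K₁, abs_nonneg K₂]
  refine ⟨fun x => bump x ^ 2, 2 + 432 * K ^ 2, by positivity, fun x => sq_nonneg _, ?_, ?_⟩
  · filter_upwards [Metric.closedBall_mem_nhds x₀ (show (0 : ℝ) < r / 4 by linarith)] with x hx
    rw [bump.one_of_mem_closedBall hx, one_pow]
  rintro ⟨⟨w₀, w₁⟩, h₀, h₁, hcurl, ht⟩
  simp only at h₀ h₁ hcurl ht ⊢
  have hint := ((re.bddCont.pow 2).mul (hgS _ _ h₀ h₁)).integrableOn hΩ hb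
  refine ⟨hint, ?_⟩
  set a : Plane → ℝ := fun x => p x * w₀ x + q x * w₁ x with ha
  set b : Plane → ℝ := fun x => -q x * w₀ x + p x * w₁ x with hbdef
  have ra : Reg1 Ω a := (rp.mul h₀ hΩ).add (rq.mul h₁ hΩ) hΩ
  have rb : Reg1 Ω b := ((rq.neg hΩ).mul h₀ hΩ).add (rp.mul h₁ hΩ) hΩ
  have rF : Reg1 Ω fun x => bump x ^ 2 * a x := (re.pow hΩ 2).mul ra hΩ
  have hF : Vanish Ω fun x => bump x ^ 2 * a x := by
    intro y hy
    by_cases hyr : y ∈ Metric.ball x₀ r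
    · have h1 := ht x₀ R g r hch y hy hyr
      refine squeeze_zero_norm (fun x => ?_) (by simpa using h1.norm)
      have : a x = ω x * (tangent R g x 0 * w₀ x + tangent R g x 1 * w₁ x) := by
        simp only [ha, hpω, hqω]; ring
      rw [this, norm_mul, norm_mul, Real.norm_of_nonneg (sq_nonneg _), ← mul_assoc]
      refine mul_le_of_le_one_left (norm_nonneg _) (mul_le_one₀ ?_ (norm_nonneg _) (hω x))
      exact pow_le_one₀ bump.nonneg bump.le_one
    · refine tendsto_const_nhds.congr' ?_
      filter_upwards [mem_nhdsWithin_of_mem_nhds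
        (Metric.isClosed_closedBall.isOpen_compl.mem_nhds (x := y)
          (show y ∈ (Metric.closedBall x₀ (r / 2))ᶜ by
            simp only [Metric.mem_ball, not_lt] at hyr
            simp only [mem_compl_iff, Metric.mem_closedBall, not_le]
            linarith))] with x hx
      have hx' : r / 2 ≤ dist x x₀ := by
        simp only [mem_compl_iff, Metric.mem_closedBall, not_le] at hx
        exact hx.le
      simp [bump.zero_of_le_dist hx']
  have hJ := setIntegral_jacobian_eq_zero hΩ hb rF hF rb
  have bJ : BddCont Ω fun x => pd 0 (fun x => bump x ^ 2 * a x) x * pd 1 b x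
      - pd 1 (fun x => bump x ^ 2 * a x) x * pd 0 b x :=
    ((rF.bddCont_pd hΩ 0).mul (rb.bddCont_pd hΩ 1)).sub
      ((rF.bddCont_pd hΩ 1).mul (rb.bddCont_pd hΩ 0))
  have bD : BddCont Ω fun x => (pd 0 w₀ x + pd 1 w₁ x) ^ 2 + (w₀ x ^ 2 + w₁ x ^ 2) :=
    (((h₀.bddCont_pd hΩ 0).add (h₁.bddCont_pd hΩ 1)).pow 2).add
      ((h₀.bddCont.pow 2).add (h₁.bddCont.pow 2))
  have hpt : ∀ x ∈ Ω, bump x ^ 2 * gradSq w₀ w₁ x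
      ≤ (2 + 432 * K ^ 2) * ((pd 0 w₀ x + pd 1 w₁ x) ^ 2 + (w₀ x ^ 2 + w₁ x ^ 2))
        - 4 * (pd 0 (fun x => bump x ^ 2 * a x) x * pd 1 b x
          - pd 1 (fun x => bump x ^ 2 * a x) x * pd 0 b x) := by
    intro x hx
    have dp := rp.differentiableAt hΩ hx
    have dq := rq.differentiableAt hΩ hx
    have dnq := (rq.neg hΩ).differentiableAt hΩ hx
    have d0 := h₀.differentiableAt hΩ hx
    have d1 := h₁.differentiableAt hΩ hx
    have de := re.differentiableAt hΩ hx
    have hda : ∀ i, pd i a x = p x * pd i w₀ x + q x * pd i w₁ x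
        + (pd i p x * w₀ x + pd i q x * w₁ x) := fun i => by
      rw [ha, pd_add i ((rp.mul h₀ hΩ).differentiableAt hΩ hx)
        ((rq.mul h₁ hΩ).differentiableAt hΩ hx), pd_mul i dp d0, pd_mul i dq d1]; ring
    have hdb : ∀ i, pd i b x = -q x * pd i w₀ x + p x * pd i w₁ x
        + (-pd i q x * w₀ x + pd i p x * w₁ x) := fun i => by
      rw [hbdef, pd_add i (((rq.neg hΩ).mul h₀ hΩ).differentiableAt hΩ hx)
        ((rp.mul h₁ hΩ).differentiableAt hΩ hx), pd_mul i dnq d0, pd_mul i dp d1,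
        pd_neg]
      ring
    have hdF : ∀ i, pd i (fun x => bump x ^ 2 * a x) x
        = 2 * bump x * pd i bump x * a x + bump x ^ 2 * pd i a x := fun i => by
      rw [pd_mul i ((re.pow hΩ 2).differentiableAt hΩ hx) (ra.differentiableAt hΩ hx)]
      have : pd i (fun y => bump y ^ 2) x = 2 * bump x * pd i bump x := by
        have := pd_comp i (by simpa using hasDerivAt_pow 2 (bump x)) de
        simpa using this
      rw [this]
    have hp1 : |p x| ≤ 1 := abs_le_one_iff_mul_self_le_one.2 (by nlinarith [hpq x, sq_nonneg (q x)])
    have hq1 : |q x| ≤ 1 := abs_le_one_iff_mul_self_le_one.2 (by nlinarith [hpq x, sq_nonneg (p x)])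
    set W := |w₀ x| + |w₁ x| with hW
    have hW0 : 0 ≤ W := by positivity
    have hcomb : ∀ {L s t : ℝ}, |s| ≤ L → |t| ≤ L → |s * w₀ x + t * w₁ x| ≤ L * W := by
      intro L s t hs ht
      refine (abs_add_le _ _).trans ?_
      rw [abs_mul, abs_mul, hW, mul_add]
      exact add_le_add (mul_le_mul_of_nonneg_right hs (abs_nonneg _))
        (mul_le_mul_of_nonneg_right ht (abs_nonneg _))
    have key := jacobian_pointwise (e := bump x) (κ := K * W) (p := p x) (q := q x)
      (a := a x) (ei := fun i => pd i bump x) (α := fun i => pd i p x * w₀ x + pd i q x * w₁ x)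
      (β := fun i => -pd i q x * w₀ x + pd i p x * w₁ x)
      (w := fun i j => pd i (if j = 0 then w₀ else w₁) x) (hpq x) (by simpa using hcurl x hx)
      bump.nonneg bump.le_one (fun i => by
        rw [abs_mul, mul_comm K]
        exact mul_le_mul (by simpa using hcomb hp1 hq1) (hKe i x hx) (abs_nonneg _) hW0)
      (fun i => hcomb (hKp i x hx) (hKq i x hx))
      (fun i => hcomb (by rw [abs_neg]; exact hKq i x hx) (hKp i x hx))
    simp only [if_true, one_ne_zero, if_false] at key
    rw [hdF 0, hdF 1, hda 0, hda 1, hdb 0, hdb 1, gradSq]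
    have hWsq : W ^ 2 ≤ 2 * (w₀ x ^ 2 + w₁ x ^ 2) := by
      rw [hW]
      nlinarith [sq_nonneg (|w₀ x| - |w₁ x|), sq_abs (w₀ x), sq_abs (w₁ x)]
    have hKW : 216 * (K * W) ^ 2 ≤ 432 * K ^ 2 * (w₀ x ^ 2 + w₁ x ^ 2) := by
      nlinarith [mul_le_mul_of_nonneg_left hWsq (sq_nonneg K)]
    have e1 : 0 ≤ 432 * K ^ 2 * (pd 0 w₀ x + pd 1 w₁ x) ^ 2 := by positivity
    have e2 : 0 ≤ w₀ x ^ 2 + w₁ x ^ 2 := by positivity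
    linarith
  have hmono := setIntegral_mono_on hint
    (((bD.integrableOn hΩ hb).const_mul (2 + 432 * K ^ 2)).sub
      ((bJ.integrableOn hΩ hb).const_mul 4)) hΩ.measurableSet hpt
  simp only [Pi.sub_apply] at hmono
  rw [integral_sub ((bD.integrableOn hΩ hb).const_mul (2 + 432 * K ^ 2))
      ((bJ.integrableOn hΩ hb).const_mul 4), integral_const_mul, integral_const_mul, hJ] at hmono
  linarith

end Gaffney

/-! ### The inequalities of Ladyzhenskaya and Poincaré -/

/-- A function on the plane that is bounded, at each point, by the integrals of `D` along the lines
in two independent directions has its `L²` norm bounded by the `L¹` norm of `D`. -/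
lemma exists_lintegral_sq_le (L : (ℝ × ℝ) ≃L[ℝ] Plane) : ∃ c : ℝ≥0, ∀ D h : Plane → ℝ≥0∞,
    Measurable D → (∀ x, h x ≤ ∫⁻ s : ℝ, D (x + s • L (1, 0))) →
      (∀ x, h x ≤ ∫⁻ s : ℝ, D (x + s • L (0, 1))) → ∫⁻ x, h x ^ 2 ≤ c * (∫⁻ x, D x) ^ 2 := by
  have hmap : (volume.map L : Measure Plane).IsAddHaarMeasure :=
    L.toContinuousAddEquiv.isAddHaarMeasure_map volume
  set c := Measure.addHaarScalarFactor (volume.map L : Measure Plane) volume with hc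
  have hc0 : c ≠ 0 := (Measure.addHaarScalarFactor_pos_of_isAddHaarMeasure _ _).ne'
  have hvol : (volume.map L : Measure Plane) = c • volume :=
    Measure.isAddLeftInvariant_eq_smul _ _
  have hint : ∀ F : Plane → ℝ≥0∞, ∫⁻ p : ℝ × ℝ, F (L p) = c * ∫⁻ x, F x := fun F => by
    have h1 := lintegral_map_equiv (μ := volume) F L.toHomeomorph.toMeasurableEquiv
    have h2 : (volume.map L.toHomeomorph.toMeasurableEquiv : Measure Plane) = volume.map L := rfl
    rw [h2, hvol, lintegral_smul_measure] at h1
    exact h1.symm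
  refine ⟨c, fun D h hD h1 h2 => ?_⟩
  set P : ℝ → ℝ≥0∞ := fun b => ∫⁻ s : ℝ, D (L (s, b)) with hP
  set Q : ℝ → ℝ≥0∞ := fun a => ∫⁻ s : ℝ, D (L (a, s)) with hQ
  have hDL : Measurable fun p : ℝ × ℝ => D (L p) := hD.comp L.continuous.measurable
  have hPm : Measurable P := hDL.lintegral_prod_left'
  have hQm : Measurable Q := hDL.lintegral_prod_right'
  have hb1 : ∀ p : ℝ × ℝ, h (L p) ≤ P p.2 := fun p => by
    refine (h1 _).trans_eq ?_
    have : ∀ s : ℝ, L p + s • L (1, 0) = L (s + p.1, p.2) := fun s => by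
      rw [← map_smul, ← map_add]; congr 1; ext <;> simp [add_comm]
    simp only [this]
    exact lintegral_add_right_eq_self (fun s => D (L (s, p.2))) p.1
  have hb2 : ∀ p : ℝ × ℝ, h (L p) ≤ Q p.1 := fun p => by
    refine (h2 _).trans_eq ?_
    have : ∀ s : ℝ, L p + s • L (0, 1) = L (p.1, s + p.2) := fun s => by
      rw [← map_smul, ← map_add]; congr 1; ext <;> simp [add_comm]
    simp only [this]
    exact lintegral_add_right_eq_self (fun s => D (L (p.1, s))) p.2
  have hPint : ∫⁻ b, P b = c * ∫⁻ x, D x := by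
    rw [← hint, Measure.volume_eq_prod, lintegral_prod_symm _ hDL.aemeasurable]
  have hQint : ∫⁻ a, Q a = c * ∫⁻ x, D x := by
    rw [← hint, Measure.volume_eq_prod, lintegral_prod _ hDL.aemeasurable]
  have hkey : (c : ℝ≥0∞) * ∫⁻ x, h x ^ 2 ≤ c * (c * (∫⁻ x, D x) ^ 2) := by
    rw [← hint fun x => h x ^ 2]
    calc ∫⁻ p : ℝ × ℝ, h (L p) ^ 2 ≤ ∫⁻ p : ℝ × ℝ, Q p.1 * P p.2 :=
          lintegral_mono fun p => by rw [sq]; exact mul_le_mul' (hb2 p) (hb1 p)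
      _ = (∫⁻ a, Q a) * ∫⁻ b, P b := by
          rw [Measure.volume_eq_prod, lintegral_prod_mul hQm.aemeasurable hPm.aemeasurable]
      _ = _ := by rw [hPint, hQint]; ring
  exact (ENNReal.mul_le_mul_iff_right (by simpa using hc0) ENNReal.coe_ne_top).1 hkey

/-- The direction `R⁻¹(δ, 1)`, which points into the domain if `δ` is small. -/
noncomputable def inward (R : Plane ≃ₗᵢ[ℝ] Plane) (δ : ℝ) : Plane :=
  δ • R.symm (EuclideanSpace.single 0 1) + R.symm (EuclideanSpace.single 1 1)

lemma apply_inward (R : Plane ≃ₗᵢ[ℝ] Plane) (δ : ℝ) :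
    R (inward R δ) 0 = δ ∧ R (inward R δ) 1 = 1 := by
  simp [inward]

lemma norm_inward_sq (R : Plane ≃ₗᵢ[ℝ] Plane) (δ : ℝ) : ‖inward R δ‖ ^ 2 = δ ^ 2 + 1 := by
  rw [← R.norm_map, EuclideanSpace.norm_sq_eq, Fin.sum_univ_two, (apply_inward R δ).1,
    (apply_inward R δ).2]
  simp

/-- The coordinates with respect to the two directions `inward R (±ε)`. -/
lemma exists_inward_equiv (R : Plane ≃ₗᵢ[ℝ] Plane) {ε : ℝ} (hε : 0 < ε) :
    ∃ L : (ℝ × ℝ) ≃L[ℝ] Plane, L (1, 0) = inward R ε ∧ L (0, 1) = inward R (-ε) := by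
  let f : (ℝ × ℝ) →ₗ[ℝ] Plane := (LinearMap.toSpanSingleton ℝ Plane (inward R ε)).coprod
    (LinearMap.toSpanSingleton ℝ Plane (inward R (-ε)))
  have hf : ∀ p : ℝ × ℝ, f p = p.1 • inward R ε + p.2 • inward R (-ε) := fun p => by simp [f]
  have hinj : Function.Injective f := by
    rw [injective_iff_map_eq_zero]
    intro p hp
    rw [hf] at hp
    have h1 := congrArg (fun z => R z 0) hp
    have h2 := congrArg (fun z => R z 1) hp
    simp only [map_add, map_smul, map_zero, PiLp.add_apply, PiLp.smul_apply, smul_eq_mul,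
      PiLp.zero_apply, (apply_inward R _).1, (apply_inward R _).2] at h1 h2
    have h3 : p.1 - p.2 = 0 := by
      have : ε * (p.1 - p.2) = 0 := by linarith
      exact (mul_eq_zero.1 this).resolve_left hε.ne'
    ext <;> simp <;> linarith
  let L := LinearEquiv.ofInjectiveOfFinrankEq f hinj (by simp)
  refine ⟨L.toContinuousLinearEquiv, ?_, ?_⟩
  · change f (1, 0) = _
    rw [hf]; simp
  · change f (0, 1) = _
    rw [hf]; simp

section Ladyzhenskaya

variable {Ω : Set Plane}

/-- Near a boundary point, the segments in the directions of a narrow cone about the inward one stay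
in the domain. -/
lemma IsGraphChart.exists_cone {x₀ : Plane} {R : Plane ≃ₗᵢ[ℝ] Plane} {g : ℝ → ℝ} {r : ℝ}
    (hc : IsGraphChart Ω x₀ R g r) : ∃ ε, 0 < ε ∧ ε ≤ 1 ∧ ∀ δ, |δ| ≤ ε →
      ∀ x ∈ Ω, x ∈ Metric.ball x₀ (r / 8) → ∀ s ∈ Icc 0 (r / 2), x + s • inward R δ ∈ Ω := by
  have hr := hc.pos
  obtain ⟨M, hM⟩ := (isCompact_Icc (a := R x₀ 0 - r) (b := R x₀ 0 + r)).exists_bound_of_continuousOn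
    (hc.contDiff.continuous_deriv (by norm_num)).continuousOn
  have hM0 : 0 ≤ |M| := abs_nonneg M
  refine ⟨(|M| + 1)⁻¹, by positivity, inv_le_one_of_one_le₀ (by linarith), ?_⟩
  intro δ hδ x hx hxr s hs
  have hδ1 : |δ| ≤ 1 := hδ.trans (inv_le_one_of_one_le₀ (by linarith))
  have hξ : ‖inward R δ‖ ≤ 3 / 2 := by
    have := norm_inward_sq R δ
    nlinarith [norm_nonneg (inward R δ), sq_abs δ, abs_nonneg δ]
  have hball : ∀ y ∈ Metric.ball x₀ r, R y 0 ∈ Icc (R x₀ 0 - r) (R x₀ 0 + r) := by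
    intro y hy
    have h1 : |(R (y - x₀)) 0| ≤ ‖R (y - x₀)‖ := by simpa using PiLp.norm_apply_le (R (y - x₀)) 0
    rw [R.norm_map, ← dist_eq_norm] at h1
    have h2 := h1.trans (Metric.mem_ball.1 hy).le
    rw [map_sub, PiLp.sub_apply, abs_le] at h2
    exact ⟨by linarith [h2.1], by linarith [h2.2]⟩
  have hxr' : x ∈ Metric.ball x₀ r := Metric.ball_subset_ball (by linarith) hxr
  have hz : x + s • inward R δ ∈ Metric.ball x₀ r := by
    rw [Metric.mem_ball, dist_eq_norm] at hxr ⊢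
    have h1 : ‖s • inward R δ‖ ≤ r / 2 * (3 / 2) := by
      rw [norm_smul, Real.norm_of_nonneg hs.1]
      exact mul_le_mul hs.2 hξ (norm_nonneg _) (by positivity)
    calc ‖x + s • inward R δ - x₀‖ = ‖(x - x₀) + s • inward R δ‖ := by congr 1; abel
      _ ≤ _ := norm_add_le _ _
      _ < r := by linarith
  rw [hc.mem_iff _ hz]
  have h1 := (hc.mem_iff x hxr').1 hx
  have e0 : R (x + s • inward R δ) 0 = R x 0 + s * δ := by
    simp [(apply_inward R δ).1]
  have e1 : R (x + s • inward R δ) 1 = R x 1 + s := by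
    simp [(apply_inward R δ).2]
  have hlip := (convex_Icc (R x₀ 0 - r) (R x₀ 0 + r)).norm_image_sub_le_of_norm_deriv_le
    (f := g) (C := |M|) (fun y _ => (hc.contDiff.differentiable (by norm_num)).differentiableAt)
    (fun y hy => (hM y hy).trans (le_abs_self M)) (hball x hxr') (hball _ hz)
  rw [e0, add_sub_cancel_left, Real.norm_eq_abs, Real.norm_eq_abs, abs_mul,
    abs_of_nonneg hs.1] at hlip
  rw [e0, e1]
  have h2 : |M| * |δ| ≤ 1 := by
    calc |M| * |δ| ≤ |M| * (|M| + 1)⁻¹ := mul_le_mul_of_nonneg_left hδ hM0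
      _ ≤ 1 := by rw [← div_eq_mul_inv, div_le_one (by positivity)]; linarith
  have h3 : |M| * (s * |δ|) ≤ s := by nlinarith [hs.1]
  linarith [(le_abs_self _).trans hlip]

/-- A function that vanishes off a small ball is bounded by the integral of its derivative along a
line; the part of the line that matters stays in `Ω`. -/
lemma enorm_indicator_le_lintegral (hΩ : IsOpen Ω) {x₀ ξ : Plane} {r : ℝ}
    (hξ : 1 ≤ ‖ξ‖) (hξ' : ‖ξ‖ ≤ 2)
    (hcone : ∀ x ∈ Ω, x ∈ Metric.ball x₀ (r / 8) → ∀ s ∈ Icc 0 (r / 2), x + s • ξ ∈ Ω)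
    {h : Plane → ℝ} (hh : ContDiffOn ℝ 1 h Ω) (h0 : ∀ x ∉ Metric.ball x₀ (r / 8), h x = 0)
    (x : Plane) : ‖Ω.indicator h x‖ₑ
      ≤ ∫⁻ s : ℝ, Ω.indicator (fun y => ‖2 * (|pd 0 h y| + |pd 1 h y|)‖ₑ) (x + s • ξ) := by
  by_cases hx : x ∈ Ω
  swap
  · simp [hx]
  by_cases hxr : x ∈ Metric.ball x₀ (r / 8)
  swap
  · rw [indicator_of_mem hx, h0 x hxr, enorm_zero]
    exact bot_le
  have hr : 0 < r := by
    have := (dist_nonneg).trans_lt (Metric.mem_ball.1 hxr)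
    linarith
  rw [indicator_of_mem hx]
  have hline : ∀ s ∈ Icc 0 (r / 2), x + s • ξ ∈ Ω := hcone x hx hxr
  have hder : ∀ s ∈ uIcc 0 (r / 2), HasDerivAt (fun s => h (x + s • ξ))
      (∑ i, ξ i * pd i h (x + s • ξ)) s := by
    intro s hs
    rw [uIcc_of_le (by positivity)] at hs
    have h1 : HasDerivAt (fun s : ℝ => x + s • ξ) ξ s := by
      simpa using ((hasDerivAt_id s).smul_const ξ).const_add x
    have h2 := (differentiableAt_of_contDiffOn hΩ hh (hline s hs)).hasFDerivAt.comp_hasDerivAt s h1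
    rw [fderiv_apply_eq] at h2
    exact h2
  have hcont : ContinuousOn (fun s : ℝ => ∑ i, ξ i * pd i h (x + s • ξ)) (uIcc 0 (r / 2)) := by
    rw [uIcc_of_le (by positivity)]
    refine continuousOn_finsetSum _ fun i _ => continuousOn_const.mul ?_
    exact (continuousOn_pd hΩ hh i).comp (by fun_prop) hline
  have hftc := intervalIntegral.integral_eq_sub_of_hasDerivAt hder hcont.intervalIntegrable
  have hend : h (x + (r / 2) • ξ) = 0 := by
    refine h0 _ fun hmem => ?_
    rw [Metric.mem_ball, dist_eq_norm] at hmem hxr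
    have h1 : ‖(r / 2) • ξ‖ ≤ ‖x + (r / 2) • ξ - x₀‖ + ‖x - x₀‖ := by
      refine le_trans (le_of_eq ?_) (norm_sub_le _ _)
      congr 1; abel
    rw [norm_smul, Real.norm_of_nonneg (by positivity)] at h1
    nlinarith
  simp only [hend, zero_smul, add_zero, zero_sub] at hftc
  rw [intervalIntegral.integral_of_le (by positivity)] at hftc
  have h1 : h x = -∫ s in Ioc 0 (r / 2), ∑ i, ξ i * pd i h (x + s • ξ) := by linarith
  rw [h1, enorm_neg]
  refine (enorm_integral_le_lintegral_enorm _).trans ?_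
  refine le_trans ?_ (setLIntegral_le_lintegral (Ioc 0 (r / 2)) _)
  refine setLIntegral_mono' measurableSet_Ioc fun s hs => ?_
  rw [indicator_of_mem (hline s ⟨hs.1.le, hs.2⟩)]
  rw [enorm_le_iff_norm_le, Fin.sum_univ_two, Real.norm_eq_abs]
  refine le_trans ?_ (le_abs_self _)
  have hi : ∀ i, |ξ i| ≤ 2 := fun i => by
    have : |ξ i| ≤ ‖ξ‖ := by simpa using PiLp.norm_apply_le ξ i
    linarith
  refine (abs_add_le _ _).trans ?_
  rw [abs_mul, abs_mul, mul_add]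
  exact add_le_add (mul_le_mul_of_nonneg_right (hi 0) (abs_nonneg _))
    (mul_le_mul_of_nonneg_right (hi 1) (abs_nonneg _))

/-- The Cauchy-Schwarz inequality. -/
lemma sq_integral_mul_le {X : Type*} [MeasurableSpace X] {κ : Measure X} {f g : X → ℝ}
    (hf : Integrable (fun x => f x ^ 2) κ) (hg : Integrable (fun x => g x ^ 2) κ)
    (hfg : Integrable (fun x => f x * g x) κ) :
    (∫ x, f x * g x ∂κ) ^ 2 ≤ (∫ x, f x ^ 2 ∂κ) * ∫ x, g x ^ 2 ∂κ := by
  have h : ∀ t : ℝ, 0 ≤ (∫ x, f x ^ 2 ∂κ) * (t * t) + (2 * ∫ x, f x * g x ∂κ) * t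
      + ∫ x, g x ^ 2 ∂κ := fun t => by
    have h1 : 0 ≤ ∫ x, (f x ^ 2 * (t * t) + f x * g x * (2 * t) + g x ^ 2) ∂κ :=
      integral_nonneg fun x => by
        have : f x ^ 2 * (t * t) + f x * g x * (2 * t) + g x ^ 2 = (f x * t + g x) ^ 2 := by ring
        simp only [this, Pi.zero_apply]; positivity
    have h2 : Integrable (fun x => f x ^ 2 * (t * t) + f x * g x * (2 * t)) κ :=
      (hf.mul_const _).add (hfg.mul_const _)
    rw [integral_add h2 hg,
      integral_add (hf.mul_const _) (hfg.mul_const _), integral_mul_const,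
      integral_mul_const] at h1
    linarith
  have := discrim_le_zero h
  rw [discrim] at this
  linarith

/-- The local form of the inequality, for the square `h` of a function times a cut-off. -/
lemma IsGraphChart.exists_sq_le (hΩ : IsOpen Ω) (hb : Bornology.IsBounded Ω)
    {x₀ : Plane} {R : Plane ≃ₗᵢ[ℝ] Plane} {g : ℝ → ℝ} {r : ℝ} (hc : IsGraphChart Ω x₀ R g r) :
    ∃ C, 0 ≤ C ∧ ∀ h : Plane → ℝ, Reg1 Ω h → (∀ x ∉ Metric.ball x₀ (r / 8), h x = 0) →
      ∫ x in Ω, h x ^ 2 ≤ C * (∫ x in Ω, (|pd 0 h x| + |pd 1 h x|)) ^ 2 := by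
  obtain ⟨ε, hε, hε1, hcone⟩ := hc.exists_cone
  obtain ⟨L, hL1, hL2⟩ := exists_inward_equiv R hε
  obtain ⟨c, hc'⟩ := exists_lintegral_sq_le L
  have hnorm : ∀ δ, |δ| ≤ ε → 1 ≤ ‖inward R δ‖ ∧ ‖inward R δ‖ ≤ 2 := fun δ hδ => by
    have h1 := norm_inward_sq R δ
    have h2 : δ ^ 2 ≤ 1 := by rw [← sq_abs]; exact pow_le_one₀ (abs_nonneg _) (hδ.trans hε1)
    exact ⟨by nlinarith [norm_nonneg (inward R δ), sq_nonneg δ],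
      by nlinarith [norm_nonneg (inward R δ)]⟩
  have a1 : |ε| ≤ ε := (abs_of_pos hε).le
  have a2 : |-ε| ≤ ε := by rw [abs_neg]; exact a1
  refine ⟨c * 4, by positivity, fun h hh h0 => ?_⟩
  have hG : BddCont Ω fun y => |pd 0 h y| + |pd 1 h y| := by
    have habs : ∀ i, BddCont Ω fun y => |pd i h y| := fun i =>
      ⟨((hh.bddCont_pd hΩ i).continuousOn).abs, by
        obtain ⟨K, hK⟩ := (hh.bddCont_pd hΩ i).bdd
        exact ⟨K, fun x hx => by rw [abs_abs]; exact hK x hx⟩⟩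
    exact (habs 0).add (habs 1)
  have hG2 := (bddCont_const 2).mul hG
  have hD : Measurable (Ω.indicator fun y => ‖2 * (|pd 0 h y| + |pd 1 h y|)‖ₑ) := by
    have h1 : Measurable (Ω.indicator fun y => 2 * (|pd 0 h y| + |pd 1 h y|)) := by
      classical
      rw [← piecewise_eq_indicator]
      exact hG2.continuousOn.measurable_piecewise continuousOn_const hΩ.measurableSet
    have h2 : (Ω.indicator fun y => ‖2 * (|pd 0 h y| + |pd 1 h y|)‖ₑ)
        = fun x => ‖Ω.indicator (fun y => 2 * (|pd 0 h y| + |pd 1 h y|)) x‖ₑ := by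
      ext x; by_cases hx : x ∈ Ω <;> simp [hx]
    rw [h2]
    exact h1.enorm
  have key := hc' _ (fun x => ‖Ω.indicator h x‖ₑ) hD
    (fun x => by
      rw [hL1]
      exact enorm_indicator_le_lintegral hΩ (hnorm ε a1).1 (hnorm ε a1).2 (hcone ε a1)
        hh.contDiffOn h0 x)
    (fun x => by
      rw [hL2]
      exact enorm_indicator_le_lintegral hΩ (hnorm _ a2).1 (hnorm _ a2).2 (hcone _ a2)
        hh.contDiffOn h0 x)
  have e1 : ∫⁻ x, ‖Ω.indicator h x‖ₑ ^ 2 = ENNReal.ofReal (∫ x in Ω, h x ^ 2) := by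
    rw [ofReal_integral_eq_lintegral_ofReal ((hh.bddCont.pow 2).integrableOn hΩ hb)
      (ae_of_all _ fun x => sq_nonneg _), ← lintegral_indicator hΩ.measurableSet]
    refine lintegral_congr fun x => ?_
    by_cases hx : x ∈ Ω
    · simp only [hx, indicator_of_mem]
      rw [← enorm_pow, Real.enorm_of_nonneg (sq_nonneg _)]
    · simp [hx]
  have e2 : ∫⁻ x, Ω.indicator (fun y => ‖2 * (|pd 0 h y| + |pd 1 h y|)‖ₑ) x
      = ENNReal.ofReal (∫ x in Ω, 2 * (|pd 0 h x| + |pd 1 h x|)) := by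
    rw [ofReal_integral_eq_lintegral_ofReal (hG2.integrableOn hΩ hb)
      (ae_of_all _ fun x => by positivity), lintegral_indicator hΩ.measurableSet]
    exact lintegral_congr fun x => Real.enorm_of_nonneg (by positivity)
  rw [e1, e2, integral_const_mul, ← ENNReal.ofReal_coe_nnreal,
    ← ENNReal.ofReal_pow (mul_nonneg zero_le_two (integral_nonneg fun x => by positivity)),
    ← ENNReal.ofReal_mul c.coe_nonneg,
    ENNReal.ofReal_le_ofReal_iff (by positivity)] at key
  linarith [key]

/-- Ladyzhenskaya's inequality, for functions with arbitrary boundary values. -/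
lemma exists_ladyzhenskaya (hΩ : IsOpen Ω) (hb : Bornology.IsBounded Ω) {α : ℝ≥0}
    (hα : HasC2HolderBoundary α Ω) : ∃ C, 0 ≤ C ∧ ∀ f : Plane → ℝ, Reg1 Ω f →
      ∫ x in Ω, f x ^ 4 ≤ C * ((∫ x in Ω, f x ^ 2) *
        ((∫ x in Ω, f x ^ 2) + ∫ x in Ω, (pd 0 f x ^ 2 + pd 1 f x ^ 2))) := by
  let ι := {f : Plane → ℝ // Reg1 Ω f}
  refine Exists.elim (exists_global_bound (ι := ι) (f := fun f x => f.1 x ^ 4)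
    (B := fun f => (∫ x in Ω, f.1 x ^ 2) * ((∫ x in Ω, f.1 x ^ 2)
      + ∫ x in Ω, (pd 0 f.1 x ^ 2 + pd 1 f.1 x ^ 2)))
    hΩ hb (fun f => (f.2.bddCont.pow 4).integrableOn hΩ hb)
    (fun f x => by positivity) ?_)
    fun C hC => ⟨C, hC.1, fun f hf => hC.2 ⟨f, hf⟩⟩
  intro x₀ hx₀
  obtain ⟨R, g, r, hch⟩ := exists_isGraphChart hΩ hα hx₀
  have hr := hch.pos
  obtain ⟨C, hC0, hC⟩ := hch.exists_sq_le hΩ hb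
  let bump : ContDiffBump x₀ := ⟨r / 16, r / 8, by linarith, by linarith⟩
  have hbump : ContDiff ℝ 1 (bump : Plane → ℝ) := bump.contDiff
  have re : Reg1 Ω bump := reg1_of_contDiff hb hbump
  obtain ⟨K, hK⟩ := re.bdd_pd
  refine ⟨fun x => bump x ^ 2, C * (8 * K ^ 2 + 16), by positivity, fun x => sq_nonneg _, ?_, ?_⟩
  · filter_upwards [Metric.closedBall_mem_nhds x₀ (show (0 : ℝ) < r / 16 by linarith)] with x hx
    rw [bump.one_of_mem_closedBall hx, one_pow]
  rintro ⟨f, hf⟩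
  simp only
  refine ⟨((re.bddCont.pow 2).mul (hf.bddCont.pow 4)).integrableOn hΩ hb, ?_⟩
  have hh : Reg1 Ω fun x => bump x * f x ^ 2 := re.mul (hf.pow hΩ 2) hΩ
  have h1 := hC (fun x => bump x * f x ^ 2) hh fun x hx => by
    rw [bump.zero_of_le_dist (by simpa using hx), zero_mul]
  have e1 : ∫ x in Ω, (bump x * f x ^ 2) ^ 2 = ∫ x in Ω, bump x ^ 2 * f x ^ 4 := by
    congr 1; ext x; ring
  rw [e1] at h1
  refine h1.trans ?_
  rw [mul_assoc]
  refine mul_le_mul_of_nonneg_left ?_ hC0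
  have babs : ∀ {u : Plane → ℝ}, BddCont Ω u → BddCont Ω fun x => |u x| := fun hu =>
    ⟨hu.continuousOn.abs, let ⟨K, hK⟩ := hu.bdd; ⟨K, fun x hx => by rw [abs_abs]; exact hK x hx⟩⟩
  set G : Plane → ℝ := fun x => |pd 0 f x| + |pd 1 f x| with hGdef
  have bG : BddCont Ω G := (babs (hf.bddCont_pd hΩ 0)).add (babs (hf.bddCont_pd hΩ 1))
  have bf := babs hf.bddCont
  have bgr : BddCont Ω fun x => pd 0 f x ^ 2 + pd 1 f x ^ 2 :=
    ((hf.bddCont_pd hΩ 0).pow 2).add ((hf.bddCont_pd hΩ 1).pow 2)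
  set a := ∫ x in Ω, f x ^ 2 with ha
  set b := ∫ x in Ω, (pd 0 f x ^ 2 + pd 1 f x ^ 2) with hbdef
  set m := ∫ x in Ω, |f x| * G x with hm
  have ha0 : 0 ≤ a := integral_nonneg fun x => sq_nonneg _
  have hb0 : 0 ≤ b := integral_nonneg fun x => by positivity
  have hm0 : 0 ≤ m := integral_nonneg fun x => by positivity
  have hmsq : m ^ 2 ≤ a * (2 * b) := by
    refine (sq_integral_mul_le ((bf.pow 2).integrableOn hΩ hb) ((bG.pow 2).integrableOn hΩ hb)
      ((bf.mul bG).integrableOn hΩ hb)).trans ?_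
    simp only [sq_abs]
    refine mul_le_mul_of_nonneg_left ?_ ha0
    rw [hbdef, ← integral_const_mul]
    refine setIntegral_mono_on ((bG.pow 2).integrableOn hΩ hb)
      (((bddCont_const 2).mul bgr).integrableOn hΩ hb) hΩ.measurableSet fun x _ => ?_
    simp only [hGdef]
    nlinarith [sq_nonneg (|pd 0 f x| - |pd 1 f x|), sq_abs (pd 0 f x), sq_abs (pd 1 f x)]
  have hI : ∫ x in Ω, (|pd 0 (fun x => bump x * f x ^ 2) x| + |pd 1 (fun x => bump x * f x ^ 2) x|)
      ≤ 2 * |K| * a + 2 * m := by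
    rw [ha, hm, ← integral_const_mul, ← integral_const_mul, ← integral_add
      (((bddCont_const _).mul (hf.bddCont.pow 2)).integrableOn hΩ hb)
      (((bddCont_const 2).mul (bf.mul bG)).integrableOn hΩ hb)]
    refine setIntegral_mono_on (((babs (hh.bddCont_pd hΩ 0)).add
      (babs (hh.bddCont_pd hΩ 1))).integrableOn hΩ hb)
      ((((bddCont_const _).mul (hf.bddCont.pow 2)).add
      ((bddCont_const 2).mul (bf.mul bG))).integrableOn hΩ hb) hΩ.measurableSet fun x hx => ?_
    have hpd : ∀ i, |pd i (fun x => bump x * f x ^ 2) x| ≤ |K| * f x ^ 2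
        + 2 * (|f x| * |pd i f x|) := fun i => by
      rw [pd_mul i (re.differentiableAt hΩ hx) ((hf.pow hΩ 2).differentiableAt hΩ hx),
        pd_sq i (hf.differentiableAt hΩ hx)]
      refine (abs_add_le _ _).trans (add_le_add ?_ ?_)
      · rw [abs_mul, abs_of_nonneg (sq_nonneg (f x))]
        exact mul_le_mul_of_nonneg_right ((hK i x hx).trans (le_abs_self K)) (sq_nonneg _)
      · rw [abs_mul, abs_of_nonneg bump.nonneg]
        refine (mul_le_of_le_one_left (abs_nonneg _) bump.le_one).trans (le_of_eq ?_)
        rw [abs_mul, abs_mul, abs_two, mul_assoc]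
    have := hpd 0
    have := hpd 1
    simp only [hGdef]
    linarith
  have hI0 : 0 ≤ ∫ x in Ω, (|pd 0 (fun x => bump x * f x ^ 2) x|
      + |pd 1 (fun x => bump x * f x ^ 2) x|) := integral_nonneg fun x => by positivity
  refine (pow_le_pow_left₀ hI0 hI 2).trans ?_
  have hab := mul_nonneg ha0 hb0
  have hKab : 0 ≤ K ^ 2 * (a * b) := by positivity
  nlinarith [sq_nonneg (2 * |K| * a - 2 * m), sq_abs K, sq_nonneg a]

end Ladyzhenskaya

/-- Poincaré's inequality, from the vanishing of the integral of `∂₁(x₁ f²)`. -/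
lemma exists_poincare {Ω : Set Plane} (hΩ : IsOpen Ω) (hb : Bornology.IsBounded Ω) :
    ∃ C, 0 ≤ C ∧ ∀ f : Plane → ℝ, Reg1 Ω f → Vanish Ω f →
      ∫ x in Ω, f x ^ 2 ≤ C * ∫ x in Ω, (pd 0 f x ^ 2 + pd 1 f x ^ 2) := by
  have hcd : ContDiff ℝ 1 fun x : Plane => x 0 :=
    (EuclideanSpace.proj (𝕜 := ℝ) (0 : Fin 2)).contDiff
  have rx : Reg1 Ω fun x => x 0 := reg1_of_contDiff hb hcd
  obtain ⟨M, hM⟩ := rx.bdd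
  refine ⟨4 * M ^ 2, by positivity, fun f hf hv => ?_⟩
  have rf2 := hf.pow hΩ 2
  have rF : Reg1 Ω fun x => f x ^ 2 * x 0 := rf2.mul rx hΩ
  have vF : Vanish Ω fun x => f x ^ 2 * x 0 := (hv.mul_bdd (hf.mul rx hΩ).bdd).congr
    fun x _ => by ring
  have h0 := setIntegral_pd_eq_zero hΩ hb rF vF 0
  have bP := ((hf.bddCont_pd hΩ 0).pow 2).add ((hf.bddCont_pd hΩ 1).pow 2)
  have hpt : ∀ x ∈ Ω, f x ^ 2 ≤ 4 * M ^ 2 * (pd 0 f x ^ 2 + pd 1 f x ^ 2)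
      + 2 * pd 0 (fun x => f x ^ 2 * x 0) x := by
    intro x hx
    rw [pd_mul 0 (rf2.differentiableAt hΩ hx) (rx.differentiableAt hΩ hx),
      pd_sq 0 (hf.differentiableAt hΩ hx), pd_coord, if_pos rfl]
    have h1 : x 0 ^ 2 ≤ M ^ 2 := sq_le_sq' (neg_le_of_abs_le (hM x hx)) (le_of_abs_le (hM x hx))
    have h2 := mul_le_mul_of_nonneg_right h1 (sq_nonneg (pd 0 f x))
    have h3 := mul_nonneg (sq_nonneg M) (sq_nonneg (pd 1 f x))
    nlinarith [sq_nonneg (f x + 2 * (x 0 * pd 0 f x))]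
  have h1 := ((bddCont_const (4 * M ^ 2)).mul bP).integrableOn hΩ hb
  have h2 := ((bddCont_const 2).mul (rF.bddCont_pd hΩ 0)).integrableOn hΩ hb
  have := setIntegral_mono_on ((hf.bddCont.pow 2).integrableOn hΩ hb) (h1.add h2)
    hΩ.measurableSet hpt
  simp only [Pi.add_apply] at this
  rw [integral_add h1 h2, integral_const_mul, integral_const_mul, h0] at this
  linarith

/-! ### The gradient of the angle of the director -/

/-- A field of unit vectors in the plane, with bounded derivatives of orders one and two. -/
structure UnitField (Ω : Set Plane) (d : Plane → Plane) : Prop where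
  reg : ∀ k, Reg2 Ω fun x => d x k
  sq : ∀ x ∈ Ω, d x 0 ^ 2 + d x 1 ^ 2 = 1

/-- The derivative `∂ᵢφ` of the angle `φ` of the unit field `d = (cos φ, sin φ)`. The angle itself
need not exist globally. -/
noncomputable def angGrad (d : Plane → Plane) (i : Fin 2) (x : Plane) : ℝ :=
  d x 0 * pd i (fun y => d y 1) x - d x 1 * pd i (fun y => d y 0) x

namespace UnitField

variable {Ω : Set Plane} {d : Plane → Plane} (hd : UnitField Ω d) (hΩ : IsOpen Ω)

include hd hΩ

lemma reg1_angGrad (i : Fin 2) : Reg1 Ω (angGrad d i) :=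
  ((hd.reg 0).reg1.mul ((hd.reg 1).pd i) hΩ).sub ((hd.reg 1).reg1.mul ((hd.reg 0).pd i) hΩ) hΩ

lemma pd_eq {x : Plane} (hx : x ∈ Ω) (i : Fin 2) :
    pd i (fun y => d y 0) x = -(d x 1 * angGrad d i x) ∧
      pd i (fun y => d y 1) x = d x 0 * angGrad d i x := by
  have e := fun k => (hd.reg k).reg1.differentiableAt hΩ hx
  have h1 := pd_congr_on hΩ (g := fun _ => 1) (fun y hy => hd.sq y hy) i hx
  rw [pd_const, pd_add i ((e 0).fun_pow 2) ((e 1).fun_pow 2), pd_sq i (e 0), pd_sq i (e 1)] at h1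
  have h2 := hd.sq x hx
  unfold angGrad
  constructor
  · linear_combination (-pd i (fun y => d y 0) x) * h2 + d x 0 / 2 * h1
  · linear_combination (-pd i (fun y => d y 1) x) * h2 + d x 1 / 2 * h1

lemma pd_pd_eq {x : Plane} (hx : x ∈ Ω) (j i : Fin 2) :
    pd j (pd i fun y => d y 0) x
        = -(d x 0 * (angGrad d j x * angGrad d i x) + d x 1 * pd j (angGrad d i) x) ∧
      pd j (pd i fun y => d y 1) x
        = -(d x 1 * (angGrad d j x * angGrad d i x)) + d x 0 * pd j (angGrad d i) x := by
  have e := fun k => (hd.reg k).reg1.differentiableAt hΩ hx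
  have eu := (hd.reg1_angGrad hΩ i).differentiableAt hΩ hx
  have h1 := pd_congr_on hΩ (fun y hy => (hd.pd_eq hΩ hy i).1) j hx
  have h2 := pd_congr_on hΩ (fun y hy => (hd.pd_eq hΩ hy i).2) j hx
  rw [pd_neg, pd_mul j (e 1) eu, (hd.pd_eq hΩ hx j).2] at h1
  rw [pd_mul j (e 0) eu, (hd.pd_eq hΩ hx j).1] at h2
  exact ⟨by rw [h1]; ring, by rw [h2]; ring⟩

lemma pd_angGrad {x : Plane} (hx : x ∈ Ω) (j i : Fin 2) : pd j (angGrad d i) x =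
    d x 0 * pd j (pd i fun y => d y 1) x - d x 1 * pd j (pd i fun y => d y 0) x := by
  rw [(hd.pd_pd_eq hΩ hx j i).1, (hd.pd_pd_eq hΩ hx j i).2]
  linear_combination (-pd j (angGrad d i) x) * hd.sq x hx

lemma curl_angGrad {x : Plane} (hx : x ∈ Ω) : pd 0 (angGrad d 1) x = pd 1 (angGrad d 0) x := by
  rw [hd.pd_angGrad hΩ hx, hd.pd_angGrad hΩ hx, pd_comm hΩ (hd.reg 0).contDiffOn_two 0 1 hx,
    pd_comm hΩ (hd.reg 1).contDiffOn_two 0 1 hx]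

lemma norm_grad_sq {x : Plane} (hx : x ∈ Ω) :
    ‖grad d x‖ ^ 2 = angGrad d 0 x ^ 2 + angGrad d 1 x ^ 2 := by
  rw [NematicFlow.norm_grad_sq]
  simp only [Fin.sum_univ_two]
  rw [(hd.pd_eq hΩ hx 0).1, (hd.pd_eq hΩ hx 0).2, (hd.pd_eq hΩ hx 1).1, (hd.pd_eq hΩ hx 1).2]
  linear_combination (angGrad d 0 x ^ 2 + angGrad d 1 x ^ 2) * hd.sq x hx

lemma norm_hess_sq {x : Plane} (hx : x ∈ Ω) :
    ‖hess d x‖ ^ 2 = gradSq (angGrad d 0) (angGrad d 1) x + ‖grad d x‖ ^ 4 := by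
  have h4 : ‖grad d x‖ ^ 4 = (‖grad d x‖ ^ 2) ^ 2 := by ring
  have hs : ∀ j i, pd j (pd i fun y => d y 0) x ^ 2 + pd j (pd i fun y => d y 1) x ^ 2
      = (angGrad d j x * angGrad d i x) ^ 2 + pd j (angGrad d i) x ^ 2 := fun j i => by
    rw [(hd.pd_pd_eq hΩ hx j i).1, (hd.pd_pd_eq hΩ hx j i).2]
    linear_combination ((angGrad d j x * angGrad d i x) ^ 2 + pd j (angGrad d i) x ^ 2) *
      hd.sq x hx
  rw [h4, hd.norm_grad_sq hΩ hx, EuclideanSpace.norm_sq_eq, Fintype.sum_prod_type, gradSq]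
  simp only [Fintype.sum_prod_type, Fin.sum_univ_two, hess, Real.norm_eq_abs, sq_abs]
  rw [hs, hs, hs, hs]
  ring

/-- The divergence of the gradient of the angle is the part of the tension field that is
perpendicular to the director. -/
lemma div_angGrad_sq_le {x : Plane} (hx : x ∈ Ω) :
    (pd 0 (angGrad d 0) x + pd 1 (angGrad d 1) x) ^ 2 ≤ ∑ k, tension d x k ^ 2 := by
  have h1 : pd 0 (angGrad d 0) x + pd 1 (angGrad d 1) x
      = d x 0 * tension d x 1 - d x 1 * tension d x 0 := by
    rw [hd.pd_angGrad hΩ hx, hd.pd_angGrad hΩ hx]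
    simp only [tension, lapl, Fin.sum_univ_two]
    ring
  rw [h1, Fin.sum_univ_two]
  nlinarith [sq_nonneg (d x 0 * tension d x 0 + d x 1 * tension d x 1), hd.sq x hx]

end UnitField

section Solution

variable {A γ μ lam ν θ T r : ℝ} {Ω : Set Plane} {ρ₀ : Plane → ℝ} {m₀ d₀ : Plane → Plane}
  {ρ : ℝ → Plane → ℝ} {v d : ℝ → Plane → Plane}

lemma IsClassicalSolution.unitField (h : IsClassicalSolution A γ μ lam ν θ T Ω ρ₀ m₀ d₀ ρ v d)
    (hT : 0 < T) (hΩ : IsOpen Ω) (hb : Bornology.IsBounded Ω) (hθ : 0 < θ)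
    (hd₀ : ∀ x ∈ Ω, ‖d₀ x‖ = 1) {t : ℝ} (ht : t ∈ Icc 0 T) : UnitField Ω (d t) :=
  ⟨fun k => (h.reg_director k).spaceReg2 hT hΩ hb |>.reg2_slice hΩ hb ht,
    fun x hx => h.director_sq hT hΩ hb hθ hd₀ t ht x (subset_closure hx)⟩

/-- As the director does not change on the boundary, neither does the tangential derivative of its
angle. -/
lemma IsClassicalSolution.tangVanish_angGrad_sub
    (h : IsClassicalSolution A γ μ lam ν θ T Ω ρ₀ m₀ d₀ ρ v d) (hT : 0 < T) (hΩ : IsOpen Ω)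
    (hb : Bornology.IsBounded Ω) {t : ℝ} (ht : t ∈ Ioo 0 T) :
    TangVanish Ω (fun x => angGrad (d t) 0 x - angGrad (d 0) 0 x)
      fun x => angGrad (d t) 1 x - angGrad (d 0) 1 x := by
  intro x₀ R g r hc y hy hyr
  have hI := Ioo_subset_Icc_self ht
  have hI0 : (0 : ℝ) ∈ Icc 0 T := ⟨le_rfl, hT.le⟩
  have hd := fun k => ((h.reg_director k).spaceReg2 hT hΩ hb).reg1
  choose G hGc hG using fun k => (hd k).exists_tendsto_pd hI
  choose G₀ hGc₀ hG₀ using fun k => (hd k).exists_tendsto_pd hI0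
  have hzero : ∀ k, ∑ i, tangent R g y i * (G k i y - G₀ k i y) = 0 := fun k =>
    hc.tangential_eq_zero hΩ (ψ := fun x => d t x k - d 0 x k)
      (G := fun i x => G k i x - G₀ k i x)
      (((hd k).continuousOn_slice hI).sub ((hd k).continuousOn_slice hI0))
      (((hd k).contDiffOn t hI).sub ((hd k).contDiffOn 0 hI0))
      (fun z hz => sub_eq_zero.2 (h.director_bdry hT ht hz k))
      (fun i => (hGc k i).sub (hGc₀ k i))
      (fun i x hx => by
        rw [pd_sub i (((hd k).reg1_slice hb hI).differentiableAt hΩ hx)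
          (((hd k).reg1_slice hb hI0).differentiableAt hΩ hx), hG k i hx, hG₀ k i hx]) hy hyr
  have hlim : ∀ {f : Plane → ℝ}, ContinuousOn f (closure Ω) → Tendsto f (𝓝[Ω] y) (𝓝 (f y)) :=
    fun hf => (hf y (frontier_subset_closure hy)).mono_left (nhdsWithin_mono y subset_closure)
  have hpd : ∀ k i, Tendsto (pd i fun x => d t x k) (𝓝[Ω] y) (𝓝 (G k i y)) := fun k i =>
    (hlim (hGc k i)).congr' (eventually_nhdsWithin_of_forall fun x hx => (hG k i hx).symm)
  have hpd₀ : ∀ k i, Tendsto (pd i fun x => d 0 x k) (𝓝[Ω] y) (𝓝 (G₀ k i y)) := fun k i =>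
    (hlim (hGc₀ k i)).congr' (eventually_nhdsWithin_of_forall fun x hx => (hG₀ k i hx).symm)
  have hdk := fun k => hlim ((hd k).continuousOn_slice hI)
  have hdk₀ := fun k => hlim ((hd k).continuousOn_slice hI0)
  have hτ : ∀ i, Tendsto (fun x => tangent R g x i) (𝓝[Ω] y) (𝓝 (tangent R g y i)) := fun i =>
    hlim (contDiff_tangent hc.contDiff R i).continuous.continuousOn
  have hfull := ((hτ 0).mul ((((hdk 0).mul (hpd 1 0)).sub ((hdk 1).mul (hpd 0 0))).sub
    (((hdk₀ 0).mul (hpd₀ 1 0)).sub ((hdk₀ 1).mul (hpd₀ 0 0))))).add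
    ((hτ 1).mul ((((hdk 0).mul (hpd 1 1)).sub ((hdk 1).mul (hpd 0 1))).sub
    (((hdk₀ 0).mul (hpd₀ 1 1)).sub ((hdk₀ 1).mul (hpd₀ 0 1)))))
  refine (congrArg (fun c => Tendsto _ _ (𝓝 c)) ?_).mp hfull
  have z0 := hzero 0
  have z1 := hzero 1
  rw [Fin.sum_univ_two] at z0 z1
  rw [h.director_bdry hT ht hy 0, h.director_bdry hT ht hy 1]
  linear_combination d 0 y 0 * z1 - d 0 y 1 * z0

/-- The second derivatives of the director at one instant of time. -/
lemma exists_director_bounds (hΩ : IsOpen Ω) (hb : Bornology.IsBounded Ω) {α : ℝ≥0}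
    (hα : HasC2HolderBoundary α Ω) : ∃ C, 0 ≤ C ∧ ∀ (A γ μ lam ν θ T : ℝ) (ρ₀ : Plane → ℝ)
      (m₀ d₀ : Plane → Plane) (ρ : ℝ → Plane → ℝ) (v d : ℝ → Plane → Plane),
      IsClassicalSolution A γ μ lam ν θ T Ω ρ₀ m₀ d₀ ρ v d → 0 < T → 0 < θ →
      (∀ x ∈ Ω, ‖d₀ x‖ = 1) → ∀ (U H : ℝ), (∀ t ∈ Icc 0 T, ∫ x in Ω, ‖grad (d t) x‖ ^ 2 ≤ U) →
      ∫ x in Ω, ‖hess (d 0) x‖ ^ 2 ≤ H → ∀ t ∈ Ioo 0 T,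
        ∫ x in Ω, ‖grad (d t) x‖ ^ 4
          ≤ C * (U * ((∫ x in Ω, ∑ k, tension (d t) x k ^ 2) + U + H)) ∧
        ∫ x in Ω, ‖hess (d t) x‖ ^ 2
          ≤ C * ((1 + U) * ((∫ x in Ω, ∑ k, tension (d t) x k ^ 2) + U + H)) := by
  obtain ⟨C₁, hC₁, hgaff⟩ := exists_gaffney hΩ hb hα
  obtain ⟨C₂, hC₂, hlad⟩ := exists_ladyzhenskaya hΩ hb hα
  refine ⟨4 * C₂ * (10 * C₁ + 3) + (10 * C₁ + 3), by positivity, ?_⟩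
  intro A γ μ lam ν θ T ρ₀ m₀ d₀ ρ v d h hT hθ hd₀ U H hU hH t ht
  have hI := Ioo_subset_Icc_self ht
  have hI0 : (0 : ℝ) ∈ Icc 0 T := ⟨le_rfl, hT.le⟩
  have u1 := h.unitField hT hΩ hb hθ hd₀ hI
  have u0 := h.unitField hT hΩ hb hθ hd₀ hI0
  have r1 := fun i => u1.reg1_angGrad hΩ i
  have r0 := fun i => u0.reg1_angGrad hΩ i
  have bX : IntegrableOn (fun x => ∑ k, tension (d t) x k ^ 2) Ω := by
    obtain ⟨K, hK⟩ := h.exists_tension_le hT hΩ hb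
    exact integrableOn_of_bdd hΩ hb ((h.continuousOn_tension hT hΩ hb).comp
      (f := fun x => (t, x)) (by fun_prop) fun x hx => ⟨hI, hx⟩) ⟨K, hK t hI⟩
  set X := ∫ x in Ω, ∑ k, tension (d t) x k ^ 2 with hX
  have hX0 : 0 ≤ X := integral_nonneg fun x => by positivity
  have bS : ∀ {w₀ w₁ : Plane → ℝ}, Reg1 Ω w₀ → Reg1 Ω w₁ → IntegrableOn (gradSq w₀ w₁) Ω :=
    fun h₀ h₁ => ((((h₀.bddCont_pd hΩ 0).pow 2).add ((h₀.bddCont_pd hΩ 1).pow 2)).add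
      (((h₁.bddCont_pd hΩ 0).pow 2).add ((h₁.bddCont_pd hΩ 1).pow 2))).integrableOn hΩ hb
  have bsq : ∀ {w₀ w₁ : Plane → ℝ}, Reg1 Ω w₀ → Reg1 Ω w₁ →
      IntegrableOn (fun x => w₀ x ^ 2 + w₁ x ^ 2) Ω := fun h₀ h₁ =>
    ((h₀.bddCont.pow 2).add (h₁.bddCont.pow 2)).integrableOn hΩ hb
  have b4 : ∀ {f : Plane → ℝ}, Reg1 Ω f → IntegrableOn (fun x => f x ^ 4) Ω :=
    fun hf => (hf.bddCont.pow 4).integrableOn hΩ hb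
  have hUeq : ∀ s ∈ Icc 0 T, ∫ x in Ω, (angGrad (d s) 0 x ^ 2 + angGrad (d s) 1 x ^ 2) ≤ U := by
    intro s hs
    refine le_trans (le_of_eq ?_) (hU s hs)
    exact setIntegral_congr_fun hΩ.measurableSet fun x hx =>
      ((h.unitField hT hΩ hb hθ hd₀ hs).norm_grad_sq hΩ hx).symm
  have hU0 : 0 ≤ U := le_trans (integral_nonneg fun x => by positivity) (hU t hI)
  have hH0 : 0 ≤ H := le_trans (integral_nonneg fun x => by positivity) hH
  set G := ∫ x in Ω, gradSq (angGrad (d t) 0) (angGrad (d t) 1) x with hG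
  set G₀ := ∫ x in Ω, gradSq (angGrad (d 0) 0) (angGrad (d 0) 1) x with hG₀
  have hG0 : 0 ≤ G := integral_nonneg fun x => gradSq_nonneg _ _ x
  have h4eq : ∀ x ∈ Ω, ‖grad (d t) x‖ ^ 4 = (angGrad (d t) 0 x ^ 2 + angGrad (d t) 1 x ^ 2) ^ 2 :=
    fun x hx => by rw [← u1.norm_grad_sq hΩ hx]; ring
  have bhess0 : IntegrableOn (fun x => ‖hess (d 0) x‖ ^ 2) Ω := by
    refine (((bS (r0 0) (r0 1)).add ((((r0 0).bddCont.pow 2).add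
      ((r0 1).bddCont.pow 2)).pow 2 |>.integrableOn hΩ hb))).congr_fun (fun x hx => ?_)
        hΩ.measurableSet
    simp only [Pi.add_apply]
    rw [u0.norm_hess_sq hΩ hx, ← u0.norm_grad_sq hΩ hx]
    ring
  have hG₀H : G₀ ≤ H := by
    refine le_trans (setIntegral_mono_on (bS (r0 0) (r0 1)) bhess0 hΩ.measurableSet
      fun x hx => ?_) hH
    rw [u0.norm_hess_sq hΩ hx]
    exact le_add_of_nonneg_right (by positivity)
  set w : Fin 2 → Plane → ℝ := fun i x => angGrad (d t) i x - angGrad (d 0) i x with hw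
  have rw' : ∀ i, Reg1 Ω (w i) := fun i => (r1 i).sub (r0 i) hΩ
  have hpdw : ∀ j i, ∀ x ∈ Ω, pd j (w i) x = pd j (angGrad (d t) i) x - pd j (angGrad (d 0) i) x :=
    fun j i x hx => pd_sub j ((r1 i).differentiableAt hΩ hx) ((r0 i).differentiableAt hΩ hx)
  have hga := hgaff (w 0) (w 1) (rw' 0) (rw' 1) (fun x hx => by
    rw [hpdw 0 1 x hx, hpdw 1 0 x hx, u1.curl_angGrad hΩ hx, u0.curl_angGrad hΩ hx])
    (h.tangVanish_angGrad_sub hT hΩ hb ht)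
  have hdivw : ∫ x in Ω, ((pd 0 (w 0) x + pd 1 (w 1) x) ^ 2 + (w 0 x ^ 2 + w 1 x ^ 2))
      ≤ 2 * X + 4 * G₀ + 2 * U + 2 * U := by
    have i1 := bX.const_mul 2
    have i2 := (bS (r0 0) (r0 1)).const_mul 4
    have i3 := (bsq (r1 0) (r1 1)).const_mul 2
    have i4 := (bsq (r0 0) (r0 1)).const_mul 2
    have hle := setIntegral_mono_on
      ((((((rw' 0).bddCont_pd hΩ 0).add ((rw' 1).bddCont_pd hΩ 1)).pow 2).add
        (((rw' 0).bddCont.pow 2).add ((rw' 1).bddCont.pow 2))).integrableOn hΩ hb)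
      (((i1.add i2).add i3).add i4) hΩ.measurableSet fun x hx => by
        have e1 := u1.div_angGrad_sq_le hΩ hx
        simp only [Pi.add_apply]
        rw [hpdw 0 0 x hx, hpdw 1 1 x hx]
        simp only [hw, gradSq]
        nlinarith [sq_nonneg (pd 0 (angGrad (d t) 0) x + pd 1 (angGrad (d t) 1) x
            + (pd 0 (angGrad (d 0) 0) x + pd 1 (angGrad (d 0) 1) x)),
          sq_nonneg (pd 0 (angGrad (d 0) 0) x - pd 1 (angGrad (d 0) 1) x),
          sq_nonneg (pd 1 (angGrad (d 0) 0) x), sq_nonneg (pd 0 (angGrad (d 0) 1) x),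
          sq_nonneg (angGrad (d t) 0 x + angGrad (d 0) 0 x),
          sq_nonneg (angGrad (d t) 1 x + angGrad (d 0) 1 x)]
    refine hle.trans ?_
    rw [integral_add' ((i1.add i2).add i3) i4, integral_add' (i1.add i2) i3, integral_add' i1 i2,
      integral_const_mul, integral_const_mul, integral_const_mul, integral_const_mul]
    linarith [hUeq t hI, hUeq 0 hI0]
  have hGle : G ≤ 2 * (∫ x in Ω, gradSq (w 0) (w 1) x) + 2 * G₀ := by
    have i1 := (bS (rw' 0) (rw' 1)).const_mul 2
    have i2 := (bS (r0 0) (r0 1)).const_mul 2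
    have hle := setIntegral_mono_on (bS (r1 0) (r1 1)) (i1.add i2) hΩ.measurableSet fun x hx => by
      simp only [Pi.add_apply, gradSq]
      rw [hpdw 0 0 x hx, hpdw 1 1 x hx, hpdw 0 1 x hx, hpdw 1 0 x hx]
      have hq : ∀ a b : ℝ, a ^ 2 ≤ 2 * (a - b) ^ 2 + 2 * b ^ 2 := fun a b => by
        nlinarith [sq_nonneg (a - 2 * b)]
      linarith [hq (pd 0 (angGrad (d t) 0) x) (pd 0 (angGrad (d 0) 0) x),
        hq (pd 1 (angGrad (d t) 0) x) (pd 1 (angGrad (d 0) 0) x),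
        hq (pd 0 (angGrad (d t) 1) x) (pd 0 (angGrad (d 0) 1) x),
        hq (pd 1 (angGrad (d t) 1) x) (pd 1 (angGrad (d 0) 1) x)]
    rw [integral_add' i1 i2, integral_const_mul, integral_const_mul] at hle
    exact hle
  have hGfin : G ≤ (10 * C₁ + 2) * (X + U + H) := by
    have := hga.trans (mul_le_mul_of_nonneg_left hdivw hC₁)
    have h5 : C₁ * (2 * X + 4 * G₀ + 2 * U + 2 * U) ≤ C₁ * (5 * (X + U + H)) :=
      mul_le_mul_of_nonneg_left (by linarith) hC₁
    linarith
  have hlady : ∀ i, ∫ x in Ω, angGrad (d t) i x ^ 4 ≤ C₂ * (U * (U + G)) := by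
    intro i
    refine (hlad _ (r1 i)).trans (mul_le_mul_of_nonneg_left ?_ hC₂)
    have h1 : ∫ x in Ω, angGrad (d t) i x ^ 2 ≤ U := by
      refine (setIntegral_mono_on (((r1 i).bddCont.pow 2).integrableOn hΩ hb)
        (bsq (r1 0) (r1 1)) hΩ.measurableSet fun x _ => ?_).trans (hUeq t hI)
      fin_cases i <;> simp <;> positivity
    have h2 : ∫ x in Ω, (pd 0 (angGrad (d t) i) x ^ 2 + pd 1 (angGrad (d t) i) x ^ 2) ≤ G := by
      refine setIntegral_mono_on ((((r1 i).bddCont_pd hΩ 0).pow 2).add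
        (((r1 i).bddCont_pd hΩ 1).pow 2) |>.integrableOn hΩ hb)
        (bS (r1 0) (r1 1)) hΩ.measurableSet fun x _ => ?_
      unfold gradSq
      fin_cases i <;> simp <;> positivity
    exact mul_le_mul h1 (add_le_add h1 h2) (add_nonneg (integral_nonneg fun x => sq_nonneg _)
      (integral_nonneg fun x => by positivity)) hU0
  have hL : ∫ x in Ω, ‖grad (d t) x‖ ^ 4 ≤ 4 * C₂ * (U * (U + G)) := by
    rw [setIntegral_congr_fun hΩ.measurableSet h4eq]
    have i1 := (b4 (r1 0)).const_mul 2
    have i2 := (b4 (r1 1)).const_mul 2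
    have hle := setIntegral_mono_on ((((r1 0).bddCont.pow 2).add
      ((r1 1).bddCont.pow 2)).pow 2 |>.integrableOn hΩ hb) (i1.add i2) hΩ.measurableSet
      fun x _ => by
        simp only [Pi.add_apply]
        nlinarith [sq_nonneg (angGrad (d t) 0 x ^ 2 - angGrad (d t) 1 x ^ 2)]
    rw [integral_add' i1 i2, integral_const_mul, integral_const_mul] at hle
    linarith [hlady 0, hlady 1]
  have hUG : U * (U + G) ≤ (10 * C₁ + 3) * (U * (X + U + H)) := by
    have : U * (U + G) ≤ U * ((10 * C₁ + 3) * (X + U + H)) := by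
      refine mul_le_mul_of_nonneg_left ?_ hU0
      linarith
    linarith
  have hL' : ∫ x in Ω, ‖grad (d t) x‖ ^ 4 ≤ 4 * C₂ * (10 * C₁ + 3) * (U * (X + U + H)) := by
    refine hL.trans ?_
    rw [mul_assoc (4 * C₂)]
    exact mul_le_mul_of_nonneg_left hUG (by positivity)
  have hS0 : 0 ≤ X + U + H := by positivity
  have hUS : 0 ≤ U * (X + U + H) := by positivity
  have hc1 : 0 ≤ (10 * C₁ + 3) * (U * (X + U + H)) := by positivity
  have hc2 : 0 ≤ 4 * C₂ * (10 * C₁ + 3) * (X + U + H) := by positivity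
  refine ⟨by linarith, ?_⟩
  have i4 : IntegrableOn (fun x => ‖grad (d t) x‖ ^ 4) Ω :=
    ((((r1 0).bddCont.pow 2).add ((r1 1).bddCont.pow 2)).pow 2 |>.integrableOn hΩ hb).congr_fun
      (fun x hx => (h4eq x hx).symm) hΩ.measurableSet
  rw [setIntegral_congr_fun hΩ.measurableSet fun x hx => u1.norm_hess_sq hΩ hx,
    integral_add (bS (r1 0) (r1 1)) i4]
  linarith

end Solution

/-! ### The time derivative of the director -/

lemma memLp_component {X : Type*} [MeasurableSpace X] {κ : Measure X} {w : X → Plane}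
    (hw : MemLp w 2 κ) (h : eLpNorm w 2 κ ^ 2 ≤ 1) (k : Fin 2) :
    MemLp (fun x => w x k) 2 κ ∧ ∫ x, w x k ^ 2 ∂κ ≤ 1 := by
  have hk : MemLp (fun x => w x k) 2 κ :=
    (EuclideanSpace.proj (𝕜 := ℝ) k).comp_memLp' hw
  refine ⟨hk, ?_⟩
  have h1 := eLpNorm_two_rpow hw.norm.integrable_sq
  rw [show (2 : ℝ) = ((2 : ℕ) : ℝ) by norm_num, ENNReal.rpow_natCast] at h1
  rw [h1, ENNReal.ofReal_le_one] at h
  refine (integral_mono hk.integrable_sq hw.norm.integrable_sq fun x => ?_).trans h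
  have : |w x k| ≤ ‖w x‖ := by simpa using PiLp.norm_apply_le (w x) k
  simp only
  rw [← sq_abs]
  exact pow_le_pow_left₀ (abs_nonneg _) this 2

lemma BddCont.memLp {Ω : Set Plane} {f : Plane → ℝ} (hf : BddCont Ω f) (hΩ : IsOpen Ω)
    (hb : Bornology.IsBounded Ω) : MemLp f 2 (volume.restrict Ω) :=
  (memLp_two_iff_integrable_sq (hf.integrableOn hΩ hb).aestronglyMeasurable).2
    ((hf.pow 2).integrableOn hΩ hb)

/-- The Cauchy-Schwarz inequality, for a factor of norm at most one. -/
lemma abs_integral_mul_le {X : Type*} [MeasurableSpace X] {κ : Measure X} {f z : X → ℝ} {B : ℝ}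
    (hf : MemLp f 2 κ) (hz : MemLp z 2 κ) (hz1 : ∫ x, z x ^ 2 ∂κ ≤ 1)
    (hB : ∫ x, f x ^ 2 ∂κ ≤ B) : |∫ x, f x * z x ∂κ| ≤ Real.sqrt B := by
  refine Real.abs_le_sqrt ((sq_integral_mul_le hf.integrable_sq hz.integrable_sq
    (hf.integrable_mul hz)).trans ?_)
  exact (mul_le_of_le_one_right (integral_nonneg fun x => sq_nonneg _) hz1).trans hB

section Solution

variable {A γ μ lam ν θ T r : ℝ} {Ω : Set Plane} {ρ₀ : Plane → ℝ} {m₀ d₀ : Plane → Plane}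
  {ρ : ℝ → Plane → ℝ} {v d : ℝ → Plane → Plane}

lemma IsClassicalSolution.dt_apply (h : IsClassicalSolution A γ μ lam ν θ T Ω ρ₀ m₀ d₀ ρ v d)
    (hT : 0 < T) (hΩ : IsOpen Ω) (hb : Bornology.IsBounded Ω) {t : ℝ} (ht : t ∈ Ioo 0 T)
    {x : Plane} (hx : x ∈ Ω) (k : Fin 2) :
    dt d t x k = -∑ i, v t x i * pd i (fun y => d t y k) x + θ * tension (d t) x k := by
  have hder := fun k => ((h.reg_director k).toIsC1Closed.timeReg hT hΩ hb).hasDerivAt t ht x hx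
  have hvec : HasDerivAt (fun s => d s x)
      (WithLp.toLp 2 fun k => deriv (fun s => d s x k) t) t := by
    have h1 : HasDerivAt (fun s => WithLp.ofLp (d s x)) (fun k => deriv (fun s => d s x k) t) t :=
      hasDerivAt_pi.2 fun k => hder k
    exact (PiLp.continuousLinearEquiv 2 ℝ fun _ : Fin 2 => ℝ).symm.hasFDerivAt.comp_hasDerivAt t h1
  rw [dt, hvec.deriv]
  exact h.director_expanded ht hx k

lemma IsClassicalSolution.integral_velocity_sq_le
    (h : IsClassicalSolution A γ μ lam ν θ T Ω ρ₀ m₀ d₀ ρ v d) (hT : 0 < T) (hΩ : IsOpen Ω)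
    (hb : Bornology.IsBounded Ω) {t : ℝ} (ht : t ∈ Icc 0 T) (k : Fin 2) :
    ∫ x in Ω, (pd 0 (fun y => v t y k) x ^ 2 + pd 1 (fun y => v t y k) x ^ 2)
      ≤ ∫ x in Ω, ‖grad (v t) x‖ ^ 2 := by
  have hv := ((h.reg_velocity k).spaceReg2 hT hΩ hb).reg1.reg1_slice hb ht
  refine setIntegral_mono_on ((((hv.bddCont_pd hΩ 0).pow 2).add
    ((hv.bddCont_pd hΩ 1).pow 2)).integrableOn hΩ hb)
    (integrableOn_norm_grad_sq hΩ hb fun k =>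
      (h.reg_velocity k).spaceReg2 hT hΩ hb |>.reg2_slice hΩ hb ht) hΩ.measurableSet fun x _ => ?_
  rw [norm_grad_sq]
  simp only [Fin.sum_univ_two]
  have h0 := sq_nonneg (pd 0 (fun y => v t y 0) x)
  have h1 := sq_nonneg (pd 1 (fun y => v t y 0) x)
  have h2 := sq_nonneg (pd 0 (fun y => v t y 1) x)
  have h3 := sq_nonneg (pd 1 (fun y => v t y 1) x)
  fin_cases k <;> simp only [Fin.zero_eta, Fin.mk_one] <;> linarith

lemma IsClassicalSolution.bddCont_tension
    (h : IsClassicalSolution A γ μ lam ν θ T Ω ρ₀ m₀ d₀ ρ v d) (hT : 0 < T) (hΩ : IsOpen Ω)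
    (hb : Bornology.IsBounded Ω) {t : ℝ} (ht : t ∈ Icc 0 T) (k : Fin 2) :
    BddCont Ω fun x => tension (d t) x k := by
  have hd := fun k => (h.reg_director k).spaceReg2 hT hΩ hb |>.reg2_slice hΩ hb ht
  simp only [tension, lapl, Fin.sum_univ_two]
  have hp := fun l i => ((hd l).reg1.bddCont_pd hΩ i).pow 2
  exact ((((hd k).pd 0).bddCont_pd hΩ 0).add (((hd k).pd 1).bddCont_pd hΩ 1)).add
    ((((hp 0 0).add (hp 1 0)).add ((hp 0 1).add (hp 1 1))).mul (hd k).reg1.bddCont)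

lemma IsClassicalSolution.integral_tension_sq_le
    (h : IsClassicalSolution A γ μ lam ν θ T Ω ρ₀ m₀ d₀ ρ v d) (hT : 0 < T) (hΩ : IsOpen Ω)
    (hb : Bornology.IsBounded Ω) {t : ℝ} (ht : t ∈ Icc 0 T) (k : Fin 2) :
    ∫ x in Ω, tension (d t) x k ^ 2 ≤ ∫ x in Ω, ∑ k, tension (d t) x k ^ 2 := by
  have hi := fun k => ((h.bddCont_tension hT hΩ hb ht k).pow 2).integrableOn hΩ hb
  refine setIntegral_mono_on (hi k) (integrable_finsetSum _ fun k _ => hi k) hΩ.measurableSet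
    fun x _ => ?_
  exact Finset.single_le_sum (f := fun k => tension (d t) x k ^ 2) (fun _ _ => sq_nonneg _)
    (Finset.mem_univ k)

/-- The transport term is estimated in `L²` by Hölder's inequality. -/
lemma exists_dt_sq_le (hΩ : IsOpen Ω) (hb : Bornology.IsBounded Ω) {α : ℝ≥0}
    (hα : HasC2HolderBoundary α Ω) (θ : ℝ) (hθ : 0 < θ) :
    ∃ C, 0 ≤ C ∧ ∀ (A γ μ lam ν T : ℝ) (ρ₀ : Plane → ℝ)
      (m₀ d₀ : Plane → Plane) (ρ : ℝ → Plane → ℝ) (v d : ℝ → Plane → Plane),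
      IsClassicalSolution A γ μ lam ν θ T Ω ρ₀ m₀ d₀ ρ v d → 0 < T →
      (∀ x ∈ Ω, ‖d₀ x‖ = 1) → ∀ t ∈ Ioo 0 T,
        IntegrableOn (fun x => ‖dt d t x‖ ^ 2) Ω ∧
        ∫ x in Ω, ‖dt d t x‖ ^ 2 ≤ C * ((∫ x in Ω, ‖grad (v t) x‖ ^ 2) *
          Real.sqrt (∫ x in Ω, ‖grad (d t) x‖ ^ 4) + ∫ x in Ω, ∑ k, tension (d t) x k ^ 2) := by
  obtain ⟨C₁, hC₁, hpoin⟩ := exists_poincare hΩ hb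
  obtain ⟨C₂, hC₂, hlad⟩ := exists_ladyzhenskaya hΩ hb hα
  set M := Real.sqrt (4 * (C₂ * (C₁ * (C₁ + 1)))) with hM
  refine ⟨2 * M + 2 * θ ^ 2, by positivity, ?_⟩
  intro A γ μ lam ν T ρ₀ m₀ d₀ ρ v d h hT hd₀ t ht
  have hI := Ioo_subset_Icc_self ht
  have hd := fun k => (h.reg_director k).spaceReg2 hT hΩ hb |>.reg2_slice hΩ hb hI
  have hv := fun k => ((h.reg_velocity k).spaceReg2 hT hΩ hb).reg1.reg1_slice hb hI
  have hu := h.unitField hT hΩ hb hθ hd₀ hI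
  have hτ := fun k => h.bddCont_tension hT hΩ hb hI k
  set N := ∫ x in Ω, ‖grad (v t) x‖ ^ 2 with hN
  set L := ∫ x in Ω, ‖grad (d t) x‖ ^ 4 with hL
  set X := ∫ x in Ω, ∑ k, tension (d t) x k ^ 2 with hX
  have hN0 : 0 ≤ N := integral_nonneg fun x => by positivity
  have hX0 : 0 ≤ X := integral_nonneg fun x => by positivity
  have hV : ∀ k, ∫ x in Ω, v t x k ^ 2 ≤ C₁ * N := fun k =>
    (hpoin _ (hv k) (h.vanish_velocity hT hΩ hb ht k)).trans
      (mul_le_mul_of_nonneg_left (h.integral_velocity_sq_le hT hΩ hb hI k) hC₁)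
  have hV4 : ∀ k, ∫ x in Ω, v t x k ^ 4 ≤ C₂ * (C₁ * (C₁ + 1)) * N ^ 2 := fun k => by
    refine (hlad _ (hv k)).trans ?_
    have h1 := mul_le_mul (hV k) (add_le_add (hV k) (h.integral_velocity_sq_le hT hΩ hb hI k))
      (add_nonneg (integral_nonneg fun x => sq_nonneg _) (integral_nonneg fun x => by positivity))
      (by positivity)
    refine (mul_le_mul_of_nonneg_left h1 hC₂).trans (le_of_eq ?_)
    ring
  set V : Plane → ℝ := fun x => v t x 0 ^ 2 + v t x 1 ^ 2 with hVdef
  have bV : BddCont Ω V := ((hv 0).bddCont.pow 2).add ((hv 1).bddCont.pow 2)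
  set D : Plane → ℝ := fun x => angGrad (d t) 0 x ^ 2 + angGrad (d t) 1 x ^ 2 with hD
  have bD : BddCont Ω D := ((hu.reg1_angGrad hΩ 0).bddCont.pow 2).add
    ((hu.reg1_angGrad hΩ 1).bddCont.pow 2)
  have hDL : ∫ x in Ω, D x ^ 2 = L := setIntegral_congr_fun hΩ.measurableSet fun x hx => by
    simp only [hD]
    rw [← hu.norm_grad_sq hΩ hx]; ring
  have hVV : ∫ x in Ω, V x ^ 2 ≤ (M * N) ^ 2 := by
    have i0 := ((hv 0).bddCont.pow 4).integrableOn hΩ hb |>.const_mul 2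
    have i1 := ((hv 1).bddCont.pow 4).integrableOn hΩ hb |>.const_mul 2
    have hle := setIntegral_mono_on ((bV.pow 2).integrableOn hΩ hb) (i0.add i1) hΩ.measurableSet
      fun x _ => by
        simp only [Pi.add_apply, hVdef]
        nlinarith [sq_nonneg (v t x 0 ^ 2 - v t x 1 ^ 2)]
    rw [integral_add' i0 i1, integral_const_mul, integral_const_mul] at hle
    rw [mul_pow, hM, Real.sq_sqrt (by positivity)]
    linarith [hV4 0, hV4 1]
  have hVD : ∫ x in Ω, V x * D x ≤ M * N * Real.sqrt L := by
    refine (le_abs_self _).trans (abs_le_of_sq_le_sq ?_ (by positivity))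
    rw [mul_pow, Real.sq_sqrt (integral_nonneg fun x => by positivity)]
    refine (sq_integral_mul_le ((bV.pow 2).integrableOn hΩ hb) ((bD.pow 2).integrableOn hΩ hb)
      ((bV.mul bD).integrableOn hΩ hb)).trans ?_
    rw [hDL]
    exact mul_le_mul_of_nonneg_right hVV (integral_nonneg fun x => by positivity)
  have hnorm : ∀ x ∈ Ω, ‖dt d t x‖ ^ 2 = ∑ k, (-∑ i, v t x i * pd i (fun y => d t y k) x
      + θ * tension (d t) x k) ^ 2 := fun x hx => by
    rw [EuclideanSpace.norm_sq_eq]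
    refine Finset.sum_congr rfl fun k _ => ?_
    rw [Real.norm_eq_abs, sq_abs, h.dt_apply hT hΩ hb ht hx]
  have hint : IntegrableOn (fun x => ‖dt d t x‖ ^ 2) Ω := by
    refine IntegrableOn.congr_fun ?_ (fun x hx => (hnorm x hx).symm) hΩ.measurableSet
    refine integrable_finsetSum _ fun k _ => ?_
    simp only [Fin.sum_univ_two]
    have b1 := ((hv 0).bddCont.mul ((hd k).reg1.bddCont_pd hΩ 0)).add
      ((hv 1).bddCont.mul ((hd k).reg1.bddCont_pd hΩ 1))
    have b2 := (((bddCont_const (-1)).mul b1).add ((bddCont_const θ).mul (hτ k))).pow 2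
    have b3 := b2.integrableOn hΩ hb
    simp only [neg_one_mul] at b3
    exact b3
  refine ⟨hint, ?_⟩
  have iVD := ((bV.mul bD).integrableOn hΩ hb).const_mul 2
  have iX : IntegrableOn (fun x => 2 * θ ^ 2 * ∑ k, tension (d t) x k ^ 2) Ω :=
    (integrable_finsetSum _ fun k _ => ((hτ k).pow 2).integrableOn hΩ hb).const_mul _
  have hle := setIntegral_mono_on hint (iVD.add iX) hΩ.measurableSet fun x hx => by
    rw [hnorm x hx]
    simp only [Pi.add_apply, Fin.sum_univ_two, hVdef, hD]
    rw [(hu.pd_eq hΩ hx 0).1, (hu.pd_eq hΩ hx 0).2, (hu.pd_eq hΩ hx 1).1, (hu.pd_eq hΩ hx 1).2]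
    set s := v t x 0 * angGrad (d t) 0 x + v t x 1 * angGrad (d t) 1 x with hs
    have e0 : -(v t x 0 * -(d t x 1 * angGrad (d t) 0 x) + v t x 1 * -(d t x 1 * angGrad (d t) 1 x))
        = d t x 1 * s := by rw [hs]; ring
    have e1 : -(v t x 0 * (d t x 0 * angGrad (d t) 0 x) + v t x 1 * (d t x 0 * angGrad (d t) 1 x))
        = -(d t x 0 * s) := by rw [hs]; ring
    have e2 : s ^ 2 ≤ (v t x 0 ^ 2 + v t x 1 ^ 2) *
        (angGrad (d t) 0 x ^ 2 + angGrad (d t) 1 x ^ 2) := by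
      rw [hs]
      nlinarith [sq_nonneg (v t x 0 * angGrad (d t) 1 x - v t x 1 * angGrad (d t) 0 x)]
    have e3 : (d t x 1 * s) ^ 2 + (-(d t x 0 * s)) ^ 2 = s ^ 2 := by
      linear_combination s ^ 2 * hu.sq x hx
    rw [e0, e1]
    have hq : ∀ a b : ℝ, (a + θ * b) ^ 2 ≤ 2 * a ^ 2 + 2 * θ ^ 2 * b ^ 2 := fun a b => by
      nlinarith [sq_nonneg (a - θ * b)]
    linarith [hq (d t x 1 * s) (tension (d t) x 0), hq (-(d t x 0 * s)) (tension (d t) x 1)]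
  rw [integral_add' iVD iX, integral_const_mul, integral_const_mul] at hle
  have p1 : 0 ≤ M * X := by positivity
  have p2 : 0 ≤ θ ^ 2 * (N * Real.sqrt L) := by positivity
  linarith

/-- The norm of the time derivative in the dual space of `H¹`. In the transport term the derivative
is moved to the test function, so that only `|d| = 1` and the gradient of the velocity enter. -/
lemma exists_dualH1Norm_sq_le (hΩ : IsOpen Ω) (hb : Bornology.IsBounded Ω) (θ : ℝ) (hθ : 0 < θ) :
    ∃ C, 0 ≤ C ∧ ∀ (A γ μ lam ν T : ℝ) (ρ₀ : Plane → ℝ)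
      (m₀ d₀ : Plane → Plane) (ρ : ℝ → Plane → ℝ) (v d : ℝ → Plane → Plane),
      IsClassicalSolution A γ μ lam ν θ T Ω ρ₀ m₀ d₀ ρ v d → 0 < T →
      (∀ x ∈ Ω, ‖d₀ x‖ = 1) → ∀ t ∈ Ioo 0 T,
        dualH1Norm Ω (dt d t) ^ (2 : ℝ) ≤ ENNReal.ofReal (C *
          ((∫ x in Ω, ‖grad (v t) x‖ ^ 2) + ∫ x in Ω, ∑ k, tension (d t) x k ^ 2)) := by
  obtain ⟨C₁, hC₁, hpoin⟩ := exists_poincare hΩ hb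
  refine ⟨48 * C₁ + 48 + 12 * θ ^ 2, by positivity, ?_⟩
  intro A γ μ lam ν T ρ₀ m₀ d₀ ρ v d h hT hd₀ t ht
  have hI := Ioo_subset_Icc_self ht
  have hd := fun k => (h.reg_director k).spaceReg2 hT hΩ hb |>.reg2_slice hΩ hb hI
  have hv := fun k => ((h.reg_velocity k).spaceReg2 hT hΩ hb).reg1.reg1_slice hb hI
  have hτ := fun k => h.bddCont_tension hT hΩ hb hI k
  have hsq := h.director_sq hT hΩ hb hθ hd₀ t hI
  set N := ∫ x in Ω, ‖grad (v t) x‖ ^ 2 with hN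
  set X := ∫ x in Ω, ∑ k, tension (d t) x k ^ 2 with hX
  have hN0 : 0 ≤ N := integral_nonneg fun x => by positivity
  have hX0 : 0 ≤ X := integral_nonneg fun x => by positivity
  have hdk : ∀ k, ∀ x ∈ Ω, d t x k ^ 2 ≤ 1 := fun k x hx => by
    have := hsq x (subset_closure hx)
    fin_cases k <;> simp only [Fin.zero_eta, Fin.mk_one] <;>
      linarith [sq_nonneg (d t x 0), sq_nonneg (d t x 1)]
  have bvd : ∀ i k, BddCont Ω fun x => v t x i * d t x k := fun i k =>
    (hv i).bddCont.mul (hd k).reg1.bddCont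
  have bdv : ∀ i k, BddCont Ω fun x => pd i (fun y => v t y i) x * d t x k := fun i k =>
    ((hv i).bddCont_pd hΩ i).mul (hd k).reg1.bddCont
  have hmulle : ∀ {f : Plane → ℝ} k, BddCont Ω f →
      ∫ x in Ω, (f x * d t x k) ^ 2 ≤ ∫ x in Ω, f x ^ 2 := fun {f} k hf =>
    setIntegral_mono_on (((hf.mul (hd k).reg1.bddCont).pow 2).integrableOn hΩ hb)
      ((hf.pow 2).integrableOn hΩ hb) hΩ.measurableSet fun x hx => by
        rw [mul_pow]; exact mul_le_of_le_one_right (sq_nonneg _) (hdk k x hx)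
  have hV : ∀ i k, ∫ x in Ω, (v t x i * d t x k) ^ 2 ≤ C₁ * N := fun i k =>
    (hmulle k (hv i).bddCont).trans ((hpoin _ (hv i) (h.vanish_velocity hT hΩ hb ht i)).trans
      (mul_le_mul_of_nonneg_left (h.integral_velocity_sq_le hT hΩ hb hI i) hC₁))
  have hDV : ∀ i k, ∫ x in Ω, (pd i (fun y => v t y i) x * d t x k) ^ 2 ≤ N := fun i k => by
    refine (hmulle k ((hv i).bddCont_pd hΩ i)).trans
      (le_trans ?_ (h.integral_velocity_sq_le hT hΩ hb hI i))
    refine setIntegral_mono_on ((((hv i).bddCont_pd hΩ i).pow 2).integrableOn hΩ hb)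
      ((((hv i).bddCont_pd hΩ 0).pow 2).add (((hv i).bddCont_pd hΩ 1).pow 2) |>.integrableOn hΩ hb)
      hΩ.measurableSet fun x _ => ?_
    fin_cases i <;> simp <;> positivity
  set B := 4 * Real.sqrt (C₁ * N) + 4 * Real.sqrt N + 2 * θ * Real.sqrt X with hB
  have hB0 : 0 ≤ B := by positivity
  have hmain : dualH1Norm Ω (dt d t) ≤ ENNReal.ofReal B := by
    refine iSup_le fun w => iSup_le fun g => iSup_le fun hw => iSup_le fun hle =>
      ENNReal.ofReal_le_ofReal ?_
    have hw1 := memLp_component hw.memLp (le_self_add.trans hle)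
    have hg1 : ∀ i k, _ := fun i k => memLp_component (hw.memLp_grad i)
      ((Finset.single_le_sum (f := fun i => lpNormSpace Ω 2 (g i) ^ 2) (fun _ _ => bot_le)
        (Finset.mem_univ i)).trans (le_add_self.trans hle)) k
    have i1 : ∀ {f : Plane → ℝ} k, BddCont Ω f → IntegrableOn (fun x => f x * w x k) Ω :=
      fun k hf => (hf.memLp hΩ hb).integrable_mul (hw1 k).1
    have hparts : ∀ i k, ∫ x in Ω, v t x i * pd i (fun y => d t y k) x * w x k
        = -(∫ x in Ω, v t x i * d t x k * g i x k)
          - ∫ x in Ω, pd i (fun y => v t y i) x * d t x k * w x k := by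
      intro i k
      have hr : Reg1 Ω fun x => v t x i * d t x k := (hv i).mul (hd k).reg1 hΩ
      have hvan : Vanish Ω fun x => v t x i * d t x k :=
        (h.vanish_velocity hT hΩ hb ht i).mul_bdd (hd k).reg1.bdd
      have hp := hw.setIntegral_mul_pd hΩ hb hr hvan i k
      have e1 : ∫ x in Ω, w x k * pd i (fun x => v t x i * d t x k) x
          = (∫ x in Ω, pd i (fun y => v t y i) x * d t x k * w x k)
            + ∫ x in Ω, v t x i * pd i (fun y => d t y k) x * w x k := by
        rw [← integral_add (i1 k (bdv i k))
          (i1 k ((hv i).bddCont.mul ((hd k).reg1.bddCont_pd hΩ i)))]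
        refine setIntegral_congr_fun hΩ.measurableSet fun x hx => ?_
        simp only
        rw [pd_mul i ((hv i).differentiableAt hΩ hx) ((hd k).reg1.differentiableAt hΩ hx)]
        ring
      have e2 : ∫ x in Ω, g i x k * (v t x i * d t x k) =
          ∫ x in Ω, v t x i * d t x k * g i x k := by
        congr 1; ext x; ring
      rw [e1, e2] at hp
      linarith
    have hinner : ∫ x in Ω, inner ℝ (dt d t x) (w x)
        = ∑ k, (-∑ i, (∫ x in Ω, v t x i * pd i (fun y => d t y k) x * w x k)
          + θ * ∫ x in Ω, tension (d t) x k * w x k) := by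
      have hterm : ∀ k, IntegrableOn (fun x => -∑ i, v t x i * pd i (fun y => d t y k) x * w x k
          + θ * (tension (d t) x k * w x k)) Ω := fun k =>
        (integrable_finsetSum _ fun i _ => i1 k ((hv i).bddCont.mul
          ((hd k).reg1.bddCont_pd hΩ i))).neg.add ((i1 k (hτ k)).const_mul θ)
      calc ∫ x in Ω, inner ℝ (dt d t x) (w x)
          = ∫ x in Ω, ∑ k, (-∑ i, v t x i * pd i (fun y => d t y k) x * w x k
            + θ * (tension (d t) x k * w x k)) := by
            refine setIntegral_congr_fun hΩ.measurableSet fun x hx => ?_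
            simp only [PiLp.inner_apply, Fin.sum_univ_two, h.dt_apply hT hΩ hb ht hx,
              RCLike.inner_apply, conj_trivial]
            ring
        _ = ∑ k, ∫ x in Ω, (-∑ i, v t x i * pd i (fun y => d t y k) x * w x k
            + θ * (tension (d t) x k * w x k)) := integral_finsetSum _ fun k _ => hterm k
        _ = _ := by
            refine Finset.sum_congr rfl fun k _ => ?_
            have j1 : ∀ i, IntegrableOn (fun x => v t x i * pd i (fun y => d t y k) x * w x k) Ω :=
              fun i => i1 k ((hv i).bddCont.mul ((hd k).reg1.bddCont_pd hΩ i))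
            have j2 : IntegrableOn (fun x => -∑ i, v t x i * pd i (fun y => d t y k) x * w x k) Ω :=
              (integrable_finsetSum _ fun i _ => j1 i).neg
            rw [integral_add j2 ((i1 k (hτ k)).const_mul θ), integral_neg,
              integral_finsetSum _ fun i _ => j1 i, integral_const_mul]
    rw [hinner]
    simp only [hparts, Fin.sum_univ_two]
    have q1 : ∀ i k, |∫ x in Ω, v t x i * d t x k * g i x k| ≤ Real.sqrt (C₁ * N) := fun i k =>
      abs_integral_mul_le ((bvd i k).memLp hΩ hb) (hg1 i k).1 (hg1 i k).2 (hV i k)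
    have q2 : ∀ i k, |∫ x in Ω, pd i (fun y => v t y i) x * d t x k * w x k| ≤ Real.sqrt N :=
      fun i k => abs_integral_mul_le ((bdv i k).memLp hΩ hb) (hw1 k).1 (hw1 k).2 (hDV i k)
    have q3 : ∀ k, |θ * ∫ x in Ω, tension (d t) x k * w x k| ≤ θ * Real.sqrt X := fun k => by
      rw [abs_mul, abs_of_pos hθ]
      exact mul_le_mul_of_nonneg_left (abs_integral_mul_le ((hτ k).memLp hΩ hb) (hw1 k).1 (hw1 k).2
        (h.integral_tension_sq_le hT hΩ hb hI k)) hθ.le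
    simp only [abs_le] at q1 q2 q3
    rw [abs_le]
    constructor
    · linarith [(q1 0 0).1, (q1 0 1).1, (q1 1 0).1, (q1 1 1).1, (q2 0 0).1, (q2 0 1).1,
        (q2 1 0).1, (q2 1 1).1, (q3 0).1, (q3 1).1]
    · linarith [(q1 0 0).2, (q1 0 1).2, (q1 1 0).2, (q1 1 1).2, (q2 0 0).2, (q2 0 1).2,
        (q2 1 0).2, (q2 1 1).2, (q3 0).2, (q3 1).2]
  calc dualH1Norm Ω (dt d t) ^ (2 : ℝ) ≤ ENNReal.ofReal B ^ (2 : ℝ) := by gcongr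
    _ = ENNReal.ofReal (B ^ (2 : ℝ)) := ENNReal.ofReal_rpow_of_nonneg hB0 (by norm_num)
    _ ≤ _ := by
        refine ENNReal.ofReal_le_ofReal ?_
        rw [Real.rpow_two]
        have s1 := Real.sq_sqrt (show 0 ≤ C₁ * N by positivity)
        have s2 := Real.sq_sqrt hN0
        have s3 := Real.sq_sqrt hX0
        have hq : ∀ a b c : ℝ, (a + b + c) ^ 2 ≤ 3 * (a ^ 2 + b ^ 2 + c ^ 2) := fun a b c => by
          nlinarith [sq_nonneg (a - b), sq_nonneg (b - c), sq_nonneg (a - c)]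
        refine (hq _ _ _).trans ?_
        rw [mul_pow, mul_pow, mul_pow, mul_pow, s1, s2, s3]
        have p1 : 0 ≤ C₁ * X := by positivity
        have p2 : 0 ≤ θ ^ 2 * N := by positivity
        linarith

end Solution

/-! ### Bounds in space-time -/

lemma integral_cyl {T : ℝ} {Ω : Set Plane} (hΩ : IsOpen Ω) (hb : Bornology.IsBounded Ω)
    {q : ℝ → Plane → ℝ} (hq : ContinuousOn (fun p : ℝ × Plane => q p.1 p.2) (Icc 0 T ×ˢ Ω))
    (hK : ∃ K, ∀ t ∈ Icc 0 T, ∀ x ∈ Ω, |q t x| ≤ K) :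
    IntegrableOn (fun p : ℝ × Plane => q p.1 p.2) (cyl T Ω) ∧
      ∫ p in cyl T Ω, q p.1 p.2 = ∫ t in Ioo 0 T, ∫ x in Ω, q t x := by
  obtain ⟨K, hK⟩ := hK
  have hfin : volume (cyl T Ω) < ⊤ := by
    rw [cyl, Measure.volume_eq_prod, Measure.prod_prod]
    exact ENNReal.mul_lt_top (by simp) hb.measure_lt_top
  have hm : MeasurableSet (cyl T Ω) := measurableSet_Ioo.prod hΩ.measurableSet
  have hint : IntegrableOn (fun p : ℝ × Plane => q p.1 p.2) (cyl T Ω) := by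
    refine IntegrableOn.of_bound hfin
      ((hq.mono (prod_mono_left Ioo_subset_Icc_self)).aestronglyMeasurable hm) K ?_
    filter_upwards [ae_restrict_mem hm] with p hp
    exact hK p.1 (Ioo_subset_Icc_self hp.1) p.2 hp.2
  refine ⟨hint, ?_⟩
  rw [cyl, Measure.volume_eq_prod] at hint ⊢
  exact setIntegral_prod _ hint

lemma integrableOn_slices {T : ℝ} {Ω : Set Plane} (hΩ : IsOpen Ω) (hb : Bornology.IsBounded Ω)
    {q : ℝ → Plane → ℝ} (hq : ContinuousOn (fun p : ℝ × Plane => q p.1 p.2) (Icc 0 T ×ˢ Ω))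
    (hK : ∃ K, ∀ t ∈ Icc 0 T, ∀ x ∈ Ω, |q t x| ≤ K) :
    IntegrableOn (fun t => ∫ x in Ω, q t x) (Ioo 0 T) :=
  (continuousOn_setIntegral hΩ hb hq hK).integrableOn_Icc.mono_set Ioo_subset_Icc_self

lemma norm_hess_sq (u : Plane → Plane) (x : Plane) :
    ‖hess u x‖ ^ 2 = ∑ i, ∑ j, ∑ k, pd i (pd j fun y => u y k) x ^ 2 := by
  rw [EuclideanSpace.norm_sq_eq, Fintype.sum_prod_type]
  simp only [Fintype.sum_prod_type, hess, Real.norm_eq_abs, sq_abs]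

/-- The `L^{4/3}` norm in time of `‖∂ₜd‖_{L²}` involves the power `2/3` of `Y = ‖∂ₜd‖²`. By it the
product `N √L` of two quantities integrable in time is reduced to their sum. -/
lemma rpow_two_thirds_le {Y C N L X : ℝ} (hY : 0 ≤ Y) (hC : 0 ≤ C) (hN : 0 ≤ N) (hL : 0 ≤ L)
    (hX : 0 ≤ X) (h : Y ≤ C * (N * Real.sqrt L + X)) :
    Y ^ (2 / 3 : ℝ) ≤ (1 + 2 * C) * (1 + N + L + X) := by
  set Z := 1 + N + L + X with hZ
  have hZ1 : 1 ≤ Z := by linarith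
  set W := (1 + 2 * C) * Z with hW
  have hWZ : Z ≤ W := by nlinarith
  have hW0 : 0 ≤ W := by linarith
  have hsq : 1 ≤ Real.sqrt Z := Real.one_le_sqrt.2 hZ1
  have h1 : N * Real.sqrt L ≤ Z * Real.sqrt Z :=
    mul_le_mul (by linarith) (Real.sqrt_le_sqrt (by linarith)) (Real.sqrt_nonneg _) (by linarith)
  have h2 : X ≤ Z * Real.sqrt Z := by nlinarith
  have h3 : Y ≤ W * Real.sqrt W := by
    calc Y ≤ C * (N * Real.sqrt L + X) := h
      _ ≤ C * (2 * (Z * Real.sqrt Z)) := mul_le_mul_of_nonneg_left (by linarith) hC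
      _ ≤ W * Real.sqrt Z := by
        have : 0 ≤ Z * Real.sqrt Z := by positivity
        rw [hW]; linarith
      _ ≤ W * Real.sqrt W := mul_le_mul_of_nonneg_left (Real.sqrt_le_sqrt hWZ) hW0
  have hW1 : 0 < W := by linarith
  have h4 : W * Real.sqrt W = W ^ (3 / 2 : ℝ) := by
    rw [Real.sqrt_eq_rpow, ← Real.rpow_one_add' hW0 (by norm_num)]
    norm_num
  rw [h4] at h3
  calc Y ^ (2 / 3 : ℝ) ≤ (W ^ (3 / 2 : ℝ)) ^ (2 / 3 : ℝ) := Real.rpow_le_rpow hY h3 (by norm_num)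
    _ = W := by rw [← Real.rpow_mul hW0]; norm_num

section Solution

variable {A γ μ lam ν θ T r : ℝ} {Ω : Set Plane} {ρ₀ : Plane → ℝ} {m₀ d₀ : Plane → Plane}
  {ρ : ℝ → Plane → ℝ} {v d : ℝ → Plane → Plane}
  (h : IsClassicalSolution A γ μ lam ν θ T Ω ρ₀ m₀ d₀ ρ v d)

include h

lemma IsClassicalSolution.continuousOn_norm_hess_sq (hT : 0 < T) (hΩ : IsOpen Ω)
    (hb : Bornology.IsBounded Ω) :
    ContinuousOn (fun p : ℝ × Plane => ‖hess (d p.1) p.2‖ ^ 2) (Icc 0 T ×ˢ Ω) := by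
  simp only [norm_hess_sq]
  exact continuousOn_finsetSum _ fun i _ => continuousOn_finsetSum _ fun j _ =>
    continuousOn_finsetSum _ fun k _ =>
      (((h.reg_director k).spaceReg2 hT hΩ hb).continuousOn_pd_pd hΩ i j).pow 2

lemma IsClassicalSolution.exists_norm_hess_sq_le (hT : 0 < T) (hΩ : IsOpen Ω)
    (hb : Bornology.IsBounded Ω) :
    ∃ K, ∀ t ∈ Icc 0 T, ∀ x ∈ Ω, |‖hess (d t) x‖ ^ 2| ≤ K := by
  choose a ha0 ha using fun k => ((h.reg_director k).spaceReg2 hT hΩ hb).bdd_pd_pd hΩ hb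
  refine ⟨∑ _i : Fin 2, ∑ _j : Fin 2, ∑ k, a k ^ 2, fun t ht x hx => ?_⟩
  rw [abs_of_nonneg (by positivity), norm_hess_sq]
  exact Finset.sum_le_sum fun i _ => Finset.sum_le_sum fun j _ => Finset.sum_le_sum fun k _ =>
    sq_le_sq' (neg_le_of_abs_le (ha k i j t ht x hx)) (le_of_abs_le (ha k i j t ht x hx))

lemma IsClassicalSolution.integral_hess_zero_le (hT : 0 < T) (hΩ : IsOpen Ω)
    (hb : Bornology.IsBounded Ω) (hd₀ : ∀ x ∈ Ω, ‖d₀ x‖ = 1) :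
    ∫ x in Ω, ‖hess (d 0) x‖ ^ 2 ≤ (h2Norm Ω d₀).toReal ^ 2 := by
  have hI0 : (0 : ℝ) ∈ Icc 0 T := ⟨le_rfl, hT.le⟩
  have hk : ∀ k, EqOn (fun x => d 0 x k) (fun x => d₀ x k) Ω := fun k x hx => by
    simp only [h.init_director x hx]
  have hpd : ∀ i k, EqOn (pd i fun x => d 0 x k) (pd i fun x => d₀ x k) Ω := fun i k x hx =>
    pd_congr_on hΩ (hk k) i hx
  have hgrad : ∀ x ∈ Ω, ‖grad (d 0) x‖ ^ 2 = ‖grad d₀ x‖ ^ 2 := fun x hx => by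
    rw [norm_grad_sq, norm_grad_sq]
    exact Finset.sum_congr rfl fun i _ => Finset.sum_congr rfl fun k _ => by rw [hpd i k hx]
  have hhess : ∀ x ∈ Ω, ‖hess (d 0) x‖ ^ 2 = ‖hess d₀ x‖ ^ 2 := fun x hx => by
    rw [norm_hess_sq, norm_hess_sq]
    exact Finset.sum_congr rfl fun i _ => Finset.sum_congr rfl fun j _ =>
      Finset.sum_congr rfl fun k _ => by rw [pd_congr_on hΩ (hpd j k) i hx]
  have i0 : IntegrableOn (fun x => ‖d₀ x‖ ^ 2) Ω :=
    ((bddCont_const 1).integrableOn hΩ hb).congr_fun (fun x hx => by simp [hd₀ x hx])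
      hΩ.measurableSet
  have i1 : IntegrableOn (fun x => ‖grad d₀ x‖ ^ 2) Ω :=
    (integrableOn_norm_grad_sq hΩ hb fun k =>
      (h.reg_director k).spaceReg2 hT hΩ hb |>.reg2_slice hΩ hb hI0).congr_fun hgrad
        hΩ.measurableSet
  have i2 : IntegrableOn (fun x => ‖hess d₀ x‖ ^ 2) Ω := by
    obtain ⟨K, hK⟩ := h.exists_norm_hess_sq_le hT hΩ hb
    exact (integrableOn_of_bdd hΩ hb ((h.continuousOn_norm_hess_sq hT hΩ hb).comp
      (f := fun x => ((0 : ℝ), x)) (by fun_prop) fun x hx => ⟨hI0, hx⟩) ⟨K, hK 0 hI0⟩).congr_fun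
        hhess hΩ.measurableSet
  have hsq : ∀ {F : Type} [NormedAddCommGroup F] {f : Plane → F},
      IntegrableOn (fun x => ‖f x‖ ^ 2) Ω →
      lpNormSpace Ω 2 f ^ 2 = ENNReal.ofReal (∫ x in Ω, ‖f x‖ ^ 2) := fun hf => by
    rw [← eLpNorm_two_rpow hf, lpNormSpace, ENNReal.rpow_two]
  rw [setIntegral_congr_fun hΩ.measurableSet hhess, h2Norm, hsq i0, hsq i1, hsq i2,
    ← ENNReal.toReal_pow, ← ENNReal.rpow_natCast, ← ENNReal.rpow_mul]
  have n0 : 0 ≤ ∫ x in Ω, ‖d₀ x‖ ^ 2 := integral_nonneg fun x => by positivity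
  have n1 : 0 ≤ ∫ x in Ω, ‖grad d₀ x‖ ^ 2 := integral_nonneg fun x => by positivity
  have n2 : 0 ≤ ∫ x in Ω, ‖hess d₀ x‖ ^ 2 := integral_nonneg fun x => by positivity
  rw [← ENNReal.ofReal_add n0 n1, ← ENNReal.ofReal_add (by positivity) n2]
  norm_num
  rw [ENNReal.toReal_ofReal (by positivity)]
  linarith

end Solution

set_option maxHeartbeats 1000000 in
/-- The bounds for the director in space-time, with their constant. -/
theorem exists_director_bound (μ ν θ T : ℝ) (α : ℝ≥0) (Ω : Set Plane) (hμ : 0 < μ) (hν : 0 < ν)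
    (hθ : 0 < θ) (hT : 0 < T) (hΩ : IsOpen Ω) (hb : Bornology.IsBounded Ω)
    (hα : HasC2HolderBoundary α Ω) :
    ∃ c₃ : ℝ → ℝ → ℝ, (∀ h e, 0 < c₃ h e) ∧ Monotone (Function.uncurry c₃) ∧
        ∀ (A γ lam ρinf : ℝ) (ρ₀ : Plane → ℝ) (m₀ d₀ : Plane → Plane)
          (ρ : ℝ → Plane → ℝ) (v d : ℝ → Plane → Plane),
          0 < A → 1 < γ → 0 ≤ lam + μ → 0 ≤ ρinf →
          (∀ x ∈ Ω, 0 ≤ ρ₀ x) → (∀ x ∈ Ω, ‖d₀ x‖ = 1) →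
          IsClassicalSolution A γ μ lam ν θ T Ω ρ₀ m₀ d₀ ρ v d →
          lpNormCyl T Ω 2 (fun t => hess (d t))
              + lpNormCyl T Ω 4 (fun t => grad (d t))
              + lpNormTime T (4 / 3) (fun t => lpNormSpace Ω 2 (dt d t))
              + lpNormTime T 2 (fun t => dualH1Norm Ω (dt d t))
            ≤ ENNReal.ofReal
                (c₃ (h2Norm Ω d₀).toReal (energy A γ ν ρinf Ω ρ₀ m₀ d₀)) := by
  obtain ⟨C₁, hC₁, hdir⟩ := exists_director_bounds hΩ hb hα
  obtain ⟨C₂, hC₂, hdt⟩ := exists_dt_sq_le hΩ hb hα θ hθ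
  obtain ⟨C₃, hC₃, hdual⟩ := exists_dualH1Norm_sq_le hΩ hb θ hθ
  set a := 1 / (ν * θ) + T * (2 / ν) + T with ha
  set b := 1 + 2 / ν with hbdef
  have ha0 : 0 < a := by positivity
  have hb0 : 0 < b := by positivity
  set P := C₁ * (a * b) with hP
  have hP0 : 0 ≤ P := by positivity
  set q := 1 / μ + 1 / (ν * θ) with hq
  have hq0 : 0 < q := by positivity
  set K := 4 + 2 * P + (1 + 2 * C₂) * (T + q + P) + C₃ * q with hK
  have hK0 : 0 < K := by positivity
  refine ⟨fun h e => K * (1 + max h 0 ^ 2 + max e 0) ^ 2, fun h e => by positivity, ?_, ?_⟩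
  · rintro ⟨h, e⟩ ⟨h', e'⟩ ⟨hh, he⟩
    simp only [Function.uncurry_apply_pair]
    have h1 := max_le_max_right 0 hh
    have h2 := max_le_max_right 0 he
    gcongr
  intro A γ lam ρinf ρ₀ m₀ d₀ ρ v d hA hγ hlam hρinf hρ₀ hd₀ sol
  obtain ⟨he0, -, hU, hN, hX⟩ := sol.energy_bounds hA hγ hμ hν hθ hlam hρinf hT hΩ hb hρ₀ hd₀
  have hH := sol.integral_hess_zero_le hT hΩ hb hd₀
  set e := energy A γ ν ρinf Ω ρ₀ m₀ d₀ with he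
  set h := (h2Norm Ω d₀).toReal with hh
  have hh0 : 0 ≤ h := ENNReal.toReal_nonneg
  dsimp only
  rw [max_eq_left hh0, max_eq_left he0]
  set E := 1 + h ^ 2 + e with hE
  have hE1 : 1 ≤ E := by linarith [sq_nonneg h]
  have hEE : E ≤ E ^ 2 := le_self_pow₀ hE1 two_ne_zero
  have hdreg := fun k => (sol.reg_director k).spaceReg2 hT hΩ hb
  have hvreg := fun k => ((sol.reg_velocity k).spaceReg2 hT hΩ hb).reg1
  -- integrability of the quantities in question
  have cN := continuousOn_norm_grad_sq hvreg
  have kN := exists_norm_grad_sq_le hb hvreg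
  have cX := sol.continuousOn_tension hT hΩ hb
  have kX := sol.exists_tension_le hT hΩ hb
  have cS := sol.continuousOn_norm_hess_sq hT hΩ hb
  have kS := sol.exists_norm_hess_sq_le hT hΩ hb
  have cL : ContinuousOn (fun p : ℝ × Plane => ‖grad (d p.1) p.2‖ ^ 4) (Icc 0 T ×ˢ Ω) :=
    ((continuousOn_norm_grad_sq fun k => (hdreg k).reg1).pow 2).congr fun p _ => by
      simp only [Pi.pow_apply]; ring
  have kL : ∃ K, ∀ t ∈ Icc 0 T, ∀ x ∈ Ω, |‖grad (d t) x‖ ^ 4| ≤ K := by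
    obtain ⟨K, hK⟩ := exists_norm_grad_sq_le hb fun k => (hdreg k).reg1
    refine ⟨K ^ 2, fun t ht x hx => ?_⟩
    rw [show ‖grad (d t) x‖ ^ 4 = (‖grad (d t) x‖ ^ 2) ^ 2 by ring, abs_pow]
    exact pow_le_pow_left₀ (abs_nonneg _) (hK t ht x hx) 2
  have iN := integrableOn_slices hΩ hb cN kN
  have iX := integrableOn_slices hΩ hb cX kX
  have iS := integrableOn_slices hΩ hb cS kS
  have iL := integrableOn_slices hΩ hb cL kL
  have iC : ∀ c : ℝ, IntegrableOn (fun _ => c) (Ioo 0 T) := fun c => by simp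
  have hCT : ∀ c : ℝ, ∫ _ in Ioo 0 T, c = T * c := fun c => by
    rw [setIntegral_const]; simp [hT.le]
  -- the bounds of the second derivatives, integrated in time
  have hsl := fun t ht => hdir A γ μ lam ν θ T ρ₀ m₀ d₀ ρ v d sol hT hθ hd₀ _ _ hU hH t ht
  have hU0 : 0 ≤ 2 / ν * e := by positivity
  have hXint : ∫ t in Ioo 0 T, ((∫ x in Ω, ∑ k, tension (d t) x k ^ 2) + 2 / ν * e + h ^ 2)
      ≤ a * E := by
    have i1 : IntegrableOn (fun t => (∫ x in Ω, ∑ k, tension (d t) x k ^ 2) + 2 / ν * e)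
        (Ioo 0 T) := iX.add (iC _)
    rw [integral_add i1 (iC _), integral_add iX (iC _), hCT, hCT]
    have p1 : 0 ≤ 1 / (ν * θ) * (1 + h ^ 2) := by positivity
    have p2 : 0 ≤ T * (2 / ν) * (1 + h ^ 2) := by positivity
    have p3 : 0 ≤ T * (1 + e) := by positivity
    rw [ha, hE]
    linarith
  have iX' : IntegrableOn (fun t => (∫ x in Ω, ∑ k, tension (d t) x k ^ 2) + 2 / ν * e + h ^ 2)
      (Ioo 0 T) := (iX.add (iC _)).add (iC _)
  have hbE : 1 + 2 / ν * e ≤ b * E := by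
    have p1 : 0 ≤ 2 / ν * (1 + h ^ 2) := by positivity
    rw [hbdef, hE]
    linarith [sq_nonneg h]
  have hint : ∀ {Q : ℝ → ℝ} {c : ℝ}, IntegrableOn Q (Ioo 0 T) → 0 ≤ c → c ≤ b * E →
      (∀ t ∈ Ioo 0 T, Q t ≤ C₁ * (c *
        ((∫ x in Ω, ∑ k, tension (d t) x k ^ 2) + 2 / ν * e + h ^ 2))) →
      ∫ t in Ioo 0 T, Q t ≤ P * E ^ 2 := by
    intro Q c hQ hc hcb hle
    refine (setIntegral_mono_on hQ ((iX'.const_mul c).const_mul C₁) measurableSet_Ioo hle).trans ?_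
    rw [integral_const_mul, integral_const_mul]
    calc C₁ * (c * ∫ t in Ioo 0 T, ((∫ x in Ω, ∑ k, tension (d t) x k ^ 2) + 2 / ν * e + h ^ 2))
        ≤ C₁ * (b * E * (a * E)) := by gcongr
      _ = P * E ^ 2 := by rw [hP]; ring
  have hLint := hint iL hU0 (by linarith) fun t ht => (hsl t ht).1
  have hSint := hint iS (by linarith) hbE fun t ht => (hsl t ht).2
  have hqE : (∫ t in Ioo 0 T, ∫ x in Ω, ‖grad (v t) x‖ ^ 2)
      + (∫ t in Ioo 0 T, ∫ x in Ω, ∑ k, tension (d t) x k ^ 2) ≤ q * E ^ 2 := by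
    have p1 : q * e ≤ q * E ^ 2 :=
      mul_le_mul_of_nonneg_left (by linarith [sq_nonneg h]) hq0.le
    rw [hq] at p1 ⊢
    linarith
  -- the four norms
  have n1 : lpNormCyl T Ω 2 (fun t => hess (d t)) ≤ ENNReal.ofReal (1 + P * E ^ 2) := by
    obtain ⟨j1, j2⟩ := integral_cyl hΩ hb cS kS
    exact eLpNorm_le_one_add two_eq_ofReal (by norm_num) j1 (.of_forall fun p => by positivity)
      (.of_forall fun p => (enorm_rpow_two_eq _).le) (j2.trans_le hSint)
  have n2 : lpNormCyl T Ω 4 (fun t => grad (d t)) ≤ ENNReal.ofReal (1 + P * E ^ 2) := by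
    obtain ⟨j1, j2⟩ := integral_cyl hΩ hb cL kL
    refine eLpNorm_le_one_add (p := 4) (by simp) (by norm_num) j1
      (.of_forall fun p => by positivity) (.of_forall fun p => le_of_eq ?_) (j2.trans_le hLint)
    rw [← ofReal_norm, ENNReal.ofReal_rpow_of_nonneg (norm_nonneg _) (by norm_num)]
    norm_num [Function.uncurry]
  have n3 : lpNormTime T (4 / 3) (fun t => lpNormSpace Ω 2 (dt d t))
      ≤ ENNReal.ofReal (1 + (1 + 2 * C₂) * (T + q + P) * E ^ 2) := by
    have hz0 : ∀ t, 0 ≤ (1 + 2 * C₂) * (1 + (∫ x in Ω, ‖grad (v t) x‖ ^ 2)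
        + (∫ x in Ω, ‖grad (d t) x‖ ^ 4) + ∫ x in Ω, ∑ k, tension (d t) x k ^ 2) := fun t => by
      positivity
    refine eLpNorm_le_one_add (p := 4 / 3) ?_ (by norm_num)
      (((((iC 1).add iN).add iL).add iX).const_mul (1 + 2 * C₂)) (.of_forall fun t => hz0 t) ?_ ?_
    · rw [ENNReal.ofReal_div_of_pos (by norm_num)]; simp
    · filter_upwards [ae_restrict_mem measurableSet_Ioo] with t ht
      obtain ⟨hi, hle⟩ := hdt A γ μ lam ν T ρ₀ m₀ d₀ ρ v d sol hT hd₀ t ht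
      have hY0 : 0 ≤ ∫ x in Ω, ‖dt d t x‖ ^ 2 := integral_nonneg fun x => by positivity
      rw [enorm_eq_self, lpNormSpace, show (4 / 3 : ℝ) = 2 * (2 / 3) by norm_num,
        ENNReal.rpow_mul, eLpNorm_two_rpow hi, ENNReal.ofReal_rpow_of_nonneg hY0 (by norm_num)]
      exact ENNReal.ofReal_le_ofReal (rpow_two_thirds_le hY0 hC₂
        (integral_nonneg fun x => by positivity) (integral_nonneg fun x => by positivity)
        (integral_nonneg fun x => by positivity) hle)
    · simp only [Pi.add_apply]
      have k1 : IntegrableOn (fun t => 1 + ∫ x in Ω, ‖grad (v t) x‖ ^ 2) (Ioo 0 T) :=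
        (iC 1).add iN
      have k2 : IntegrableOn (fun t => 1 + (∫ x in Ω, ‖grad (v t) x‖ ^ 2)
        + ∫ x in Ω, ‖grad (d t) x‖ ^ 4) (Ioo 0 T) := k1.add iL
      rw [integral_const_mul, integral_add k2 iX, integral_add k1 iL, integral_add (iC 1) iN, hCT,
        mul_assoc]
      refine mul_le_mul_of_nonneg_left ?_ (by positivity)
      have p1 : T * 1 ≤ T * E ^ 2 := by gcongr; linarith
      linarith
  have n4 : lpNormTime T 2 (fun t => dualH1Norm Ω (dt d t))
      ≤ ENNReal.ofReal (1 + C₃ * q * E ^ 2) := by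
    refine eLpNorm_le_one_add two_eq_ofReal (by norm_num) ((iN.add iX).const_mul C₃)
      (.of_forall fun t => ?_) ?_ ?_
    · simp only [Pi.add_apply]; positivity
    · filter_upwards [ae_restrict_mem measurableSet_Ioo] with t ht
      rw [enorm_eq_self]
      exact hdual A γ μ lam ν T ρ₀ m₀ d₀ ρ v d sol hT hd₀ t ht
    · rw [integral_const_mul, integral_add' iN iX, mul_assoc]
      exact mul_le_mul_of_nonneg_left hqE hC₃
  refine (add_le_add (add_le_add (add_le_add n1 n2) n3) n4).trans ?_
  rw [← ENNReal.ofReal_add (by positivity) (by positivity),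
    ← ENNReal.ofReal_add (by positivity) (by positivity),
    ← ENNReal.ofReal_add (by positivity) (by positivity)]
  refine ENNReal.ofReal_le_ofReal ?_
  rw [hK]
  linarith

end NematicFlow

theorem proposition2p1 :
    -- the energy bound, in every bounded domain
    (∀ A γ μ ν θ : ℝ, 0 < A → 1 < γ → 0 < μ → 0 < ν → 0 < θ →
      ∃ c₂ : ℝ → ℝ → ℝ, (∀ b e, 0 < c₂ b e) ∧ Monotone (Function.uncurry c₂) ∧
        ∀ (lam ρinf T : ℝ) (Ω : Set Plane) (ρ₀ : Plane → ℝ) (m₀ d₀ : Plane → Plane)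
          (ρ : ℝ → Plane → ℝ) (v d : ℝ → Plane → Plane),
          0 ≤ lam + μ → 0 ≤ ρinf → 0 < T → IsBoundedDomain Ω →
          (∀ x ∈ Ω, 0 ≤ ρ₀ x) → (∀ x ∈ Ω, ‖d₀ x‖ = 1) →
          IsClassicalSolution A γ μ lam ν θ T Ω ρ₀ m₀ d₀ ρ v d →
          ∀ t ∈ Set.Icc 0 T,
            lpNormSpace Ω 2 (fun x => Real.sqrt (ρ t x) • v t x)
                + lpNormSpace Ω (ENNReal.ofReal γ) (ρ t)
                + lpNormSpace Ω 2 (grad (d t))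
                + lpNormTime T 2 (fun s => lpNormSpace Ω 2 (grad (v s)))
              ≤ ENNReal.ofReal
                  (c₂ (ρinf ^ γ * (volume Ω).toReal) (energy A γ ν ρinf Ω ρ₀ m₀ d₀))) ∧
    -- the further bounds on the director, for small initial energy
    (∀ (μ ν θ T : ℝ) (α : ℝ≥0) (Ω : Set Plane),
      0 < μ → 0 < ν → 0 < θ → 0 < T → 0 < α → α < 1 →
      IsBoundedDomain Ω → HasC2HolderBoundary α Ω →
      ∃ c₃ : ℝ → ℝ → ℝ, (∀ h e, 0 < c₃ h e) ∧ Monotone (Function.uncurry c₃) ∧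
        ∀ (A γ lam ρinf : ℝ) (ρ₀ : Plane → ℝ) (m₀ d₀ : Plane → Plane)
          (ρ : ℝ → Plane → ℝ) (v d : ℝ → Plane → Plane),
          0 < A → 1 < γ → 0 ≤ lam + μ → 0 ≤ ρinf →
          (∀ x ∈ Ω, 0 ≤ ρ₀ x) → (∀ x ∈ Ω, ‖d₀ x‖ = 1) →
          IsClassicalSolution A γ μ lam ν θ T Ω ρ₀ m₀ d₀ ρ v d →
          energy A γ ν ρinf Ω ρ₀ m₀ d₀ < ν / 4096 →
          lpNormCyl T Ω 2 (fun t => hess (d t))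
              + lpNormCyl T Ω 4 (fun t => grad (d t))
              + lpNormTime T (4 / 3) (fun t => lpNormSpace Ω 2 (dt d t))
              + lpNormTime T 2 (fun t => dualH1Norm Ω (dt d t))
            ≤ ENNReal.ofReal
                (c₃ (h2Norm Ω d₀).toReal (energy A γ ν ρinf Ω ρ₀ m₀ d₀))) :=
  ⟨exists_energy_bound, fun μ ν θ T α Ω hμ hν hθ hT _ _ hΩ hα => by
    obtain ⟨c, hc, hmono, h⟩ :=
      exists_director_bound μ ν θ T α Ω hμ hν hθ hT hΩ.isOpen hΩ.isBounded hα
    exact ⟨c, hc, hmono, fun A γ lam r ρ₀ m₀ d₀ ρ v d hA hγ hlam hr hρ₀ hd₀ sol _ =>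
      h A γ lam r ρ₀ m₀ d₀ ρ v d hA hγ hlam hr hρ₀ hd₀ sol⟩⟩
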